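/- Let $n\ge 3$, let $g=(g_{jk})$ be a $C^\infty$ Riemannian metric on $\mathbb{R}^n$ and let $q\in L^{n/2}_{\mathrm{loc}}(\mathbb{R}^n;\mathbb{C})$, both periodic with respect to the lattice $2\pi\mathbb{Z}^n$. Write $(g^{jk})=(g_{jk})^{-1}$, $|g|=\det(g_{jk})$, $D_{x_j}=i^{-1}\partial_{x_j}$, $\mathbb{T}^n=\mathbb{R}^n/2\pi\mathbb{Z}^n$; repeated indices are summed from $1$ to $n$, and all $L^2$ inner products are taken with respect to $|g|^{1/2}dx$. Let $H=-\Delta_g+q$ be the operator on $L^2(\mathbb{R}^n)$ associated with the sesquilinear form \[ h[u,v]=\int_{\mathbb{R}^n} g^{jk}D_{x_k}u\,\overline{D_{x_j}v}\,|g|^{1/2}dx+\int_{\mathbb{R}^n}qu\overline{v}\,|g|^{1/2}dx,\qquad u,v\in H^1(\mathbb{R}^n), \] that is, $u\in\mathcal{D}(H)$ and $Hu=f$ if and only if $u\in H^1(\mathbb{R}^n)$, $f\in L^2(\mathbb{R}^n)$ and $h[u,v]=(f,v)_{L^2(\mathbb{R}^n)}$ for all $v\in H^1(\mathbb{R}^n)$.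 For $\theta\in\mathbb{C}^n$ let $H(\theta)=e^{-ix\cdot\theta}He^{ix\cdot\theta}$ be the operator on $L^2(\mathbb{T}^n)$ associated in the same way with the form \[ h(\theta)[u,v]=\int_{\mathbb{T}^n} g^{jk}\left(D_{x_k}u\,\overline{D_{x_j}v}+\theta_k u\,\overline{D_{x_j}v}+\theta_j (D_{x_k}u)\overline{v}+\theta_k\theta_j u\overline{v}\right)|g|^{1/2}dx+\int_{\mathbb{T}^n}qu\overline{v}\,|g|^{1/2}dx, \] $u,v\in H^1(\mathbb{T}^n)$. Let $\lambda\in\mathbb{C}$. If there exists $\theta\in\mathbb{C}^n$ such that the operator $H(\theta)-\lambda$, acting on $L^2(\mathbb{T}^n)$, has trivial kernel, then $\lambda$ is not an eigenvalue of the operator $H$, acting on $L^2(\mathbb{R}^n)$. -/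

import Mathlib

open MeasureTheory
open scoped ContDiff

noncomputable section

namespace PeriodicSchrodinger

/-- The Euclidean space of dimension `n`. -/
abbrev Space (n : ℕ) : Type := EuclideanSpace ℝ (Fin n)

/-- The lattice vector `2πk`, for `k` an integer vector. -/
def latticeVec {n : ℕ} (k : Fin n → ℤ) : Space n :=
  WithLp.toLp 2 fun i => 2 * Real.pi * (k i : ℝ)

/-- Functions that are periodic with respect to the lattice `2πℤⁿ`, that is, functions on the
torus `𝕋ⁿ = ℝⁿ/2πℤⁿ`. -/
def IsPeriodic {n : ℕ} {α : Type*} (f : Space n → α) : Prop :=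
  ∀ (k : Fin n → ℤ) (x : Space n), f (x + latticeVec k) = f x

/-- The open fundamental cell `(0,2π)ⁿ`. -/
def cell (n : ℕ) : Set (Space n) := {x | ∀ i, x i ∈ Set.Ioo 0 (2 * Real.pi)}

/-- Lebesgue measure on the fundamental cell. Integrals of periodic functions over the torus are
integrals with respect to this measure. -/
def cellMeasure (n : ℕ) : Measure (Space n) := volume.restrict (cell n)

/-- The classical partial derivative `∂φ/∂xᵢ`. -/
def partialDeriv {n : ℕ} (i : Fin n) (φ : Space n → ℂ) (x : Space n) : ℂ :=
  fderiv ℝ φ x (EuclideanSpace.single i 1)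

/-- A smooth `2πℤⁿ`-periodic Riemannian metric on `ℝⁿ`, given by its matrix `(g_{jk}(x))`. -/
structure PeriodicMetric (n : ℕ) where
  mat : Space n → Matrix (Fin n) (Fin n) ℝ
  smooth : ∀ j k, ContDiff ℝ ∞ fun x => mat x j k
  posDef : ∀ x, (mat x).PosDef
  periodic : IsPeriodic mat

/-- The coefficient `g^{jk}(x)` of the inverse matrix. -/
def PeriodicMetric.inv {n : ℕ} (g : PeriodicMetric n) (x : Space n) (j k : Fin n) : ℝ :=
  (g.mat x)⁻¹ j k

/-- The Riemannian density `|g|^{1/2}(x)`. -/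
def PeriodicMetric.density {n : ℕ} (g : PeriodicMetric n) (x : Space n) : ℝ :=
  Real.sqrt (g.mat x).det

/-- A complex periodic potential of class `L^{n/2}_loc(ℝⁿ)`. Periodicity is almost everywhere, as
befits an equivalence class of functions. -/
structure IsPeriodicPotential {n : ℕ} (q : Space n → ℂ) : Prop where
  memLp_loc : ∀ K : Set (Space n), IsCompact K → MemLp q ((n : ENNReal) / 2) (volume.restrict K)
  periodic : ∀ k : Fin n → ℤ, (fun x => q (x + latticeVec k)) =ᵐ[volume] q

/-- (A representative of) an element of the Sobolev space `H¹(ℝⁿ)`, together with its weak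
gradient, which is unique up to null sets. -/
structure SobolevSpace (n : ℕ) where
  toFun : Space n → ℂ
  grad : Fin n → Space n → ℂ
  memLp : MemLp toFun 2 volume
  memLp_grad : ∀ i, MemLp (grad i) 2 volume
  weak : ∀ (i : Fin n) (φ : Space n → ℂ), ContDiff ℝ ∞ φ → HasCompactSupport φ →
    ∫ x, toFun x * partialDeriv i φ x = -∫ x, grad i x * φ x

/-- The derivative `D_{x_k} u = i⁻¹ ∂u/∂x_k`. -/
def SobolevSpace.D {n : ℕ} (u : SobolevSpace n) (k : Fin n) (x : Space n) : ℂ :=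
  Complex.I⁻¹ * u.grad k x

/-- (A representative of) an element of `L²(𝕋ⁿ)`. -/
structure MemL2Torus {n : ℕ} (u : Space n → ℂ) : Prop where
  periodic : IsPeriodic u
  memLp : MemLp u 2 (cellMeasure n)

/-- (A representative of) an element of the Sobolev space `H¹(𝕋ⁿ)`, together with its weak
gradient, which is unique up to null sets. Test functions are the smooth functions on the torus. -/
structure TorusSobolevSpace (n : ℕ) where
  toFun : Space n → ℂ
  grad : Fin n → Space n → ℂ
  memL2 : MemL2Torus toFun
  memL2_grad : ∀ i, MemL2Torus (grad i)
  weak : ∀ (i : Fin n) (φ : Space n → ℂ), ContDiff ℝ ∞ φ → IsPeriodic φ →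
    ∫ x, toFun x * partialDeriv i φ x ∂(cellMeasure n) = -∫ x, grad i x * φ x ∂(cellMeasure n)

/-- The derivative `D_{x_k} u = i⁻¹ ∂u/∂x_k`. -/
def TorusSobolevSpace.D {n : ℕ} (u : TorusSobolevSpace n) (k : Fin n) (x : Space n) : ℂ :=
  Complex.I⁻¹ * u.grad k x

open scoped ComplexConjugate

/-- The sesquilinear form `h[u,v]` with domain `H¹(ℝⁿ)`. -/
def form {n : ℕ} (g : PeriodicMetric n) (q : Space n → ℂ) (u v : SobolevSpace n) : ℂ :=
  (∫ x, (∑ j, ∑ k, (g.inv x j k : ℂ) * (u.D k x * conj (v.D j x))) * (g.density x : ℂ))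
    + ∫ x, q x * u.toFun x * conj (v.toFun x) * (g.density x : ℂ)

/-- The form `w[θ][u,v]` on `H¹(𝕋ⁿ)`, for a complex quasimomentum `θ`. -/
def torusFormLower {n : ℕ} (g : PeriodicMetric n) (q : Space n → ℂ) (θ : Fin n → ℂ)
    (u v : TorusSobolevSpace n) : ℂ :=
  (∫ x, (∑ j, ∑ k, (g.inv x j k : ℂ) *
      (θ k * u.toFun x * conj (v.D j x) + u.D k x * θ j * conj (v.toFun x)
        + θ k * θ j * u.toFun x * conj (v.toFun x))) * (g.density x : ℂ) ∂(cellMeasure n))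
    + ∫ x, q x * u.toFun x * conj (v.toFun x) * (g.density x : ℂ) ∂(cellMeasure n)

/-- The sesquilinear form `h(θ)[u,v]` with domain `H¹(𝕋ⁿ)`. -/
def torusForm {n : ℕ} (g : PeriodicMetric n) (q : Space n → ℂ) (θ : Fin n → ℂ)
    (u v : TorusSobolevSpace n) : ℂ :=
  (∫ x, (∑ j, ∑ k, (g.inv x j k : ℂ) * (u.D k x * conj (v.D j x))) * (g.density x : ℂ)
      ∂(cellMeasure n))
    + torusFormLower g q θ u v

/-- The graph of the operator `H = -Δ_g + q` on `L²(ℝⁿ; |g|^{1/2}dx)` associated with the form `h`: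
`u ∈ 𝒟(H)` and `H u = f`. Since `|g|^{1/2}` lies between two positive constants, this `L²` space
consists of the same functions as the one for Lebesgue measure; its inner product is weighted by
`|g|^{1/2}`. -/
def OperatorGraph {n : ℕ} (g : PeriodicMetric n) (q : Space n → ℂ)
    (u : SobolevSpace n) (f : Space n → ℂ) : Prop :=
  MemLp f 2 volume ∧
    ∀ v : SobolevSpace n, form g q u v = ∫ x, f x * conj (v.toFun x) * (g.density x : ℂ)

/-- The graph of the operator `H(θ)` on `L²(𝕋ⁿ; |g|^{1/2}dx)` associated with the form `h(θ)`:
`u ∈ 𝒟(H(θ))` and `H(θ) u = f`. -/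
def TorusOperatorGraph {n : ℕ} (g : PeriodicMetric n) (q : Space n → ℂ) (θ : Fin n → ℂ)
    (u : TorusSobolevSpace n) (f : Space n → ℂ) : Prop :=
  MemL2Torus f ∧
    ∀ v : TorusSobolevSpace n,
      torusForm g q θ u v = ∫ x, f x * conj (v.toFun x) * (g.density x : ℂ) ∂(cellMeasure n)

/-- `z` is an eigenvalue of `H`: there is a nonzero `u ∈ 𝒟(H)` with `H u = z u`. -/
def IsEigenvalue {n : ℕ} (g : PeriodicMetric n) (q : Space n → ℂ) (z : ℂ) : Prop :=
  ∃ u : SobolevSpace n, OperatorGraph g q u (fun x => z * u.toFun x) ∧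
    ¬ u.toFun =ᵐ[volume] 0

/-- `H(θ) - z` has trivial kernel on `L²(𝕋ⁿ)`. -/
def TorusKernelTrivial {n : ℕ} (g : PeriodicMetric n) (q : Space n → ℂ) (θ : Fin n → ℂ)
    (z : ℂ) : Prop :=
  ∀ u : TorusSobolevSpace n, TorusOperatorGraph g q θ u (fun x => z * u.toFun x) →
    u.toFun =ᵐ[cellMeasure n] 0

end PeriodicSchrodinger

end

/-!
The forms `h(θ) - z` are represented by bounded operators `blochOp` on the Hilbert space `TorusH1`,
that is, `H¹(𝕋ⁿ)`, which depend polynomially on the complex quasimomentum `θ`. By the Sobolev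
inequality (`exists_sobolev_bound`) a potential in `L^{n/2}` is infinitesimally form bounded
(`potential_infinitesimal`), so Gårding's inequality (`garding`) holds uniformly for bounded `θ`.
As the `L²` norm is controlled by finitely many Fourier modes up to a small multiple of the `H¹`
norm (`low_modes`), the operators become invertible after adding one fixed operator of finite rank
(`exists_finrank_isUnit`). Invertibility is therefore decided by a finite determinant, which is
holomorphic in each variable, and the determinant is not identically zero on a coordinate line that
contains a point where the operator is injective (`countable_not_isUnit`). By Fubini's theorem,
trivial kernel for one complex `θ` implies invertibility for almost every real `θ`
(`ae_isUnit_blochOp`).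

Let `u` solve the eigenvalue equation in `H¹(ℝⁿ)`. For a cut-off function `ζ`, the periodization of
`exp(-iθ·x) ζ u` is an element of `H¹(𝕋ⁿ)`, and `blochOp` maps it to a commutator that contains
only terms with a derivative of `ζ` (`blochOp_blochTransform`). Cutting off makes all periodizations
finite sums, so that Plancherel's theorem for the Bloch transform (`lintegral_transformSq`) reduces
to Parseval's identity for trigonometric polynomials. On the set of `θ` where `blochOp` is bounded
below by `1/N`, the transform of `ζ u` is then small in `L²` when the derivatives of `ζ` are small
(`exists_lintegral_coerciveSet_le`). Let `ζ_k` be a cut-off function on the ball of radius `k + 1`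
whose derivatives are of order `1/k`. The transforms of `ζ_S u` and `ζ_k u` differ in `L²`, after
squaring, by at most the mass of `u` outside the ball of radius `S + 1`, if `k ≥ S`. Letting
`k → ∞` and then `N → ∞` bounds the mass of `u` inside this ball by twice the mass outside. The
latter tends to zero as `S → ∞`, hence `u = 0` (`ae_eq_zero_of_injective`).
-/

noncomputable section

namespace PeriodicSchrodinger

open scoped ComplexConjugate NNReal

variable {n : ℕ}

/-! ### The period lattice and the fundamental cell -/

@[simp] lemma latticeVec_apply (k : Fin n → ℤ) (i : Fin n) :
    latticeVec k i = 2 * Real.pi * (k i : ℝ) := rfl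

lemma latticeVec_add (k l : Fin n → ℤ) : latticeVec (k + l) = latticeVec k + latticeVec l := by
  ext i; simp; ring

lemma latticeVec_neg (k : Fin n → ℤ) : latticeVec (-k) = -latticeVec k := by
  ext i; simp

@[simp] lemma latticeVec_zero : latticeVec (0 : Fin n → ℤ) = 0 := by
  ext i; simp

lemma finite_latticeVec_norm_le (C : ℝ) : {m : Fin n → ℤ | ‖latticeVec m‖ ≤ C}.Finite := by
  refine (Set.Finite.pi' (t := fun _ : Fin n => Set.Icc (-⌈C⌉) ⌈C⌉)
    (fun _ => Set.finite_Icc _ _)).subset ?_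
  intro m hm i
  have h1 : |latticeVec m i| ≤ C := by
    have := PiLp.norm_apply_le (latticeVec m) i
    rw [Real.norm_eq_abs] at this
    exact this.trans hm
  have h2 : |(m i : ℝ)| ≤ C := by
    rw [latticeVec_apply, abs_mul] at h1
    have h3 : 1 ≤ |2 * Real.pi| := by
      rw [abs_of_pos Real.two_pi_pos]; linarith [Real.pi_gt_three]
    nlinarith [abs_nonneg (m i : ℝ)]
  have h4 : |(m i : ℝ)| ≤ (⌈C⌉ : ℝ) := h2.trans (Int.le_ceil C)
  have h5 := abs_le.1 h4
  exact ⟨by exact_mod_cast h5.1, by exact_mod_cast h5.2⟩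

lemma measurableSet_cell : MeasurableSet (cell n) := by
  have : cell n = ⋂ i, (fun x : Space n => x i) ⁻¹' Set.Ioo 0 (2 * Real.pi) := by
    ext x; simp [cell]
  rw [this]
  exact MeasurableSet.iInter fun i => measurableSet_Ioo.preimage (by fun_prop)

/-- A radius for a ball around the origin that contains the cell. -/
def cellRadius (n : ℕ) : ℝ := Real.sqrt n * (2 * Real.pi)

lemma norm_le_of_mem_cell {x : Space n} (hx : x ∈ cell n) : ‖x‖ ≤ cellRadius n := by
  rw [EuclideanSpace.norm_eq, cellRadius]
  have h : ∑ i, ‖x i‖ ^ 2 ≤ n * (2 * Real.pi) ^ 2 := by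
    calc ∑ i, ‖x i‖ ^ 2 ≤ ∑ _i : Fin n, (2 * Real.pi) ^ 2 := by
          refine Finset.sum_le_sum fun i _ => ?_
          rw [Real.norm_eq_abs, abs_of_pos (hx i).1]
          exact pow_le_pow_left₀ (hx i).1.le (hx i).2.le 2
      _ = _ := by simp
  calc Real.sqrt (∑ i, ‖x i‖ ^ 2) ≤ Real.sqrt (n * (2 * Real.pi) ^ 2) := Real.sqrt_le_sqrt h
    _ = _ := by rw [Real.sqrt_mul (by positivity), Real.sqrt_sq (by positivity)]

instance : IsFiniteMeasure (cellMeasure n) := by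
  refine ⟨?_⟩
  rw [cellMeasure, Measure.restrict_apply_univ]
  refine lt_of_le_of_lt (measure_mono (t := Metric.closedBall 0 (cellRadius n)) ?_)
    measure_closedBall_lt_top
  intro x hx
  simpa using norm_le_of_mem_cell hx

lemma ae_mem_cell : ∀ᵐ x ∂(cellMeasure n), x ∈ cell n :=
  ae_restrict_mem measurableSet_cell

/-- Almost every point of space lies in exactly one translate of the fundamental cell. -/
lemma volume_eq_sum_map_cellMeasure : (volume : Measure (Space n)) =
    Measure.sum fun m : Fin n → ℤ =>
      (cellMeasure n).map (MeasurableEquiv.addRight (latticeVec m)) := by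
  set T : (Fin n → ℤ) → Set (Space n) := fun m =>
    {x | ∀ i, x i ∈ Set.Ioo (2 * Real.pi * (m i : ℝ)) (2 * Real.pi * (m i + 1))} with hT
  have hTm : ∀ m, MeasurableSet (T m) := fun m => by
    have : T m = ⋂ i, (fun x : Space n => x i) ⁻¹'
        Set.Ioo (2 * Real.pi * (m i : ℝ)) (2 * Real.pi * (m i + 1)) := by
      ext x; simp [hT]
    rw [this]
    exact MeasurableSet.iInter fun i => measurableSet_Ioo.preimage (by fun_prop)
  have hmap : ∀ m, (cellMeasure n).map (MeasurableEquiv.addRight (latticeVec m)) =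
      volume.restrict (T m) := fun m => by
    have hpre : (MeasurableEquiv.addRight (latticeVec m)) ⁻¹' (T m) = cell n := by
      ext x
      simp only [hT, cell, Set.mem_preimage, Set.mem_ofPred_eq, MeasurableEquiv.coe_addRight,
        PiLp.add_apply, latticeVec_apply, Set.mem_Ioo]
      refine forall_congr' fun i => ?_
      constructor
      · rintro ⟨h1, h2⟩; constructor <;> nlinarith
      · rintro ⟨h1, h2⟩; constructor <;> nlinarith
    rw [cellMeasure, ← hpre, ← Measure.restrict_map (MeasurableEquiv.measurable _) (hTm m)]
    congr 1
    exact (measurePreserving_add_right volume (latticeVec m)).map_eq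
  have hdisj : Pairwise (Function.onFun Disjoint T) := by
    intro m m' hne
    rw [Function.onFun, Set.disjoint_left]
    intro x hx hx'
    apply hne
    funext i
    obtain ⟨h1, h2⟩ := hx i
    obtain ⟨h3, h4⟩ := hx' i
    have h5 := lt_of_mul_lt_mul_left (h1.trans h4) Real.two_pi_pos.le
    have h6 := lt_of_mul_lt_mul_left (h3.trans h2) Real.two_pi_pos.le
    have h7 : m i < m' i + 1 := by exact_mod_cast h5
    have h8 : m' i < m i + 1 := by exact_mod_cast h6
    omega
  have hnull : volume (⋃ m, T m)ᶜ = 0 := by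
    have hsub : (⋃ m, T m)ᶜ ⊆
        ⋃ (i : Fin n) (k : ℤ), {x : Space n | x i = 2 * Real.pi * (k : ℝ)} := by
      intro x hx
      by_contra hcon
      simp only [Set.mem_iUnion, Set.mem_ofPred_eq, not_exists] at hcon
      apply hx
      simp only [Set.mem_iUnion]
      refine ⟨fun i => ⌊x i / (2 * Real.pi)⌋, fun i => ⟨?_, ?_⟩⟩
      · refine lt_of_le_of_ne ?_ fun h => hcon i _ h.symm
        have := Int.floor_le (x i / (2 * Real.pi))
        rw [le_div_iff₀ Real.two_pi_pos] at this
        linarith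
      · have := Int.lt_floor_add_one (x i / (2 * Real.pi))
        rw [div_lt_iff₀ Real.two_pi_pos] at this
        linarith
    refine measure_mono_null hsub (measure_iUnion_null fun i => measure_iUnion_null fun k => ?_)
    have h1 := (EuclideanSpace.volume_preserving_symm_measurableEquiv_toLp (Fin n)).symm
    have h2 : {x : Space n | x i = 2 * Real.pi * (k : ℝ)} =
        (MeasurableEquiv.toLp 2 (Fin n → ℝ)).symm ⁻¹' {f | f i = 2 * Real.pi * (k : ℝ)} := by
      ext x; simp
    rw [h2,
      (EuclideanSpace.volume_preserving_symm_measurableEquiv_toLp (Fin n)).measure_preimage_equiv]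
    exact Measure.pi_hyperplane _ i _
  rw [funext hmap, ← Measure.restrict_iUnion hdisj hTm]
  exact (Measure.restrict_eq_self_of_ae_mem (by rw [ae_iff]; exact hnull)).symm

lemma lintegral_eq_tsum_cell (f : Space n → ENNReal) :
    ∫⁻ x, f x = ∑' m : Fin n → ℤ, ∫⁻ x, f (x + latticeVec m) ∂(cellMeasure n) := by
  rw [volume_eq_sum_map_cellMeasure, lintegral_sum_measure]
  exact tsum_congr fun m => lintegral_map_equiv _ _

lemma hasSum_integral_cell {f : Space n → ℂ} (hf : Integrable f) :
    HasSum (fun m : Fin n → ℤ => ∫ x, f (x + latticeVec m) ∂(cellMeasure n)) (∫ x, f x) := by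
  have h := hasSum_integral_measure
    (μ := fun m : Fin n → ℤ => (cellMeasure n).map (MeasurableEquiv.addRight (latticeVec m)))
    (f := f) (by rwa [← volume_eq_sum_map_cellMeasure])
  rw [← volume_eq_sum_map_cellMeasure] at h
  have h2 : (fun m : Fin n → ℤ => ∫ x, f (x + latticeVec m) ∂(cellMeasure n)) = fun m =>
      ∫ x, f x ∂((cellMeasure n).map (MeasurableEquiv.addRight (latticeVec m))) :=
    funext fun m => (integral_map_equiv (MeasurableEquiv.addRight (latticeVec m)) f).symm
  rw [h2]
  exact h

lemma memLp_translate {f : Space n → ℂ} {p : ENNReal} (hf : MemLp f p volume) (v : Space n) :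
    MemLp (fun x => f (x + v)) p volume :=
  hf.comp_measurePreserving (measurePreserving_add_right volume v)

lemma memLp_cell_translate {f : Space n → ℂ} {p : ENNReal} (hf : MemLp f p volume) (v : Space n) :
    MemLp (fun x => f (x + v)) p (cellMeasure n) :=
  (memLp_translate hf v).restrict _

lemma continuous_bounded_cell {E : Type*} [NormedAddCommGroup E] {f : Space n → E}
    (hf : Continuous f) : ∃ C, 0 ≤ C ∧ ∀ x ∈ cell n, ‖f x‖ ≤ C := by
  obtain ⟨C, hC⟩ := (isCompact_closedBall (0 : Space n) (cellRadius n)).exists_bound_of_continuousOn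
    hf.continuousOn
  refine ⟨max C 0, le_max_right _ _, fun x hx => (hC x ?_).trans (le_max_left _ _)⟩
  simpa using norm_le_of_mem_cell hx

lemma memLp_cell_of_continuous {f : Space n → ℂ} (hf : Continuous f) (p : ENNReal) :
    MemLp f p (cellMeasure n) := by
  obtain ⟨C, -, hC⟩ := continuous_bounded_cell hf
  exact MemLp.of_bound hf.aestronglyMeasurable C (ae_mem_cell.mono hC)

/-- The reduction of a point modulo the period lattice to the cell `[0,2π)ⁿ`: the integer
vector of the translate that contains the point. -/
def cellIndex (x : Space n) : Fin n → ℤ := fun i => ⌊x i / (2 * Real.pi)⌋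

lemma cellIndex_add (x : Space n) (k : Fin n → ℤ) :
    cellIndex (x + latticeVec k) = cellIndex x + k := by
  funext i
  simp only [cellIndex, PiLp.add_apply, latticeVec_apply, Pi.add_apply]
  rw [add_div, mul_div_cancel_left₀ _ Real.two_pi_pos.ne', Int.floor_add_intCast]

lemma cellIndex_of_mem {x : Space n} (hx : x ∈ cell n) : cellIndex x = 0 := by
  funext i
  simp only [cellIndex, Pi.zero_apply]
  rw [Int.floor_eq_zero_iff]
  exact ⟨div_nonneg (hx i).1.le Real.two_pi_pos.le, (div_lt_one Real.two_pi_pos).2 (hx i).2⟩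

/-- The function that agrees with `f m` on the `m`-th translate of the cell. -/
def glue {α : Type*} (f : (Fin n → ℤ) → Space n → α) (x : Space n) : α :=
  f (cellIndex x) (x - latticeVec (cellIndex x))

lemma glue_add {α : Type*} (f : (Fin n → ℤ) → Space n → α) {x : Space n} (hx : x ∈ cell n)
    (m : Fin n → ℤ) : glue f (x + latticeVec m) = f m x := by
  simp [glue, cellIndex_add, cellIndex_of_mem hx]

/-- The periodic extension of the restriction of a function to the cell. -/
def periodicExtension {α : Type*} (f : Space n → α) : Space n → α := glue fun _ => f

lemma isPeriodic_periodicExtension {α : Type*} (f : Space n → α) :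
    IsPeriodic (periodicExtension f) := by
  intro k x
  simp [periodicExtension, glue, cellIndex_add, latticeVec_add]

lemma periodicExtension_ae {α : Type*} (f : Space n → α) :
    periodicExtension f =ᵐ[cellMeasure n] f := by
  filter_upwards [ae_mem_cell] with x hx
  simpa [periodicExtension] using glue_add (fun _ : Fin n → ℤ => f) hx 0

/-! ### Plane waves and the Fourier basis of the cell -/

/-- The plane wave `x ↦ exp(i θ·x)` for a real wave vector `θ`. -/
def planeWave (θ x : Space n) : ℂ := Complex.exp (Complex.I * ((∑ i, θ i * x i : ℝ) : ℂ))

lemma planeWave_add_right (θ x y : Space n) :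
    planeWave θ (x + y) = planeWave θ x * planeWave θ y := by
  rw [planeWave, planeWave, planeWave, ← Complex.exp_add, ← mul_add, ← Complex.ofReal_add,
    ← Finset.sum_add_distrib]
  simp [mul_add]

lemma planeWave_add_left (θ η x : Space n) :
    planeWave (θ + η) x = planeWave θ x * planeWave η x := by
  rw [planeWave, planeWave, planeWave, ← Complex.exp_add, ← mul_add, ← Complex.ofReal_add,
    ← Finset.sum_add_distrib]
  simp [add_mul]

@[simp] lemma norm_planeWave (θ x : Space n) : ‖planeWave θ x‖ = 1 := by
  rw [planeWave, mul_comm]; exact Complex.norm_exp_ofReal_mul_I _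

lemma planeWave_neg (θ x : Space n) : planeWave (-θ) x = conj (planeWave θ x) := by
  rw [planeWave, planeWave, ← Complex.exp_conj]
  simp

lemma contDiff_planeWave (θ : Space n) : ContDiff ℝ ∞ (planeWave θ) := by
  have h : ContDiff ℝ ∞ fun x : Space n => ∑ i, θ i * x i :=
    ContDiff.sum fun i _ => contDiff_const.mul (contDiff_piLp_apply 2)
  exact Complex.contDiff_exp.comp (contDiff_const.mul (Complex.ofRealCLM.contDiff.comp h))

lemma continuous_planeWave (θ : Space n) : Continuous (planeWave θ) :=
  (contDiff_planeWave θ).continuous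

lemma partialDeriv_planeWave (θ : Space n) (i : Fin n) (x : Space n) :
    partialDeriv i (planeWave θ) x = Complex.I * θ i * planeWave θ x := by
  have h : HasDerivAt (fun t : ℝ => planeWave θ (x + t • EuclideanSpace.single i 1))
      (Complex.I * θ i * planeWave θ x) 0 := by
    have h1 : ∀ t : ℝ, planeWave θ (x + t • EuclideanSpace.single i 1) =
        planeWave θ x * Complex.exp ((Complex.I * θ i) * (t : ℂ)) := fun t => by
      rw [planeWave_add_right]
      congr 1
      rw [planeWave]
      congr 1
      have : (∑ j, θ j * (t • EuclideanSpace.single i (1 : ℝ)) j) = θ i * t := by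
        rw [Finset.sum_eq_single i] <;> simp +contextual
      rw [this]; push_cast; ring
    simp only [h1]
    have h2 : HasDerivAt (fun t : ℝ => Complex.exp ((Complex.I * θ i) * (t : ℂ)))
        (Complex.I * θ i) 0 := by
      have := ((Complex.ofRealCLM.hasDerivAt (x := (0 : ℝ))).const_mul (Complex.I * θ i)).cexp
      simpa using this
    simpa [mul_comm] using h2.const_mul (planeWave θ x)
  have h3 := ((contDiff_planeWave θ).differentiable (by simp) x).hasFDerivAt
  have h4 : HasDerivAt (fun t : ℝ => x + t • EuclideanSpace.single i (1 : ℝ))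
      (EuclideanSpace.single i (1 : ℝ)) 0 := by
    simpa using ((hasDerivAt_id (0 : ℝ)).smul_const (EuclideanSpace.single i (1 : ℝ))).const_add x
  have h5 : HasFDerivAt (planeWave θ) (fderiv ℝ (planeWave θ) x)
      (x + (0 : ℝ) • EuclideanSpace.single i (1 : ℝ)) := by simpa using h3
  have h6 : HasDerivAt (fun t : ℝ => planeWave θ (x + t • EuclideanSpace.single i 1))
      (partialDeriv i (planeWave θ) x) 0 := by
    have h7 := HasFDerivAt.comp_hasDerivAt (0 : ℝ) h5 h4
    exact h7
  exact h6.unique h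

/-- An integer vector, as a vector of `ℝⁿ`. -/
def intVec (k : Fin n → ℤ) : Space n := WithLp.toLp 2 fun i => (k i : ℝ)

@[simp] lemma intVec_apply (k : Fin n → ℤ) (i : Fin n) : intVec k i = k i := rfl

lemma planeWave_intVec_latticeVec (k m : Fin n → ℤ) :
    planeWave (intVec k) (latticeVec m) = 1 := by
  rw [planeWave, Complex.exp_eq_one_iff]
  refine ⟨∑ i, k i * m i, ?_⟩
  push_cast
  simp only [intVec_apply, latticeVec_apply, Finset.mul_sum, Finset.sum_mul]
  refine Finset.sum_congr rfl fun i _ => ?_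
  push_cast; ring

lemma isPeriodic_planeWave (k : Fin n → ℤ) : IsPeriodic (planeWave (intVec k)) := fun m x => by
  rw [planeWave_add_right, planeWave_intVec_latticeVec, mul_one]

/-- The Hilbert space `L²(𝕋ⁿ)`, realized on the cell. -/
abbrev CellL2 (n : ℕ) : Type := Lp ℂ 2 (cellMeasure n)

section UnitTorus

-- The Fourier basis of the unit torus refers to Haar measure of total mass one on each circle.
attribute [local instance] instMeasureSpaceUnitAddCircle

local instance : IsProbabilityMeasure (volume : Measure UnitAddCircle) :=
  inferInstanceAs (IsProbabilityMeasure AddCircle.haarAddCircle)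

/-- The covering map from space to the unit torus. -/
def toUnitTorus (x : Space n) : UnitAddTorus (Fin n) :=
  fun i => ((((2 * Real.pi)⁻¹ * x i : ℝ)) : UnitAddCircle)

lemma mFourier_toUnitTorus (k : Fin n → ℤ) (x : Space n) :
    UnitAddTorus.mFourier k (toUnitTorus x) = planeWave (intVec k) x := by
  simp only [UnitAddTorus.mFourier, ContinuousMap.coe_mk, toUnitTorus, planeWave]
  simp_rw [fourier_coe_apply]
  rw [← Complex.exp_sum]
  congr 1
  push_cast
  rw [Finset.mul_sum]
  refine Finset.sum_congr rfl fun i _ => ?_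
  have : (Real.pi : ℂ) ≠ 0 := by exact_mod_cast Real.pi_ne_zero
  simp
  field_simp

/-- Up to a constant factor, the covering map carries Lebesgue measure on the cell to Haar measure
on the unit torus. -/
lemma exists_measurePreserving_toUnitTorus : ∃ K : ENNReal, K ≠ 0 ∧ K ≠ ⊤ ∧
    MeasurePreserving (toUnitTorus (n := n)) (cellMeasure n) (K • volume) := by
  have h2p : (2 * Real.pi)⁻¹ ≠ 0 := by positivity
  set s : Set (Fin n → ℝ) := Set.univ.pi fun _ => Set.Ioo 0 1 with hs
  set s' : Set (Space n) := (MeasurableEquiv.toLp 2 (Fin n → ℝ)).symm ⁻¹' s with hs'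
  have hsm : MeasurableSet s := MeasurableSet.univ_pi fun _ => measurableSet_Ioo
  have hsm' : MeasurableSet s' := hsm.preimage (MeasurableEquiv.measurable _)
  set K : ENNReal := ENNReal.ofReal (abs (((2 * Real.pi)⁻¹) ^ Module.finrank ℝ (Space n))⁻¹) with hK
  have hKpos : K ≠ 0 := by
    rw [hK, Ne, ENNReal.ofReal_eq_zero, not_le]
    positivity
  -- scaling to the unit cell
  have h1 : MeasurePreserving (fun x : Space n => (2 * Real.pi)⁻¹ • x) (cellMeasure n)
      (K • volume.restrict s') := by
    have h := (⟨by fun_prop, Measure.map_addHaar_smul (μ := (volume : Measure (Space n))) h2p⟩ :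
      MeasurePreserving (fun x : Space n => (2 * Real.pi)⁻¹ • x) volume (K • volume))
    have h' := h.restrict_preimage hsm'
    rw [Measure.restrict_smul] at h'
    suffices hcell : cell n = (fun x : Space n => (2 * Real.pi)⁻¹ • x) ⁻¹' s' by
      rw [cellMeasure, hcell]
      exact h'
    ext x
    simp only [cell, hs', hs, Set.mem_preimage, Set.mem_univ_pi, Set.mem_ofPred_eq]
    refine forall_congr' fun i => ?_
    have : (MeasurableEquiv.toLp 2 (Fin n → ℝ)).symm ((2 * Real.pi)⁻¹ • x) i =
      (2 * Real.pi)⁻¹ * x i := rfl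
    rw [this, Set.mem_Ioo, Set.mem_Ioo, inv_mul_lt_iff₀ Real.two_pi_pos, mul_one]
    refine and_congr ⟨fun h => by positivity, fun h => ?_⟩ Iff.rfl
    exact pos_of_mul_pos_right h (by positivity)
  have h2 : MeasurePreserving (MeasurableEquiv.toLp 2 (Fin n → ℝ)).symm (volume.restrict s')
      (Measure.pi fun _ : Fin n => (volume : Measure ℝ).restrict (Set.Ioc 0 (0 + 1))) := by
    have h := (EuclideanSpace.volume_preserving_symm_measurableEquiv_toLp (Fin n)).restrict_preimage
      hsm
    have hm : (volume : Measure (Fin n → ℝ)).restrict s =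
        Measure.pi fun _ : Fin n => (volume : Measure ℝ).restrict (Set.Ioc 0 (0 + 1)) := by
      rw [hs, volume_pi, Measure.restrict_pi_pi]
      congr 1
      funext i
      rw [zero_add]
      exact restrict_Ioo_eq_restrict_Ioc
    rw [← hm]
    exact h
  have h3 : MeasurePreserving (fun (x : Fin n → ℝ) (i : Fin n) => ((x i : ℝ) : UnitAddCircle))
      (Measure.pi fun _ : Fin n => (volume : Measure ℝ).restrict (Set.Ioc 0 (0 + 1)))
      (volume : Measure (UnitAddTorus (Fin n))) :=
    measurePreserving_pi _ _ fun _ => by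
      have h := AddCircle.measurePreserving_mk 1 0
      rw [AddCircle.volume_eq_smul_haarAddCircle, ENNReal.ofReal_one, one_smul] at h
      exact h
  refine ⟨K, hKpos, ENNReal.ofReal_ne_top, ?_⟩
  have h4 := (h3.comp h2)
  have h5 : MeasurePreserving (fun x : Space n => toUnitTorus ((2 * Real.pi) • x))
      (K • volume.restrict s') (K • volume) := by
    have h6 := h4.smul_measure K
    convert h6 using 1
    funext x i
    simp [toUnitTorus]
    congr 1
    field_simp
  have h7 := h5.comp h1
  convert h7 using 1
  funext x
  simp only [Function.comp]
  rw [smul_smul, mul_inv_cancel₀ (by positivity), one_smul]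

/-- A measurable section of the covering map over the cell. -/
lemma exists_section_toUnitTorus : ∃ σ : UnitAddTorus (Fin n) → Space n, Measurable σ ∧
    ∀ x ∈ cell n, σ (toUnitTorus x) = x := by
  refine ⟨fun y => WithLp.toLp 2 fun i =>
    2 * Real.pi * (AddCircle.measurableEquivIoc 1 0 (y i) : ℝ),
    ?_, fun x hx => ?_⟩
  · refine (MeasurableEquiv.toLp 2 (Fin n → ℝ)).measurable.comp ?_
    refine measurable_pi_lambda _ fun i => Measurable.const_mul ?_ _
    exact measurable_subtype_coe.comp
      ((AddCircle.measurableEquivIoc 1 0).measurable.comp (measurable_pi_apply i))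
  · ext i
    simp only [toUnitTorus]
    have h : (2 * Real.pi)⁻¹ * x i ∈ Set.Ioc (0 : ℝ) (0 + 1) := by
      have := hx i
      constructor
      · have := this.1; positivity
      · rw [zero_add, inv_mul_le_iff₀ Real.two_pi_pos, mul_one]; exact this.2.le
    have h2 : (AddCircle.measurableEquivIoc (1 : ℝ) 0
        (((2 * Real.pi)⁻¹ * x i : ℝ) : UnitAddCircle) : ℝ) = (2 * Real.pi)⁻¹ * x i := by
      exact AddCircle.equivIoc_coe_of_mem (p := (1 : ℝ)) (a := 0) h
    rw [h2]
    field_simp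

/-- A square integrable function on the cell is determined by its Fourier coefficients. -/
lemma cellL2_eq_zero_of_fourier (p : CellL2 n)
    (h : ∀ k : Fin n → ℤ, ∫ x, conj (planeWave (intVec k) x) * p x ∂(cellMeasure n) = 0) :
    p = 0 := by
  obtain ⟨K, hK0, hKt, hτ⟩ := exists_measurePreserving_toUnitTorus (n := n)
  obtain ⟨σ, hσm, hσ⟩ := exists_section_toUnitTorus (n := n)
  have hpm : StronglyMeasurable (p : Space n → ℂ) := Lp.stronglyMeasurable p
  set f : UnitAddTorus (Fin n) → ℂ := fun y => p (σ y) with hf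
  have hfm : Measurable f := hpm.measurable.comp hσm
  have hfτ : ∀ᵐ x ∂(cellMeasure n), f (toUnitTorus x) = p x := by
    filter_upwards [ae_mem_cell] with x hx
    rw [hf]; simp only [hσ x hx]
  have hf2 : MemLp f 2 volume := by
    have h1 : MemLp f 2 (K • volume) := by
      rw [← hτ.map_eq, memLp_map_measure_iff hfm.aestronglyMeasurable hτ.measurable.aemeasurable]
      exact (memLp_congr_ae hfτ).2 (Lp.memLp p)
    have h2 := h1.smul_measure (c := K⁻¹) (by simpa using hK0)
    rwa [smul_smul, ENNReal.inv_mul_cancel hK0 hKt, one_smul] at h2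
  have hcoef : ∀ k, UnitAddTorus.mFourierCoeff f k = 0 := fun k => by
    have h1 : ∫ y, UnitAddTorus.mFourier (-k) y • f y ∂(K • volume) = 0 := by
      rw [← hτ.map_eq, integral_map hτ.measurable.aemeasurable]
      · rw [← h k]
        refine integral_congr_ae ?_
        filter_upwards [hfτ] with x hx
        rw [hx, UnitAddTorus.mFourier_neg, mFourier_toUnitTorus, smul_eq_mul]
      · exact ((map_continuous
          (UnitAddTorus.mFourier (-k))).measurable.smul hfm).aestronglyMeasurable
    rw [integral_smul_measure, smul_eq_zero] at h1
    refine h1.resolve_left ?_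
    exact (ENNReal.toReal_pos hK0 hKt).ne'
  have hf0 : f =ᵐ[volume] 0 := by
    have h1 : UnitAddTorus.mFourierBasis.repr hf2.toLp = 0 := by
      ext k
      rw [UnitAddTorus.mFourierBasis_repr]
      rw [UnitAddTorus.mFourierCoeff]
      rw [show ((0 : lp (fun _ : Fin n → ℤ => ℂ) 2) : (Fin n → ℤ) → ℂ) k = 0 from rfl, ← hcoef k,
        UnitAddTorus.mFourierCoeff]
      refine integral_congr_ae ?_
      filter_upwards [hf2.coeFn_toLp] with y hy
      rw [hy]
    have h2 : hf2.toLp = 0 := by simpa using h1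
    exact (MemLp.toLp_eq_toLp_iff hf2 (MemLp.zero)).1 (by rw [h2]; rfl)
  have hf0' : ∀ᵐ x ∂(cellMeasure n), f (toUnitTorus x) = 0 := by
    have h1 : ∀ᵐ y ∂(K • (volume : Measure (UnitAddTorus (Fin n)))), f y = 0 :=
      Measure.ae_smul_measure hf0 K
    rw [← hτ.map_eq] at h1
    exact ae_of_ae_map hτ.measurable.aemeasurable h1
  rw [Lp.eq_zero_iff_ae_eq_zero]
  filter_upwards [hfτ, hf0'] with x h1 h2
  rw [← h1, h2]; rfl

/-- The normalizing constant `(2π)^{-n/2}` of the plane waves on the cell. -/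
def cellNorm (n : ℕ) : ℝ := (Real.sqrt ((cellMeasure n).real Set.univ))⁻¹

lemma integral_cell_planeWave (k : Fin n → ℤ) (hk : k ≠ 0) :
    ∫ x, planeWave (intVec k) x ∂(cellMeasure n) = 0 := by
  obtain ⟨K, hK0, hKt, hτ⟩ := exists_measurePreserving_toUnitTorus (n := n)
  have h1 : ∫ y, UnitAddTorus.mFourier k y ∂(K • (volume : Measure (UnitAddTorus (Fin n)))) =
      ∫ x, planeWave (intVec k) x ∂(cellMeasure n) := by
    rw [← hτ.map_eq, integral_map hτ.measurable.aemeasurable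
      (map_continuous _).aestronglyMeasurable]
    simp only [mFourier_toUnitTorus]
  rw [← h1, integral_smul_measure]
  have h2 := (orthonormal_iff_ite.1 (UnitAddTorus.orthonormal_mFourier (d := Fin n))) 0 k
  rw [if_neg hk.symm, ContinuousMap.inner_toLp] at h2
  simp only [UnitAddTorus.mFourier_zero] at h2
  have h3 : ∫ y, UnitAddTorus.mFourier k y = 0 := by
    simpa using h2
  rw [h3, smul_zero]

lemma cellMeasure_real_univ_pos : 0 < (cellMeasure n).real Set.univ := by
  obtain ⟨K, hK0, hKt, hτ⟩ := exists_measurePreserving_toUnitTorus (n := n)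
  have h : (cellMeasure n) Set.univ = K * (volume (Set.univ : Set (UnitAddTorus (Fin n)))) := by
    have := hτ.measure_preimage (s := Set.univ) MeasurableSet.univ.nullMeasurableSet
    simpa using this
  refine ENNReal.toReal_pos ?_ (measure_ne_top _ _)
  rw [h]
  refine mul_ne_zero hK0 ?_
  simp

end UnitTorus

/-- The normalized plane wave with integer wave vector, as an element of `L²(𝕋ⁿ)`. -/
def expL2 (k : Fin n → ℤ) : CellL2 n :=
  (memLp_cell_of_continuous (f := fun x => (cellNorm n : ℂ) * planeWave (intVec k) x)
    (continuous_const.mul (continuous_planeWave _)) 2).toLp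

lemma coeFn_expL2 (k : Fin n → ℤ) :
    expL2 k =ᵐ[cellMeasure n] fun x => (cellNorm n : ℂ) * planeWave (intVec k) x :=
  MemLp.coeFn_toLp _

lemma cellNorm_pos : 0 < cellNorm n := inv_pos.2 (Real.sqrt_pos.2 cellMeasure_real_univ_pos)

lemma inner_expL2 (k : Fin n → ℤ) (p : CellL2 n) :
    inner ℂ (expL2 k) p =
      cellNorm n * ∫ x, conj (planeWave (intVec k) x) * p x ∂(cellMeasure n) := by
  rw [L2.inner_def, ← integral_const_mul]
  refine integral_congr_ae ?_
  filter_upwards [coeFn_expL2 k] with x hx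
  rw [hx, RCLike.inner_apply]
  simp; ring

lemma orthonormal_expL2 : Orthonormal ℂ (expL2 (n := n)) := by
  rw [orthonormal_iff_ite]
  intro k l
  rw [inner_expL2]
  have h : ∫ x, conj (planeWave (intVec k) x) * expL2 l x ∂(cellMeasure n) =
      cellNorm n * ∫ x, planeWave (intVec (l - k)) x ∂(cellMeasure n) := by
    rw [← integral_const_mul]
    refine integral_congr_ae ?_
    filter_upwards [coeFn_expL2 l] with x hx
    have : intVec (l - k) = intVec l + -intVec k := by ext i; simp [sub_eq_add_neg]
    rw [hx, this, planeWave_add_left, planeWave_neg]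
    ring
  rw [h]
  split_ifs with hkl
  · subst hkl
    have h1 : ∀ x : Space n, planeWave (intVec (k - k)) x = 1 := fun x => by
      simp [planeWave]
    simp only [h1, integral_const]
    rw [Complex.real_smul, mul_one, ← Complex.ofReal_mul, ← Complex.ofReal_mul, cellNorm]
    have := cellMeasure_real_univ_pos (n := n)
    have h2 := Real.mul_self_sqrt this.le
    have h3 := Real.sqrt_pos.2 this
    norm_cast
    field_simp
    rw [sq, h2]
  · rw [integral_cell_planeWave _ (sub_ne_zero.2 fun h => hkl h.symm)]
    simp

/-- The Fourier basis of `L²(𝕋ⁿ)`. -/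
def fourierL2 : HilbertBasis (Fin n → ℤ) ℂ (CellL2 n) :=
  HilbertBasis.mkOfOrthogonalEqBot orthonormal_expL2 (by
    rw [Submodule.eq_bot_iff]
    intro p hp
    refine cellL2_eq_zero_of_fourier p fun k => ?_
    have h := (Submodule.mem_orthogonal _ _).1 hp (expL2 k) (Submodule.subset_span ⟨k, rfl⟩)
    rw [inner_expL2, mul_eq_zero] at h
    exact h.resolve_left (by exact_mod_cast cellNorm_pos.ne'))

@[simp] lemma coe_fourierL2 : ⇑(fourierL2 (n := n)) = expL2 :=
  HilbertBasis.coe_mkOfOrthogonalEqBot _ _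

/-! ### The Sobolev space of the torus as a Hilbert space -/

/-- The continuous linear functional `p ↦ ∫ p f` on `L²(𝕋ⁿ)`. -/
def pairL2 (f : Space n → ℂ) (hf : MemLp f 2 (cellMeasure n)) : CellL2 n →L[ℂ] ℂ :=
  innerSL ℂ (hf.star).toLp

lemma pairL2_apply (f : Space n → ℂ) (hf : MemLp f 2 (cellMeasure n)) (p : CellL2 n) :
    pairL2 f hf p = ∫ x, p x * f x ∂(cellMeasure n) := by
  rw [pairL2, innerSL_apply_apply, L2.inner_def]
  refine integral_congr_ae ?_
  filter_upwards [(hf.star).coeFn_toLp] with x hx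
  rw [hx, RCLike.inner_apply]
  simp

lemma continuous_partialDeriv {φ : Space n → ℂ} (hφ : ContDiff ℝ ∞ φ) (i : Fin n) :
    Continuous (partialDeriv i φ) :=
  (hφ.continuous_fderiv (by simp)).clm_apply continuous_const

/-- The defining relation of a weak `i`-th derivative on the torus, tested against `φ`, as a
continuous functional of a function and its gradient. -/
def weakFunctional (i : Fin n) (φ : Space n → ℂ) (hφ : ContDiff ℝ ∞ φ) :
    PiLp 2 (fun _ : Option (Fin n) => CellL2 n) →L[ℂ] ℂ :=
  (pairL2 (partialDeriv i φ) (memLp_cell_of_continuous (continuous_partialDeriv hφ i) 2)).comp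
      (PiLp.proj 2 (fun _ : Option (Fin n) => CellL2 n) none) +
    (pairL2 φ (memLp_cell_of_continuous hφ.continuous 2)).comp
      (PiLp.proj 2 (fun _ : Option (Fin n) => CellL2 n) (some i))

/-- The Sobolev space `H¹(𝕋ⁿ)` as a closed subspace of `L²(𝕋ⁿ)¹⁺ⁿ`: the component `none` is the
function, the component `some i` its `i`-th weak derivative. -/
def torusH1 (n : ℕ) : Submodule ℂ (PiLp 2 (fun _ : Option (Fin n) => CellL2 n)) :=
  ⨅ (i : Fin n) (φ : Space n → ℂ) (hφ : ContDiff ℝ ∞ φ ∧ IsPeriodic φ),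
    (weakFunctional i φ hφ.1).ker

/-- The Hilbert space `H¹(𝕋ⁿ)`. -/
def TorusH1 (n : ℕ) : Type := torusH1 n

instance : NormedAddCommGroup (TorusH1 n) := inferInstanceAs (NormedAddCommGroup (torusH1 n))

instance : InnerProductSpace ℂ (TorusH1 n) := inferInstanceAs (InnerProductSpace ℂ (torusH1 n))

lemma isClosed_torusH1 :
    IsClosed (torusH1 n : Set (PiLp 2 (fun _ : Option (Fin n) => CellL2 n))) := by
  simp only [torusH1, Submodule.coe_iInf]
  exact isClosed_iInter fun i => isClosed_iInter fun φ => isClosed_iInter fun hφ =>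
    (weakFunctional i φ hφ.1).isClosed_ker

instance : CompleteSpace (TorusH1 n) :=
  show CompleteSpace (torusH1 n) from isClosed_torusH1.completeSpace_coe

/-- The inclusion of `H¹(𝕋ⁿ)` in `L²(𝕋ⁿ)`. -/
def fn : TorusH1 n →L[ℂ] CellL2 n :=
  ((PiLp.proj 2 (fun _ : Option (Fin n) => CellL2 n) none).comp (torusH1 n).subtypeL :
    torusH1 n →L[ℂ] CellL2 n)

/-- The weak derivative `∂/∂xᵢ`, as a bounded operator from `H¹(𝕋ⁿ)` to `L²(𝕋ⁿ)`. -/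
def gr (i : Fin n) : TorusH1 n →L[ℂ] CellL2 n :=
  ((PiLp.proj 2 (fun _ : Option (Fin n) => CellL2 n) (some i)).comp (torusH1 n).subtypeL :
    torusH1 n →L[ℂ] CellL2 n)

lemma norm_sq_torusH1 (p : TorusH1 n) : ‖p‖ ^ 2 = ‖fn p‖ ^ 2 + ∑ i, ‖gr i p‖ ^ 2 := by
  have h : ‖p‖ ^ 2 =
      ‖(torusH1 n).subtypeL p‖ ^ 2 := rfl
  rw [h, PiLp.norm_sq_eq_of_L2, Fintype.sum_option]
  rfl

lemma norm_fn_le (p : TorusH1 n) : ‖fn p‖ ≤ ‖p‖ := by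
  have h := norm_sq_torusH1 p
  have : 0 ≤ ∑ i, ‖gr i p‖ ^ 2 := Finset.sum_nonneg fun i _ => by positivity
  exact (sq_le_sq₀ (norm_nonneg _) (norm_nonneg _)).1 (by linarith)

lemma norm_gr_le (i : Fin n) (p : TorusH1 n) : ‖gr i p‖ ≤ ‖p‖ := by
  have h := norm_sq_torusH1 p
  have h1 := Finset.single_le_sum (f := fun i => ‖gr i p‖ ^ 2) (fun i _ => by positivity)
    (Finset.mem_univ i)
  refine (sq_le_sq₀ (norm_nonneg _) (norm_nonneg _)).1 ?_
  have : 0 ≤ ‖fn p‖ ^ 2 := by positivity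
  linarith

lemma weak_torusH1 (p : TorusH1 n) (i : Fin n) {φ : Space n → ℂ} (hφ : ContDiff ℝ ∞ φ)
    (hper : IsPeriodic φ) :
    ∫ x, fn p x * partialDeriv i φ x ∂(cellMeasure n) = -∫ x, gr i p x * φ x ∂(cellMeasure n) := by
  have h := (show torusH1 n from p).2
  simp only [torusH1, Submodule.mem_iInf] at h
  have h1 := h i φ ⟨hφ, hper⟩
  rw [LinearMap.mem_ker] at h1
  simp only [weakFunctional] at h1
  have h2 : pairL2 (partialDeriv i φ)
      (memLp_cell_of_continuous (continuous_partialDeriv hφ i) 2) (fn p) +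
      pairL2 φ (memLp_cell_of_continuous hφ.continuous 2) (gr i p) = 0 := h1
  rw [pairL2_apply, pairL2_apply] at h2
  exact eq_neg_of_add_eq_zero_left h2

/-- An element of `H¹(𝕋ⁿ)` from a square integrable function and its weak gradient on the cell. -/
def mkH1 (f : Space n → ℂ) (G : Fin n → Space n → ℂ) (hf : MemLp f 2 (cellMeasure n))
    (hG : ∀ i, MemLp (G i) 2 (cellMeasure n))
    (hw : ∀ (i : Fin n) (φ : Space n → ℂ), ContDiff ℝ ∞ φ → IsPeriodic φ →
      ∫ x, f x * partialDeriv i φ x ∂(cellMeasure n) = -∫ x, G i x * φ x ∂(cellMeasure n)) :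
    TorusH1 n :=
  (⟨WithLp.toLp 2 fun o => o.elim hf.toLp fun i => (hG i).toLp, by
    simp only [torusH1, Submodule.mem_iInf]
    intro i φ hφ
    rw [LinearMap.mem_ker]
    have h : pairL2 (partialDeriv i φ)
        (memLp_cell_of_continuous (continuous_partialDeriv hφ.1 i) 2) hf.toLp +
        pairL2 φ (memLp_cell_of_continuous hφ.1.continuous 2) (hG i).toLp = 0 := by
      rw [pairL2_apply, pairL2_apply, ← sub_neg_eq_add, sub_eq_zero]
      have h1 := hw i φ hφ.1 hφ.2
      convert h1 using 1
      · refine integral_congr_ae ?_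
        filter_upwards [hf.coeFn_toLp] with x hx
        rw [hx]
      · congr 1
        refine integral_congr_ae ?_
        filter_upwards [(hG i).coeFn_toLp] with x hx
        rw [hx]
    exact h⟩ : torusH1 n)

section
variable (f : Space n → ℂ) (G : Fin n → Space n → ℂ) (hf : MemLp f 2 (cellMeasure n))
    (hG : ∀ i, MemLp (G i) 2 (cellMeasure n))
    (hw : ∀ (i : Fin n) (φ : Space n → ℂ), ContDiff ℝ ∞ φ → IsPeriodic φ →
      ∫ x, f x * partialDeriv i φ x ∂(cellMeasure n) = -∫ x, G i x * φ x ∂(cellMeasure n))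

lemma coeFn_fn_mkH1 : fn (mkH1 f G hf hG hw) =ᵐ[cellMeasure n] f := hf.coeFn_toLp

lemma coeFn_gr_mkH1 (i : Fin n) : gr i (mkH1 f G hf hG hw) =ᵐ[cellMeasure n] G i :=
  (hG i).coeFn_toLp

end

/-- The element of the Hilbert space `H¹(𝕋ⁿ)` that is represented by a Sobolev function. -/
def TorusSobolevSpace.toH1 (u : TorusSobolevSpace n) : TorusH1 n :=
  mkH1 u.toFun u.grad u.memL2.memLp (fun i => (u.memL2_grad i).memLp) u.weak

lemma memL2Torus_periodicExtension (p : CellL2 n) :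
    MemL2Torus (periodicExtension (p : Space n → ℂ)) :=
  ⟨isPeriodic_periodicExtension _, (memLp_congr_ae (periodicExtension_ae _)).2 (Lp.memLp p)⟩

/-- A periodic representative of an element of `H¹(𝕋ⁿ)`. -/
def toSobolev (p : TorusH1 n) : TorusSobolevSpace n where
  toFun := periodicExtension (fn p)
  grad i := periodicExtension (gr i p)
  memL2 := memL2Torus_periodicExtension _
  memL2_grad i := memL2Torus_periodicExtension _
  weak i φ hφ hper := by
    rw [← integral_congr_ae (g := fun x => periodicExtension (fn p) x * partialDeriv i φ x)
      (f := fun x => fn p x * partialDeriv i φ x), weak_torusH1 p i hφ hper]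
    · congr 1
      refine integral_congr_ae ?_
      filter_upwards [periodicExtension_ae (gr i p)] with x hx
      rw [hx]
    · filter_upwards [periodicExtension_ae (fn p)] with x hx
      rw [hx]

/-- Differentiation multiplies the Fourier coefficients by the wave vector. -/
lemma inner_expL2_gr (k : Fin n → ℤ) (i : Fin n) (p : TorusH1 n) :
    inner ℂ (expL2 k) (gr i p) = Complex.I * k i * inner ℂ (expL2 k) (fn p) := by
  rw [inner_expL2, inner_expL2]
  have hk : -intVec k = intVec (-k) := by ext i; simp
  have h := weak_torusH1 p i (contDiff_planeWave (-intVec k)) (by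
    rw [hk]; exact isPeriodic_planeWave _)
  simp only [partialDeriv_planeWave] at h
  have h1 : ∫ x, conj (planeWave (intVec k) x) * gr i p x ∂(cellMeasure n) =
      ∫ x, gr i p x * planeWave (-intVec k) x ∂(cellMeasure n) := by
    simp only [planeWave_neg, mul_comm]
  rw [h1, ← neg_eq_iff_eq_neg.2 h, ← integral_neg, ← integral_const_mul, ← integral_const_mul,
    ← integral_const_mul]
  congr 1
  funext x
  rw [planeWave_neg]
  simp
  ring

/-! ### The Sobolev inequality on the torus -/

lemma isPeriodic_partialDeriv {f : Space n → ℂ} (hf : IsPeriodic f) (i : Fin n) :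
    IsPeriodic (partialDeriv i f) := fun k x => by
  have h : (fun y => f (y + latticeVec k)) = f := funext fun y => hf k y
  rw [partialDeriv, partialDeriv, ← fderiv_comp_add_right (latticeVec k), h]

lemma eLpNorm_two_sq {α E : Type*} [MeasurableSpace α] [NormedAddCommGroup E] (f : α → E)
    (μ : Measure α) : eLpNorm f 2 μ ^ 2 = ∫⁻ x, ‖f x‖ₑ ^ 2 ∂μ := by
  have h := eLpNorm_nnreal_pow_eq_lintegral (f := f) (μ := μ) (p := 2) (by norm_num)
  simpa using h

lemma enorm_sq_eq_lintegral (p : CellL2 n) : ‖p‖ₑ ^ 2 = ∫⁻ x, ‖p x‖ₑ ^ 2 ∂(cellMeasure n) := by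
  rw [← eLpNorm_two_sq, Lp.enorm_def]

/-- The finite set of the lattice vectors by which translates of the cell may meet the ball of
radius `r` about the origin. -/
def ballCells (n : ℕ) (r : ℝ) : Finset (Fin n → ℤ) :=
  (finite_latticeVec_norm_le (n := n) (r + cellRadius n)).toFinset

lemma mem_ballCells {r : ℝ} {x : Space n} (hx : x ∈ cell n) {m : Fin n → ℤ}
    (h : ‖x + latticeVec m‖ ≤ r) : m ∈ ballCells n r := by
  simp only [ballCells, Set.Finite.mem_toFinset, Set.mem_ofPred_eq]
  have h1 := norm_le_of_mem_cell hx
  have h2 : ‖latticeVec m‖ ≤ ‖x + latticeVec m‖ + ‖x‖ := by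
    have := norm_sub_le (x + latticeVec m) x
    simpa using this
  linarith

lemma lintegral_ball_le_of_isPeriodic {h : Space n → ENNReal} (hper : IsPeriodic h) (r : ℝ) :
    ∫⁻ x, (Metric.closedBall 0 r).indicator h x ≤
      (ballCells n r).card * ∫⁻ x, h x ∂(cellMeasure n) := by
  rw [lintegral_eq_tsum_cell, tsum_eq_sum (s := ballCells n r)]
  · rw [← nsmul_eq_mul, ← Finset.sum_const]
    refine Finset.sum_le_sum fun m _ => lintegral_mono fun x => ?_
    refine (Set.indicator_le_self _ _ _).trans (hper m x).le
  · intro m hm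
    rw [lintegral_eq_zero_of_ae_eq_zero]
    filter_upwards [ae_mem_cell] with x hx
    rw [Set.indicator_of_notMem]; · rfl
    intro hmem
    exact hm (mem_ballCells hx (by simpa using hmem))

lemma eLpNorm_ball_le_of_isPeriodic {h : Space n → ℂ} (hper : IsPeriodic h) (r : ℝ) :
    eLpNorm ((Metric.closedBall 0 r).indicator h) 2 volume ≤
      (ballCells n r).card * eLpNorm h 2 (cellMeasure n) := by
  have h1 : IsPeriodic fun x => ‖h x‖ₑ ^ 2 := fun k x => by simp only [hper k x]
  have h2 := lintegral_ball_le_of_isPeriodic h1 r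
  refine (ENNReal.pow_right_strictMono two_ne_zero).le_iff_le.1 ?_
  simp only [mul_pow, eLpNorm_two_sq]
  have h3 : ∀ x, ‖(Metric.closedBall 0 r).indicator h x‖ₑ ^ 2 =
      (Metric.closedBall 0 r).indicator (fun x => ‖h x‖ₑ ^ 2) x := fun x => by
    by_cases hx : x ∈ Metric.closedBall (0 : Space n) r <;> simp [hx]
  simp only [h3]
  refine h2.trans (mul_le_mul_left ?_ _)
  rcases Nat.eq_zero_or_pos (ballCells n r).card with h | h
  · simp [h]
  · exact_mod_cast Nat.le_self_pow (by norm_num) _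

lemma norm_fderiv_le_sum_partialDeriv (f : Space n → ℂ) (x : Space n) :
    ‖fderiv ℝ f x‖ ≤ ∑ i, ‖partialDeriv i f x‖ := by
  refine ContinuousLinearMap.opNorm_le_bound _ (Finset.sum_nonneg fun i _ => norm_nonneg _)
    fun y => ?_
  have hy : y = ∑ i, y i • EuclideanSpace.single i (1 : ℝ) := by
    ext j
    simp [Finset.sum_apply, Pi.single_apply]
  conv_lhs => rw [hy]
  rw [map_sum, Finset.sum_mul]
  refine (norm_sum_le _ _).trans (Finset.sum_le_sum fun i _ => ?_)
  rw [map_smul, norm_smul, mul_comm]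
  exact mul_le_mul_of_nonneg_left (PiLp.norm_apply_le y i) (norm_nonneg _)

/-- The Sobolev exponent `2n/(n-2)`. -/
def sobolevExponent (n : ℕ) : ℝ≥0 := 2 * (n / (n - 2))

/-- The Sobolev inequality for smooth periodic functions: a cut-off function that equals one on the
cell reduces it to the Gagliardo-Nirenberg-Sobolev inequality on `ℝⁿ`. -/
lemma sobolev_smooth (hn : 3 ≤ n) : ∃ C : ℝ≥0, ∀ f : Space n → ℂ, ContDiff ℝ ∞ f →
    IsPeriodic f → eLpNorm f (sobolevExponent n) (cellMeasure n) ≤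
      C * (eLpNorm f 2 (cellMeasure n) +
        ∑ i, eLpNorm (partialDeriv i f) 2 (cellMeasure n)) := by
  have hr0 : 0 ≤ cellRadius n := by unfold cellRadius; positivity
  let χ : ContDiffBump (0 : Space n) :=
    ⟨cellRadius n + 1, cellRadius n + 2, by linarith, by linarith⟩
  obtain ⟨M, hM⟩ := (χ.contDiff (n := 1)).continuous_fderiv (by simp)
    |>.bounded_above_of_compact_support
    (χ.hasCompactSupport.fderiv (𝕜 := ℝ))
  have hM0 : 0 ≤ M := (norm_nonneg _).trans (hM 0)
  set K := SNormLESNormFDerivOfEqConst ℂ (volume : Measure (Space n)) 2 with hK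
  set N : ℝ≥0 := ((ballCells n (cellRadius n + 2)).card : ℝ≥0) with hN
  refine ⟨K * (M.toNNReal + 1) * N, fun f hf hper => ?_⟩
  set B := Metric.closedBall (0 : Space n) (cellRadius n + 2) with hB
  set u : Space n → ℂ := fun x => (χ x : ℂ) * f x with hu
  have hχ : ContDiff ℝ 1 fun x => (χ x : ℂ) := Complex.ofRealCLM.contDiff.comp χ.contDiff
  have huc : ContDiff ℝ 1 u := hχ.mul (hf.of_le (by exact_mod_cast le_top))
  have husupp : HasCompactSupport u := by
    refine HasCompactSupport.mul_right ?_
    exact χ.hasCompactSupport.comp_left (g := fun t : ℝ => (t : ℂ)) (by simp)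
  have h1 : eLpNorm f (sobolevExponent n) (cellMeasure n) ≤
      eLpNorm u (sobolevExponent n) volume := by
    refine le_trans (le_of_eq (eLpNorm_congr_ae ?_))
      (eLpNorm_mono_measure u (Measure.restrict_le_self (s := cell n)))
    filter_upwards [ae_mem_cell] with x hx
    have : χ x = 1 := χ.one_of_mem_closedBall (by
      simp only [Metric.mem_closedBall, dist_zero_right]
      show ‖x‖ ≤ cellRadius n + 1
      linarith [norm_le_of_mem_cell hx])
    simp [hu, this]
  have hn3 : (3 : ℝ) ≤ n := by exact_mod_cast hn
  have h2 : eLpNorm u (sobolevExponent n) volume ≤ K * eLpNorm (fderiv ℝ u) 2 volume := by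
    have h := eLpNorm_le_eLpNorm_fderiv_of_eq (μ := (volume : Measure (Space n))) huc husupp
      (p := 2) (p' := sobolevExponent n) (by norm_num) (by simp; omega) (by
        rw [finrank_euclideanSpace_fin, sobolevExponent]
        push_cast
        rw [NNReal.coe_sub (by exact_mod_cast (by omega : 2 ≤ n))]
        push_cast
        have : (n : ℝ) - 2 ≠ 0 := by linarith
        field_simp)
    simpa using h
  have hpt : ∀ x, ‖fderiv ℝ u x‖ ≤ ‖((M + 1 : ℝ) : ℂ) *
      (((‖B.indicator f x‖ + ∑ i, ‖B.indicator (partialDeriv i f) x‖ : ℝ)) : ℂ)‖ := fun x => by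
    have hs : 0 ≤ ‖B.indicator f x‖ + ∑ i, ‖B.indicator (partialDeriv i f) x‖ := by positivity
    rw [← Complex.ofReal_mul, Complex.norm_real, Real.norm_of_nonneg (by positivity)]
    by_cases hx : x ∈ B
    · simp only [Set.indicator_of_mem hx]
      have h3 : fderiv ℝ u x = (χ x : ℂ) • fderiv ℝ f x +
          f x • fderiv ℝ (fun x => (χ x : ℂ)) x :=
        fderiv_mul (hχ.differentiable (by simp) x) (hf.differentiable (by simp) x)
      have h4 : ‖fderiv ℝ (fun x => (χ x : ℂ)) x‖ ≤ M := by
        have h5 : fderiv ℝ (fun x => (χ x : ℂ)) x = Complex.ofRealCLM.comp (fderiv ℝ χ x) :=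
          (Complex.ofRealCLM.hasFDerivAt.comp x
            ((χ.contDiff (n := 1)).differentiable (by simp) x).hasFDerivAt).fderiv
        rw [h5]
        refine (ContinuousLinearMap.opNorm_comp_le _ _).trans ?_
        rw [Complex.ofRealCLM_norm, one_mul]
        exact hM x
      have h6 : ‖(χ x : ℂ)‖ ≤ 1 := by
        rw [Complex.norm_real, Real.norm_of_nonneg χ.nonneg]
        exact χ.le_one
      have h7 := norm_fderiv_le_sum_partialDeriv f x
      have h8 : 0 ≤ ∑ i, ‖partialDeriv i f x‖ := by positivity
      rw [h3]
      calc _ ≤ ‖(χ x : ℂ)‖ * ‖fderiv ℝ f x‖ + ‖f x‖ * ‖fderiv ℝ (fun x => (χ x : ℂ)) x‖ := by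
            refine (norm_add_le _ _).trans ?_
            rw [norm_smul, norm_smul]
        _ ≤ 1 * (∑ i, ‖partialDeriv i f x‖) + ‖f x‖ * M := by gcongr
        _ ≤ _ := by nlinarith [norm_nonneg (f x)]
    · have h3 : fderiv ℝ u x = 0 := by
        refine image_eq_zero_of_notMem_tsupport fun h => hx ?_
        have h4 : x ∈ tsupport u := tsupport_fderiv_subset ℝ h
        have h5 : x ∈ tsupport χ := by
          refine closure_mono ?_ h4
          intro y hy hy0
          exact hy (by simp [hu, hy0])
        rwa [χ.tsupport_eq] at h5
      rw [h3, norm_zero]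
      positivity
  have hfm : AEStronglyMeasurable (fun x => ‖B.indicator f x‖) volume :=
    (hf.continuous.aestronglyMeasurable.indicator Metric.isClosed_closedBall.measurableSet).norm
  have hgm : ∀ i, AEStronglyMeasurable (fun x => ‖B.indicator (partialDeriv i f) x‖) volume :=
    fun i => ((continuous_partialDeriv hf i).aestronglyMeasurable.indicator
      Metric.isClosed_closedBall.measurableSet).norm
  have h3 : eLpNorm (fderiv ℝ u) 2 volume ≤ (M.toNNReal + 1 : ℝ≥0) *
      (eLpNorm (B.indicator f) 2 volume +
        ∑ i, eLpNorm (B.indicator (partialDeriv i f)) 2 volume) := by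
    refine (eLpNorm_mono hpt).trans ?_
    have h4 : eLpNorm (fun x => ((M + 1 : ℝ) : ℂ) *
        (((‖B.indicator f x‖ + ∑ i, ‖B.indicator (partialDeriv i f) x‖ : ℝ)) : ℂ)) 2 volume =
        ‖((M + 1 : ℝ) : ℂ)‖ₑ * eLpNorm (fun x =>
          ‖B.indicator f x‖ + ∑ i, ‖B.indicator (partialDeriv i f) x‖) 2 volume := by
      have := eLpNorm_const_smul (p := 2) (μ := (volume : Measure (Space n))) ((M + 1 : ℝ) : ℂ)
        (fun x => (((‖B.indicator f x‖ + ∑ i, ‖B.indicator (partialDeriv i f) x‖ : ℝ)) : ℂ))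
      refine this.trans ?_
      congr 1
      exact eLpNorm_congr_norm_ae (Filter.Eventually.of_forall fun x => Complex.norm_real _)
    rw [h4]
    refine mul_le_mul' (le_of_eq ?_) ?_
    · rw [enorm_eq_nnnorm]
      congr 1
      ext
      rw [coe_nnnorm, Complex.norm_real, Real.norm_of_nonneg (by positivity)]
      push_cast
      rw [Real.coe_toNNReal _ hM0]
    · refine (eLpNorm_add_le hfm (Finset.aestronglyMeasurable_fun_sum _ fun i _ => hgm i)
        (by norm_num)).trans ?_
      refine add_le_add (eLpNorm_norm _).le ?_
      have hsum : (fun x => ∑ i, ‖B.indicator (partialDeriv i f) x‖) =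
          ∑ i, fun x => ‖B.indicator (partialDeriv i f) x‖ := by
        funext x; rw [Finset.sum_apply]
      rw [hsum]
      refine (eLpNorm_sum_le (fun i _ => hgm i) (by norm_num)).trans ?_
      exact Finset.sum_le_sum fun i _ => (eLpNorm_norm _).le
  refine h1.trans (h2.trans ?_)
  push_cast
  rw [mul_assoc (K : ENNReal), mul_assoc (K : ENNReal)]
  refine mul_le_mul_right ?_ _
  refine h3.trans ?_
  push_cast
  rw [mul_assoc]
  refine mul_le_mul_right ?_ _
  rw [mul_add, Finset.mul_sum]
  refine add_le_add ?_ (Finset.sum_le_sum fun i _ => ?_)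
  · simpa [hN] using eLpNorm_ball_le_of_isPeriodic hper (cellRadius n + 2)
  · simpa [hN] using
      eLpNorm_ball_le_of_isPeriodic (isPeriodic_partialDeriv hper i) (cellRadius n + 2)

/-- The partial sum over `F` of the Fourier series of `r`. -/
def trigSum (F : Finset (Fin n → ℤ)) (r : CellL2 n) (x : Space n) : ℂ :=
  ∑ k ∈ F, inner ℂ (expL2 k) r * ((cellNorm n : ℂ) * planeWave (intVec k) x)

lemma contDiff_trigSum (F : Finset (Fin n → ℤ)) (r : CellL2 n) : ContDiff ℝ ∞ (trigSum F r) :=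
  ContDiff.sum fun _ _ => contDiff_const.mul (contDiff_const.mul (contDiff_planeWave _))

lemma isPeriodic_trigSum (F : Finset (Fin n → ℤ)) (r : CellL2 n) : IsPeriodic (trigSum F r) :=
  fun m x => Finset.sum_congr rfl fun k _ => by rw [isPeriodic_planeWave k m x]

lemma partialDeriv_trigSum (F : Finset (Fin n → ℤ)) (p : TorusH1 n) (i : Fin n) :
    partialDeriv i (trigSum F (fn p)) = trigSum F (gr i p) := by
  funext x
  have hd : ∀ k : Fin n → ℤ, DifferentiableAt ℝ (planeWave (intVec k)) x := fun k =>
    (contDiff_planeWave _).differentiable (by simp) x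
  have h : HasFDerivAt (trigSum F (fn p)) (∑ k ∈ F, (inner ℂ (expL2 k) (fn p) : ℂ) •
      ((cellNorm n : ℂ) • fderiv ℝ (planeWave (intVec k)) x)) x :=
    HasFDerivAt.fun_sum fun k _ => ((hd k).hasFDerivAt.const_mul _).const_mul _
  rw [partialDeriv, h.fderiv, _root_.sum_apply, trigSum]
  refine Finset.sum_congr rfl fun k _ => ?_
  have h1 := partialDeriv_planeWave (intVec k) i x
  rw [partialDeriv] at h1
  rw [inner_expL2_gr]
  simp only [_root_.smul_apply, h1, smul_eq_mul, intVec_apply]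
  push_cast
  ring

lemma coeFn_sum_expL2 (F : Finset (Fin n → ℤ)) (r : CellL2 n) :
    (∑ k ∈ F, (inner ℂ (expL2 k) r : ℂ) • expL2 k : CellL2 n) =ᵐ[cellMeasure n] trigSum F r := by
  have h : ∀ k ∈ F, ((inner ℂ (expL2 k) r : ℂ) • expL2 k : CellL2 n) =ᵐ[cellMeasure n]
      fun x => inner ℂ (expL2 k) r * ((cellNorm n : ℂ) * planeWave (intVec k) x) := fun k _ => by
    filter_upwards [Lp.coeFn_smul (inner ℂ (expL2 k) r : ℂ) (expL2 k), coeFn_expL2 k] with x h1 h2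
    rw [h1, Pi.smul_apply, h2, smul_eq_mul]
  refine (Lp.coeFn_finsetSum F _).trans ?_
  have h2 := (Filter.eventually_all_finset F).2 h
  filter_upwards [h2] with x hx
  rw [Finset.sum_apply, trigSum]
  exact Finset.sum_congr rfl hx

lemma norm_sum_expL2_le (F : Finset (Fin n → ℤ)) (r : CellL2 n) :
    ‖∑ k ∈ F, (inner ℂ (expL2 k) r : ℂ) • expL2 k‖ ≤ ‖r‖ := by
  refine (sq_le_sq₀ (norm_nonneg _) (norm_nonneg _)).1 ?_
  have h := orthonormal_expL2.sum_inner_products_le r (s := F)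
  refine le_trans (le_of_eq ?_) h
  have h1 := orthonormal_expL2.inner_sum (fun k => inner ℂ (expL2 k) r)
    (fun k => inner ℂ (expL2 k) r) F
  rw [inner_self_eq_norm_sq_to_K] at h1
  have h2 : ∀ k : Fin n → ℤ, conj (inner ℂ (expL2 k) r : ℂ) * inner ℂ (expL2 k) r =
      ((‖(inner ℂ (expL2 k) r : ℂ)‖ ^ 2 : ℝ) : ℂ) := fun k => by
    rw [mul_comm, Complex.mul_conj, Complex.normSq_eq_norm_sq]
  simp only [h2] at h1
  rw [← Complex.ofReal_sum] at h1
  apply Complex.ofReal_injective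
  rw [Complex.ofReal_pow]
  exact h1

lemma eLpNorm_trigSum_le (F : Finset (Fin n → ℤ)) (r : CellL2 n) :
    eLpNorm (trigSum F r) 2 (cellMeasure n) ≤ ‖r‖ₑ := by
  rw [← eLpNorm_congr_ae (coeFn_sum_expL2 F r), ← Lp.enorm_def]
  exact enorm_le_iff_norm_le.2 (norm_sum_expL2_le F r)

/-- Hölder's inequality for the exponents `n/2` and `n/(n-2)`. -/
lemma lintegral_mul_sq_le (hn : 3 ≤ n) {q f : Space n → ℂ} {μ : Measure (Space n)}
    (hq : AEStronglyMeasurable q μ) (hf : AEStronglyMeasurable f μ) :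
    ∫⁻ x, ‖q x‖ₑ * ‖f x‖ₑ ^ 2 ∂μ ≤
      eLpNorm q ((n : ENNReal) / 2) μ * eLpNorm f (sobolevExponent n) μ ^ 2 := by
  have hn3 : (3 : ℝ) ≤ n := by exact_mod_cast hn
  set a : ℝ := n / 2 with ha
  set b : ℝ := n / (n - 2) with hb
  have hn2 : (0 : ℝ) < n - 2 := by linarith
  have hab : a.HolderConjugate b := by
    rw [Real.holderConjugate_iff]
    constructor
    · rw [ha]; linarith
    · rw [ha, hb]; field_simp; ring
  have hapos : 0 < a := by rw [ha]; linarith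
  have hbpos : 0 < b := by rw [hb]; positivity
  have h := ENNReal.lintegral_mul_le_Lp_mul_Lq μ hab hq.enorm (hf.enorm.pow_const 2)
  refine h.trans (le_of_eq ?_)
  have hae : (n : ENNReal) / 2 = ENNReal.ofReal a := by
    rw [ha, ENNReal.ofReal_div_of_pos (by norm_num)]; simp
  have hbe : (sobolevExponent n : ENNReal) = ENNReal.ofReal (2 * b) := by
    rw [← ENNReal.ofReal_coe_nnreal, sobolevExponent, hb]
    congr 1
    push_cast
    rw [NNReal.coe_sub (by exact_mod_cast (by omega : 2 ≤ n))]
    push_cast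
    rfl
  rw [hae, hbe, eLpNorm_eq_lintegral_rpow_enorm_toReal (by simpa using hapos) ENNReal.ofReal_ne_top,
    eLpNorm_eq_lintegral_rpow_enorm_toReal (by simpa using hbpos) ENNReal.ofReal_ne_top,
    ENNReal.toReal_ofReal hapos.le, ENNReal.toReal_ofReal (by positivity)]
  congr 1
  have h1 : ∀ x, (‖f x‖ₑ ^ 2) ^ b = ‖f x‖ₑ ^ (2 * b) := fun x => by
    rw [← ENNReal.rpow_natCast, ← ENNReal.rpow_mul]; norm_num
  simp only [h1]
  rw [← ENNReal.rpow_natCast, ← ENNReal.rpow_mul]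
  congr 1
  push_cast
  field_simp

/-- The Sobolev inequality on the torus: multiplication by an `L^{n/2}` function is form bounded
on `H¹(𝕋ⁿ)`. It holds for trigonometric polynomials by cutting them off and applying the
Gagliardo-Nirenberg-Sobolev inequality, and passes to limits by Fatou's lemma. -/
lemma exists_sobolev_bound (hn : 3 ≤ n) : ∃ C : ℝ≥0, ∀ q : Space n → ℂ,
    AEStronglyMeasurable q (cellMeasure n) → ∀ p : TorusH1 n,
      ∫⁻ x, ‖q x‖ₑ * ‖fn p x‖ₑ ^ 2 ∂(cellMeasure n) ≤
        C * eLpNorm q ((n : ENNReal) / 2) (cellMeasure n) * ‖p‖ₑ ^ 2 := by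
  obtain ⟨C, hC⟩ := sobolev_smooth hn
  refine ⟨(C * (1 + n)) ^ 2, fun q hq p => ?_⟩
  have hbound : ∀ F : Finset (Fin n → ℤ),
      ∫⁻ x, ‖q x‖ₑ * ‖trigSum F (fn p) x‖ₑ ^ 2 ∂(cellMeasure n) ≤
        ((C * (1 + n)) ^ 2 : ℝ≥0) * eLpNorm q ((n : ENNReal) / 2) (cellMeasure n) * ‖p‖ₑ ^ 2 := by
    intro F
    have h1 := hC _ (contDiff_trigSum F (fn p)) (isPeriodic_trigSum F _)
    have h2 : eLpNorm (trigSum F (fn p)) (sobolevExponent n) (cellMeasure n) ≤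
        (C * (1 + n) : ℝ≥0) * ‖p‖ₑ := by
      refine h1.trans ?_
      push_cast
      rw [mul_assoc]
      refine mul_le_mul_right ?_ _
      rw [add_mul, one_mul]
      refine add_le_add ?_ ?_
      · exact (eLpNorm_trigSum_le F _).trans (enorm_le_iff_norm_le.2 (norm_fn_le p))
      · refine (Finset.sum_le_card_nsmul _ _ ‖p‖ₑ fun i _ => ?_).trans ?_
        · rw [partialDeriv_trigSum]
          exact (eLpNorm_trigSum_le F _).trans (enorm_le_iff_norm_le.2 (norm_gr_le i p))
        · simp
    refine (lintegral_mul_sq_le hn hq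
      (contDiff_trigSum F (fn p)).continuous.aestronglyMeasurable).trans ?_
    calc _ ≤ eLpNorm q ((n : ENNReal) / 2) (cellMeasure n) * ((C * (1 + n) : ℝ≥0) * ‖p‖ₑ) ^ 2 := by
          gcongr
      _ = _ := by push_cast; ring
  -- almost everywhere convergence of partial sums along a sequence
  have hsum : Filter.Tendsto (fun F : Finset (Fin n → ℤ) =>
      (∑ k ∈ F, (inner ℂ (expL2 k) (fn p) : ℂ) • expL2 k : CellL2 n)) Filter.atTop
      (nhds (fn p)) := by
    have := (fourierL2 (n := n)).hasSum_repr (fn p)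
    simp only [HilbertBasis.repr_apply_apply, coe_fourierL2] at this
    exact this
  obtain ⟨F, -, hF⟩ := (tendstoInMeasure_of_tendsto_Lp hsum).exists_seq_tendsto_ae'
  have hF2 : ∀ᵐ x ∂(cellMeasure n), Filter.Tendsto (fun j => trigSum (F j) (fn p) x) Filter.atTop
      (nhds (fn p x)) := by
    have h1 := ae_all_iff.2 fun j => coeFn_sum_expL2 (F j) (fn p)
    filter_upwards [hF, h1] with x hx h2
    simpa only [h2] using hx
  have hq' := hq.enorm
  have hlim : ∀ᵐ x ∂(cellMeasure n), ‖q x‖ₑ * ‖fn p x‖ₑ ^ 2 =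
      Filter.liminf (fun j => ‖q x‖ₑ * ‖trigSum (F j) (fn p) x‖ₑ ^ 2) Filter.atTop := by
    filter_upwards [hF2] with x hx
    refine (Filter.Tendsto.liminf_eq ?_).symm
    exact ENNReal.Tendsto.const_mul ((ENNReal.continuous_pow 2).tendsto _ |>.comp hx.enorm)
      (Or.inr enorm_ne_top)
  rw [lintegral_congr_ae hlim]
  refine (lintegral_liminf_le' fun j => hq'.mul
    ((contDiff_trigSum (F j) (fn p)).continuous.aestronglyMeasurable.enorm.pow_const 2)).trans ?_
  refine (Filter.liminf_le_liminf (Filter.Eventually.of_forall fun j => hbound (F j))).trans ?_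
  simp

/-! ### Holomorphic families that are invertible up to finite rank -/

section Fredholm

variable {H : Type*} [NormedAddCommGroup H] [NormedSpace ℂ H] [CompleteSpace H]
  {S : Type*} [Fintype S]

/-- If `B + J'J` is invertible, then `B` is invertible as soon as it is injective, and this is
decided by the finite determinant of `1 - J(B + J'J)⁻¹J'`. -/
lemma finrank_perturbation (B : H →L[ℂ] H) (J : H →L[ℂ] (S → ℂ)) (J' : (S → ℂ) →L[ℂ] H)
    (hT : IsUnit (B + J'.comp J)) :
    (Function.Injective B →
      LinearMap.det (((1 : (S → ℂ) →L[ℂ] (S → ℂ)) -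
        J.comp ((Ring.inverse (B + J'.comp J)).comp J') :
        (S → ℂ) →L[ℂ] (S → ℂ)) : (S → ℂ) →ₗ[ℂ] (S → ℂ)) ≠ 0) ∧
    (LinearMap.det (((1 : (S → ℂ) →L[ℂ] (S → ℂ)) - J.comp ((Ring.inverse (B + J'.comp J)).comp J') :
        (S → ℂ) →L[ℂ] (S → ℂ)) : (S → ℂ) →ₗ[ℂ] (S → ℂ)) ≠ 0 → IsUnit B) := by
  set T := B + J'.comp J with hTdef
  set R := Ring.inverse T with hR
  set A : (S → ℂ) →L[ℂ] (S → ℂ) := 1 - J.comp (R.comp J') with hA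
  have hRT : ∀ x, R (T x) = x := fun x => by
    have := Ring.inverse_mul_cancel T hT
    exact congrArg (fun f : H →L[ℂ] H => f x) this
  have hTR : ∀ x, T (R x) = x := fun x => by
    have := Ring.mul_inverse_cancel T hT
    exact congrArg (fun f : H →L[ℂ] H => f x) this
  have hTx : ∀ x, T x = B x + J' (J x) := fun x => rfl
  have hAx : ∀ y, A y = y - J (R (J' y)) := fun y => rfl
  constructor
  · intro hB hdet
    obtain ⟨y, hy0, hy⟩ := (Submodule.ne_bot_iff _).1
      (LinearMap.bot_lt_ker_of_det_eq_zero hdet).ne'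
    rw [LinearMap.mem_ker] at hy0
    have h1 : y = J (R (J' y)) := sub_eq_zero.1 (by rw [← hAx]; exact hy0)
    have h2 : B (R (J' y)) = 0 := by
      have h3 := hTR (J' y)
      rw [hTx, ← h1] at h3
      simpa using h3
    have h3 : R (J' y) = 0 := hB (by rw [h2, map_zero])
    rw [h3, map_zero] at h1
    exact hy h1
  · intro hdet
    have hAu : IsUnit (A : (S → ℂ) →ₗ[ℂ] (S → ℂ)) :=
      (LinearMap.isUnit_iff_isUnit_det _).2 (isUnit_iff_ne_zero.2 hdet)
    have hAbij := (Module.End.isUnit_iff _).1 hAu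
    rw [ContinuousLinearMap.isUnit_iff_bijective]
    constructor
    · rw [injective_iff_map_eq_zero]
      intro x hx
      have h1 : x = R (J' (J x)) := by
        conv_lhs => rw [← hRT x, hTx, hx, zero_add]
      have h2 : A (J x) = 0 := by
        rw [hAx, ← h1, sub_self]
      have h3 : J x = 0 := hAbij.1 (by
        show A (J x) = A 0
        rw [h2, map_zero])
      rw [h1, h3, map_zero, map_zero]
    · intro y
      obtain ⟨s, hs⟩ := hAbij.2 (J (R y))
      have hs' : s - J (R (J' s)) = J (R y) := hs
      refine ⟨R y + R (J' s), ?_⟩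
      have h1 : J (R y + R (J' s)) = s := by rw [map_add, ← hs', sub_add_cancel]
      have h2 : T (R y + R (J' s)) = y + J' s := by rw [map_add, hTR, hTR]
      rw [hTx, h1] at h2
      exact add_right_cancel h2

/-- A holomorphic family of operators on a disc that becomes invertible after adding an operator
of finite rank and is injective at one point fails to be invertible on a countable set only. -/
lemma countable_not_isUnit [DecidableEq S] (B : ℂ → H →L[ℂ] H) (hB : Differentiable ℂ B)
    (J : H →L[ℂ] (S → ℂ)) (J' : (S → ℂ) →L[ℂ] H) (r : ℝ)
    (hT : ∀ t ∈ Metric.ball (0 : ℂ) r, IsUnit (B t + J'.comp J))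
    (t₀ : ℂ) (ht₀ : t₀ ∈ Metric.ball (0 : ℂ) r) (hinj : Function.Injective (B t₀)) :
    {t ∈ Metric.ball (0 : ℂ) r | ¬ IsUnit (B t)}.Countable := by
  set A : ℂ → (S → ℂ) →L[ℂ] (S → ℂ) :=
    fun t => 1 - J.comp ((Ring.inverse (B t + J'.comp J)).comp J') with hA
  set d : ℂ → ℂ := fun t => LinearMap.det ((A t : (S → ℂ) →L[ℂ] (S → ℂ)) :
    (S → ℂ) →ₗ[ℂ] (S → ℂ)) with hd
  have hAd : DifferentiableOn ℂ A (Metric.ball (0 : ℂ) r) := by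
    intro t ht
    have h1 : DifferentiableAt ℂ (fun t => Ring.inverse (B t + J'.comp J)) t := by
      have h2 : DifferentiableAt ℂ Ring.inverse (B t + J'.comp J) :=
        differentiableAt_inverse (hT t ht)
      exact h2.comp t ((hB t).add_const _)
    refine DifferentiableAt.differentiableWithinAt ?_
    exact (differentiableAt_const _).sub
      ((differentiableAt_const _).clm_comp (h1.clm_comp (differentiableAt_const _)))
  have hdd : DifferentiableOn ℂ d (Metric.ball (0 : ℂ) r) := by
    -- the Leibniz formula shows that the determinant is holomorphic
    have h1 : d = fun t => ∑ σ : Equiv.Perm S, ((Equiv.Perm.sign σ : ℤ) : ℂ) *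
        ∏ i, (A t) (Pi.single i 1) (σ i) := by
      funext t
      simp only [hd]
      rw [← LinearMap.det_toMatrix', Matrix.det_apply']
      refine Finset.sum_congr rfl fun σ _ => ?_
      congr 1
    rw [h1]
    refine DifferentiableOn.fun_sum fun σ _ => (differentiableOn_const _).mul ?_
    refine DifferentiableOn.fun_finsetProd fun i _ => ?_
    exact differentiableOn_pi.1 (hAd.clm_apply (differentiableOn_const _)) (σ i)
  have hda : AnalyticOnNhd ℂ d (Metric.ball (0 : ℂ) r) := hdd.analyticOnNhd Metric.isOpen_ball
  have hne : d t₀ ≠ 0 := (finrank_perturbation (B t₀) J J' (hT t₀ ht₀)).1 hinj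
  have hconn : IsConnected (Metric.ball (0 : ℂ) r) :=
    ⟨⟨t₀, ht₀⟩, (convex_ball _ _).isPreconnected⟩
  have hcod := hda.preimage_zero_mem_codiscreteWithin hne ht₀ hconn
  have hcount : ((d ⁻¹' {0}ᶜ)ᶜ ∩ Metric.ball (0 : ℂ) r).Countable := by
    apply (HereditarilyLindelofSpace.isLindelof _).countable_of_isDiscrete
      (isDiscrete_of_codiscreteWithin _)
    simpa using! hcod
  refine hcount.mono ?_
  rintro t ⟨ht, hnu⟩
  refine ⟨fun hdt => hnu ?_, ht⟩
  exact (finrank_perturbation (B t) J J' (hT t ht)).2 hdt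

end Fredholm

/-- If the bad set of parameters meets each complex coordinate line that contains a good point in a
countable set only, then almost every real parameter is good. The proof is an induction on the
number of variables by Fubini's theorem. -/
lemma ae_real_of_countable_on_lines : ∀ (n : ℕ) (G : Set (Fin n → ℂ)), IsOpen G →
    (∀ θ ∈ G, ∀ j, {t : ℂ | Function.update θ j t ∉ G}.Countable) → G.Nonempty →
    ∀ᵐ x : Fin n → ℝ, (fun i => (x i : ℂ)) ∈ G := by
  intro n
  induction n with
  | zero =>
    rintro G - - ⟨θ, hθ⟩
    refine Filter.Eventually.of_forall fun x => ?_
    convert hθ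
  | succ n ih =>
    rintro G hG hline ⟨θ, hθ⟩
    have hcons : Continuous fun p : ℝ × (Fin n → ℝ) =>
        (Fin.cons (p.1 : ℂ) (fun i => (p.2 i : ℂ)) : Fin (n + 1) → ℂ) := by
      refine continuous_pi fun i => ?_
      refine Fin.cases ?_ (fun i => ?_) i
      · simp only [Fin.cons_zero]; fun_prop
      · simp only [Fin.cons_succ]; fun_prop
    set P : Set (ℝ × (Fin n → ℝ)) := {p | (Fin.cons (p.1 : ℂ) (fun i => (p.2 i : ℂ)) :
      Fin (n + 1) → ℂ) ∈ G} with hP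
    have hPm : MeasurableSet P := (hG.preimage hcons).measurableSet
    have hprod : ∀ᵐ p : ℝ × (Fin n → ℝ), p ∈ P := by
      rw [Measure.volume_eq_prod]
      rw [Measure.ae_prod_mem_iff_ae_ae_mem hPm]
      have hc := hline θ hθ 0
      have hc' : {t : ℝ | Function.update θ 0 (t : ℂ) ∉ G}.Countable :=
        hc.preimage Complex.ofReal_injective
      have hae : ∀ᵐ t : ℝ, t ∉ {t : ℝ | Function.update θ 0 (t : ℂ) ∉ G} :=
        hc'.ae_notMem volume
      filter_upwards [hae] with t ht
      have ht' : Function.update θ 0 (t : ℂ) ∈ G := not_not.1 ht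
      have hθ' : Function.update θ 0 (t : ℂ) = Fin.cons (t : ℂ) (Fin.tail θ) := by
        conv_lhs => rw [← Fin.cons_self_tail θ, Fin.update_cons_zero]
      refine ih {η | (Fin.cons (t : ℂ) η : Fin (n + 1) → ℂ) ∈ G} ?_ ?_ ⟨Fin.tail θ, by
        rw [hθ'] at ht'; exact ht'⟩
      · refine hG.preimage (continuous_pi fun i => ?_)
        refine Fin.cases ?_ (fun i => ?_) i
        · simp only [Fin.cons_zero]; fun_prop
        · simp only [Fin.cons_succ]; fun_prop
      · intro η hη j
        have := hline _ hη j.succ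
        refine this.mono fun s hs => ?_
        rw [Set.mem_ofPred_eq, ← Fin.cons_update]
        exact hs
    have hmp := volume_preserving_piFinSuccAbove (fun _ : Fin (n + 1) => ℝ) 0
    have h1 := hmp.quasiMeasurePreserving.ae hprod
    filter_upwards [h1] with x hx
    have hx' : (Fin.cons ((x 0 : ℝ) : ℂ) (fun i => ((x (Fin.succ i) : ℝ) : ℂ)) :
        Fin (n + 1) → ℂ) ∈ G := hx
    convert hx' using 1
    funext i
    refine Fin.cases rfl (fun i => rfl) i

/-! ### The forms `h(θ)` as operators on `H¹(𝕋ⁿ)` -/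

/-- Multiplication by an essentially bounded function on `L²(𝕋ⁿ)`. -/
def mulOp (b : Space n → ℂ) (hb : MemLp b ⊤ (cellMeasure n)) : CellL2 n →L[ℂ] CellL2 n :=
  (ContinuousLinearMap.mul ℂ ℂ).holderL (cellMeasure n) ⊤ 2 2 hb.toLp

lemma coeFn_mulOp (b : Space n → ℂ) (hb : MemLp b ⊤ (cellMeasure n)) (p : CellL2 n) :
    mulOp b hb p =ᵐ[cellMeasure n] fun x => b x * p x := by
  filter_upwards [ContinuousLinearMap.coeFn_holder (r := 2) (ContinuousLinearMap.mul ℂ ℂ)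
    hb.toLp p, hb.coeFn_toLp] with x h1 h2
  rw [← h2]
  exact h1

lemma inner_mulOp (b : Space n → ℂ) (hb : MemLp b ⊤ (cellMeasure n)) (p r : CellL2 n) :
    inner ℂ r (mulOp b hb p) = ∫ x, b x * p x * conj (r x) ∂(cellMeasure n) := by
  rw [L2.inner_def]
  refine integral_congr_ae ?_
  filter_upwards [coeFn_mulOp b hb p] with x hx
  rw [hx, RCLike.inner_apply]

lemma integrable_mul_mul_conj {b : Space n → ℂ} (hb : MemLp b ⊤ (cellMeasure n))
    (p r : CellL2 n) : Integrable (fun x => b x * p x * conj (r x)) (cellMeasure n) := by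
  refine (L2.integrable_inner (𝕜 := ℂ) r (mulOp b hb p)).congr ?_
  filter_upwards [coeFn_mulOp b hb p] with x hx
  rw [hx, RCLike.inner_apply]

section Potential

variable (hn : 3 ≤ n) {Q : Space n → ℂ} (hQ : MemLp Q ((n : ENNReal) / 2) (cellMeasure n))

include hn hQ in
lemma memLp_sqrt_mul (u : TorusH1 n) :
    MemLp (fun x => (Real.sqrt ‖Q x‖ : ℂ) * fn u x) 2 (cellMeasure n) := by
  obtain ⟨C, hC⟩ := exists_sobolev_bound hn
  refine ⟨?_, ?_⟩
  · exact ((Complex.continuous_ofReal.comp Real.continuous_sqrt).comp_aestronglyMeasurable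
      hQ.1.norm).mul (Lp.aestronglyMeasurable _)
  · have h := hC Q hQ.1 u
    have h2 : eLpNorm (fun x => (Real.sqrt ‖Q x‖ : ℂ) * fn u x) 2 (cellMeasure n) ^ 2 < ⊤ := by
      rw [eLpNorm_two_sq]
      refine lt_of_le_of_lt (le_trans (le_of_eq ?_) h) ?_
      · refine lintegral_congr fun x => ?_
        rw [enorm_mul, mul_pow]
        congr 1
        rw [← ofReal_norm, Complex.norm_real, ← ENNReal.ofReal_pow (norm_nonneg _),
          Real.norm_of_nonneg (Real.sqrt_nonneg _), Real.sq_sqrt (norm_nonneg _), ofReal_norm]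
      · exact ENNReal.mul_lt_top (ENNReal.mul_lt_top ENNReal.coe_lt_top hQ.2)
          (ENNReal.pow_lt_top enorm_lt_top)
    by_contra hcon
    rw [not_lt, top_le_iff] at hcon
    simp [hcon] at h2

/-- Multiplication by `|Q|^{1/2}`, bounded from `H¹(𝕋ⁿ)` to `L²(𝕋ⁿ)` by the Sobolev inequality. -/
def sqrtMul : TorusH1 n →L[ℂ] CellL2 n :=
  LinearMap.mkContinuousOfExistsBound
    { toFun := fun u => (memLp_sqrt_mul hn hQ u).toLp
      map_add' := fun u v => by
        rw [← MemLp.toLp_add]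
        refine MemLp.toLp_congr _ _ ?_
        filter_upwards [Lp.coeFn_add (fn u) (fn v)] with x hx
        rw [map_add, hx, Pi.add_apply, Pi.add_apply, mul_add]
      map_smul' := fun c u => by
        rw [RingHom.id_apply, ← MemLp.toLp_const_smul]
        refine MemLp.toLp_congr _ _ ?_
        filter_upwards [Lp.coeFn_smul c (fn u)] with x hx
        rw [map_smul, hx, Pi.smul_apply, Pi.smul_apply, smul_eq_mul, smul_eq_mul]
        ring } (by
    obtain ⟨C, hC⟩ := exists_sobolev_bound hn
    set N := C * (eLpNorm Q ((n : ENNReal) / 2) (cellMeasure n)) with hN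
    have hNt : N ≠ ⊤ := ENNReal.mul_ne_top ENNReal.coe_ne_top hQ.2.ne
    refine ⟨Real.sqrt N.toReal, fun u => ?_⟩
    show ‖(memLp_sqrt_mul hn hQ u).toLp‖ ≤ _
    refine (sq_le_sq₀ (norm_nonneg _) (by positivity)).1 ?_
    rw [mul_pow, Real.sq_sqrt ENNReal.toReal_nonneg]
    have h1 : ‖(memLp_sqrt_mul hn hQ u).toLp‖ₑ ^ 2 ≤ N * ‖u‖ₑ ^ 2 := by
      refine le_trans (le_of_eq ?_) (hC Q hQ.1 u)
      rw [Lp.enorm_toLp, eLpNorm_two_sq]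
      refine lintegral_congr fun x => ?_
      rw [enorm_mul, mul_pow]
      congr 1
      rw [← ofReal_norm, Complex.norm_real, ← ENNReal.ofReal_pow (norm_nonneg _),
        Real.norm_of_nonneg (Real.sqrt_nonneg _), Real.sq_sqrt (norm_nonneg _), ofReal_norm]
    have h2 := ENNReal.toReal_mono (ENNReal.mul_ne_top hNt
      (ENNReal.pow_ne_top enorm_ne_top)) h1
    simpa [ENNReal.toReal_mul, ENNReal.toReal_pow, toReal_enorm] using h2)

lemma coeFn_sqrtMul (u : TorusH1 n) :
    sqrtMul hn hQ u =ᵐ[cellMeasure n] fun x => (Real.sqrt ‖Q x‖ : ℂ) * fn u x :=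
  (memLp_sqrt_mul hn hQ u).coeFn_toLp

lemma norm_sq_sqrtMul (u : TorusH1 n) :
    ‖sqrtMul hn hQ u‖ₑ ^ 2 = ∫⁻ x, ‖Q x‖ₑ * ‖fn u x‖ₑ ^ 2 ∂(cellMeasure n) := by
  rw [enorm_sq_eq_lintegral]
  refine lintegral_congr_ae ?_
  filter_upwards [coeFn_sqrtMul hn hQ u] with x hx
  rw [hx, enorm_mul, mul_pow]
  congr 1
  rw [← ofReal_norm, Complex.norm_real, ← ENNReal.ofReal_pow (norm_nonneg _),
    Real.norm_of_nonneg (Real.sqrt_nonneg _), Real.sq_sqrt (norm_nonneg _), ofReal_norm]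

include hQ in
lemma memLp_phase : MemLp (fun x => Q x / (‖Q x‖ : ℂ)) ⊤ (cellMeasure n) := by
  refine memLp_top_of_bound (hQ.1.div₀
    (Complex.continuous_ofReal.comp_aestronglyMeasurable hQ.1.norm)) 1
    (Filter.Eventually.of_forall fun x => ?_)
  rw [norm_div, Complex.norm_real, norm_norm]
  exact div_self_le_one _

/-- The bounded operator on `H¹(𝕋ⁿ)` of the form `∫ Q u v̄` of a potential `Q ∈ L^{n/2}`, written
through the factorization `Q = |Q|^{1/2} · (Q/|Q|) · |Q|^{1/2}`. -/
def potentialOp : TorusH1 n →L[ℂ] TorusH1 n :=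
  (sqrtMul hn hQ).adjoint ∘L (mulOp _ (memLp_phase hQ)) ∘L (sqrtMul hn hQ)

lemma phase_sqrt_sqrt (z u v : ℂ) : z / (‖z‖ : ℂ) * ((Real.sqrt ‖z‖ : ℂ) * u) *
    conj ((Real.sqrt ‖z‖ : ℂ) * v) = z * u * conj v := by
  rcases eq_or_ne z 0 with h | h
  · simp [h]
  · have h1 : (Real.sqrt ‖z‖ : ℂ) * (Real.sqrt ‖z‖ : ℂ) = (‖z‖ : ℂ) := by
      rw [← Complex.ofReal_mul, Real.mul_self_sqrt (norm_nonneg _)]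
    have h2 : (‖z‖ : ℂ) ≠ 0 := by exact_mod_cast (norm_ne_zero_iff.2 h)
    rw [map_mul, Complex.conj_ofReal]
    calc _ = z / (‖z‖ : ℂ) * ((Real.sqrt ‖z‖ : ℂ) * (Real.sqrt ‖z‖ : ℂ)) * u * conj v := by ring
      _ = _ := by rw [h1]; field_simp

lemma inner_potentialOp (u v : TorusH1 n) :
    inner ℂ v (potentialOp hn hQ u) = ∫ x, Q x * fn u x * conj (fn v x) ∂(cellMeasure n) := by
  rw [potentialOp, ContinuousLinearMap.comp_apply, ContinuousLinearMap.adjoint_inner_right,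
    ContinuousLinearMap.comp_apply, inner_mulOp]
  refine integral_congr_ae ?_
  filter_upwards [coeFn_sqrtMul hn hQ u, coeFn_sqrtMul hn hQ v] with x h1 h2
  rw [h1, h2, phase_sqrt_sqrt]

include hn hQ in
lemma integrable_potential (u v : TorusH1 n) :
    Integrable (fun x => Q x * fn u x * conj (fn v x)) (cellMeasure n) := by
  refine (integrable_mul_mul_conj (memLp_phase hQ) (sqrtMul hn hQ u) (sqrtMul hn hQ v)).congr ?_
  filter_upwards [coeFn_sqrtMul hn hQ u, coeFn_sqrtMul hn hQ v] with x h1 h2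
  rw [h1, h2, phase_sqrt_sqrt]

lemma norm_mulOp_phase_le (p : CellL2 n) : ‖mulOp _ (memLp_phase hQ) p‖ ≤ ‖p‖ := by
  refine Lp.norm_le_norm_of_ae_le ?_
  filter_upwards [coeFn_mulOp _ (memLp_phase hQ) p] with x hx
  rw [hx, norm_mul, norm_div, Complex.norm_real, norm_norm]
  exact mul_le_of_le_one_left (norm_nonneg _) (div_self_le_one _)

lemma norm_inner_potentialOp_le (u : TorusH1 n) :
    ‖(inner ℂ u (potentialOp hn hQ u) : ℂ)‖ ≤ ‖sqrtMul hn hQ u‖ ^ 2 := by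
  rw [potentialOp, ContinuousLinearMap.comp_apply, ContinuousLinearMap.adjoint_inner_right,
    ContinuousLinearMap.comp_apply, sq]
  exact (norm_inner_le_norm _ _).trans (mul_le_mul_of_nonneg_left
    (norm_mulOp_phase_le hQ _) (norm_nonneg _))

/-- A potential in `L^{n/2}` is infinitesimally form bounded: split off its large values, whose
`L^{n/2}` norm is small. -/
lemma potential_infinitesimal {ε : ℝ} (hε : 0 < ε) : ∃ K : ℝ, 0 ≤ K ∧ ∀ u : TorusH1 n,
    ‖(inner ℂ u (potentialOp hn hQ u) : ℂ)‖ ≤ ε * ‖u‖ ^ 2 + K * ‖fn u‖ ^ 2 := by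
  obtain ⟨C, hC⟩ := exists_sobolev_bound hn
  obtain ⟨Q', hQ'm, hQ'⟩ := hQ.1
  have hQ'L : MemLp Q' ((n : ENNReal) / 2) (cellMeasure n) := (memLp_congr_ae hQ').1 hQ
  have hε' : 0 < ε / (C + 1) := by positivity
  obtain ⟨M, hM⟩ := hQ'L.eLpNorm_indicator_norm_ge_le hQ'm hε'
  refine ⟨max M 0, le_max_right _ _, fun u => (norm_inner_potentialOp_le hn hQ u).trans ?_⟩
  set s := {x | M ≤ ‖Q' x‖₊} with hs
  have hsm : MeasurableSet s :=
    measurableSet_le measurable_const hQ'm.measurable.nnnorm.coe_nnreal_real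
  have h1 : ‖sqrtMul hn hQ u‖ₑ ^ 2 ≤ ENNReal.ofReal ε * ‖u‖ₑ ^ 2 +
      ENNReal.ofReal (max M 0) * ‖fn u‖ₑ ^ 2 := by
    rw [norm_sq_sqrtMul]
    have h2 : ∀ᵐ x ∂(cellMeasure n), ‖Q x‖ₑ * ‖fn u x‖ₑ ^ 2 ≤
        ‖s.indicator Q' x‖ₑ * ‖fn u x‖ₑ ^ 2 + ENNReal.ofReal (max M 0) * ‖fn u x‖ₑ ^ 2 := by
      filter_upwards [hQ'] with x hx
      rw [hx]
      by_cases hxs : x ∈ s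
      · rw [Set.indicator_of_mem hxs]; exact le_self_add
      · refine le_trans (mul_le_mul_left ?_ _) le_add_self
        have h3 : ‖Q' x‖ < M := not_le.1 hxs
        rw [← ofReal_norm]
        exact ENNReal.ofReal_le_ofReal (h3.le.trans (le_max_left _ _))
    refine (lintegral_mono_ae h2).trans ?_
    have hm : AEMeasurable (fun x => ‖s.indicator Q' x‖ₑ * ‖fn u x‖ₑ ^ 2) (cellMeasure n) :=
      ((hQ'm.indicator hsm).measurable.enorm.aemeasurable).mul
        ((Lp.aestronglyMeasurable (fn u)).enorm.pow_const 2)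
    rw [lintegral_add_left' hm, lintegral_const_mul' _ _ ENNReal.ofReal_ne_top,
      ← enorm_sq_eq_lintegral]
    refine add_le_add ((hC _ (hQ'm.indicator hsm).aestronglyMeasurable u).trans ?_) le_rfl
    refine mul_le_mul_left ?_ _
    calc (C : ENNReal) * eLpNorm (s.indicator Q') ((n : ENNReal) / 2) (cellMeasure n)
        ≤ ENNReal.ofReal C * ENNReal.ofReal (ε / (C + 1)) := by
          rw [ENNReal.ofReal_coe_nnreal]; gcongr
      _ ≤ ENNReal.ofReal ε := by
          rw [← ENNReal.ofReal_mul (by positivity)]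
          refine ENNReal.ofReal_le_ofReal ?_
          rw [mul_div_assoc', div_le_iff₀ (by positivity)]
          nlinarith [C.coe_nonneg]
  have h2 := ENNReal.toReal_mono (by finiteness) h1
  rw [ENNReal.toReal_add (by finiteness) (by finiteness)] at h2
  rw [ENNReal.toReal_mul, ENNReal.toReal_mul, ENNReal.toReal_pow, ENNReal.toReal_pow,
    ENNReal.toReal_pow, toReal_enorm, toReal_enorm, toReal_enorm, ENNReal.toReal_ofReal hε.le,
    ENNReal.toReal_ofReal (le_max_right _ _)] at h2
  exact h2

end Potential

namespace PeriodicMetric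

variable (g : PeriodicMetric n)

lemma continuous_mat : Continuous g.mat :=
  continuous_matrix fun j k => (g.smooth j k).continuous

lemma det_pos (x : Space n) : 0 < (g.mat x).det := (g.posDef x).det_pos

lemma continuous_inv (j k : Fin n) : Continuous fun x => g.inv x j k := by
  have h : (fun x => g.inv x j k) = fun x => ((g.mat x).det)⁻¹ * (g.mat x).adjugate j k := by
    funext x
    rw [PeriodicMetric.inv, Matrix.inv_def, Ring.inverse_eq_inv', Matrix.smul_apply, smul_eq_mul]
  rw [h]
  exact (g.continuous_mat.matrix_det.inv₀ fun x => (g.det_pos x).ne').mul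
    (g.continuous_mat.matrix_adjugate.matrix_elem j k)

lemma continuous_density : Continuous g.density :=
  Real.continuous_sqrt.comp g.continuous_mat.matrix_det

lemma density_pos (x : Space n) : 0 < g.density x := Real.sqrt_pos.2 (g.det_pos x)

lemma isPeriodic_inv (j k : Fin n) : IsPeriodic fun x => g.inv x j k := fun m x => by
  simp only [PeriodicMetric.inv, g.periodic m x]

lemma isPeriodic_density : IsPeriodic g.density := fun m x => by
  simp only [PeriodicMetric.density, g.periodic m x]

/-- The coefficient `g^{jk}|g|^{1/2}`. -/
def coeff (j k : Fin n) (x : Space n) : ℂ := (g.inv x j k : ℂ) * (g.density x : ℂ)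

/-- The Riemannian density as a complex valued function. -/
def weight (x : Space n) : ℂ := (g.density x : ℂ)

lemma continuous_coeff (j k : Fin n) : Continuous (g.coeff j k) :=
  (Complex.continuous_ofReal.comp (g.continuous_inv j k)).mul
    (Complex.continuous_ofReal.comp g.continuous_density)

lemma continuous_weight : Continuous g.weight := Complex.continuous_ofReal.comp g.continuous_density

lemma isPeriodic_coeff (j k : Fin n) : IsPeriodic (g.coeff j k) := fun m x => by
  have h1 := g.isPeriodic_inv j k m x
  have h2 := g.isPeriodic_density m x
  simp only at h1
  simp only [coeff, h1, h2]

lemma isPeriodic_weight : IsPeriodic g.weight := fun m x => by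
  simp only [weight, g.isPeriodic_density m x]

/-- The principal symbol is uniformly elliptic on the cell. -/
lemma exists_ellipticity : ∃ c : ℝ, 0 < c ∧ ∀ x ∈ cell n, ∀ y : Space n,
    c * ‖y‖ ^ 2 ≤ ∑ j, ∑ k, g.inv x j k * g.density x * (y k * y j) := by
  set Φ : Space n × Space n → ℝ := fun p =>
    ∑ j, ∑ k, g.inv p.1 j k * g.density p.1 * (p.2 k * p.2 j) with hΦ
  have hΦc : Continuous Φ := by
    refine continuous_finsetSum _ fun j _ => continuous_finsetSum _ fun k _ => ?_
    refine (((g.continuous_inv j k).comp continuous_fst).mul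
      (g.continuous_density.comp continuous_fst)).mul ?_
    fun_prop
  have hΦpos : ∀ x y, y ≠ 0 → 0 < Φ (x, y) := fun x y hy => by
    have h1 := (g.posDef x).inv.dotProduct_mulVec_pos (x := y.ofLp) (by
      intro h; exact hy (by ext i; exact congrFun h i))
    have h2 : Φ (x, y) = g.density x * (star y.ofLp ⬝ᵥ ((g.mat x)⁻¹.mulVec y.ofLp)) := by
      simp only [hΦ, dotProduct, Matrix.mulVec, PeriodicMetric.inv, Finset.mul_sum, Pi.star_apply,
        star_trivial]
      refine Finset.sum_congr rfl fun j _ => Finset.sum_congr rfl fun k _ => ?_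
      ring
    rw [h2]
    exact mul_pos (g.density_pos x) h1
  have hhom : ∀ x y (t : ℝ), Φ (x, t • y) = t ^ 2 * Φ (x, y) := fun x y t => by
    simp only [hΦ, Finset.mul_sum, PiLp.smul_apply, smul_eq_mul]
    refine Finset.sum_congr rfl fun j _ => Finset.sum_congr rfl fun k _ => ?_
    ring
  set 𝒦 := Metric.closedBall (0 : Space n) (cellRadius n) ×ˢ Metric.sphere (0 : Space n) 1 with hK
  have hKc : IsCompact 𝒦 := (isCompact_closedBall _ _).prod (isCompact_sphere _ _)
  rcases 𝒦.eq_empty_or_nonempty with hem | hne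
  · refine ⟨1, one_pos, fun x hx y => ?_⟩
    rcases eq_or_ne y 0 with rfl | hy
    · simp
    · exfalso
      have : (x, (‖y‖⁻¹ : ℝ) • y) ∈ 𝒦 := ⟨by simpa using norm_le_of_mem_cell hx, by
        simp [norm_smul, norm_ne_zero_iff.2 hy]⟩
      rw [hem] at this
      exact this
  · obtain ⟨p, hp, hmin⟩ := hKc.exists_isMinOn hne hΦc.continuousOn
    have hp0 : p.2 ≠ 0 := by
      intro h
      have := hp.2
      rw [h] at this
      simp at this
    refine ⟨Φ p, hΦpos p.1 p.2 hp0, fun x hx y => ?_⟩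
    rcases eq_or_ne y 0 with rfl | hy
    · simp
    · have hyn := norm_ne_zero_iff.2 hy
      have hmem : (x, (‖y‖⁻¹ : ℝ) • y) ∈ 𝒦 := ⟨by simpa using norm_le_of_mem_cell hx, by
        simp [norm_smul, hyn]⟩
      have h1 : Φ p ≤ Φ (x, (‖y‖⁻¹ : ℝ) • y) := hmin hmem
      rw [hhom] at h1
      have h2 : Φ p * ‖y‖ ^ 2 ≤ (‖y‖⁻¹ ^ 2 * Φ (x, y)) * ‖y‖ ^ 2 :=
        mul_le_mul_of_nonneg_right h1 (by positivity)
      refine h2.trans (le_of_eq ?_)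
      show _ = Φ (x, y)
      field_simp

end PeriodicMetric

lemma memLp_top_cell {f : Space n → ℂ} (hf : Continuous f) : MemLp f ⊤ (cellMeasure n) :=
  memLp_cell_of_continuous hf ⊤

lemma norm_mulOp_le {b : Space n → ℂ} (hb : MemLp b ⊤ (cellMeasure n)) {K : ℝ}
    (hK : ∀ x ∈ cell n, ‖b x‖ ≤ K) (p : CellL2 n) : ‖mulOp b hb p‖ ≤ K * ‖p‖ := by
  refine Lp.norm_le_mul_norm_of_ae_le_mul ?_
  filter_upwards [coeFn_mulOp b hb p, ae_mem_cell] with x hx hc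
  rw [hx, norm_mul]
  exact mul_le_mul_of_nonneg_right (hK x hc) (norm_nonneg _)

lemma norm_sq_eq_integral (p : CellL2 n) : ‖p‖ ^ 2 = ∫ x, ‖p x‖ ^ 2 ∂(cellMeasure n) := by
  have h1 : ((‖p‖ : ℂ)) ^ 2 = ∫ x, ((‖p x‖ ^ 2 : ℝ) : ℂ) ∂(cellMeasure n) := by
    have h := inner_self_eq_norm_sq_to_K (𝕜 := ℂ) p
    rw [L2.inner_def] at h
    refine h.symm.trans (integral_congr_ae (Filter.Eventually.of_forall fun x => ?_))
    have h3 := inner_self_eq_norm_sq_to_K (𝕜 := ℂ) (p x)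
    simp only [h3]
    push_cast
    rfl
  rw [integral_complex_ofReal] at h1
  apply Complex.ofReal_injective
  rw [Complex.ofReal_pow]
  exact h1

lemma integrable_norm_sq (p : CellL2 n) : Integrable (fun x => ‖p x‖ ^ 2) (cellMeasure n) :=
  (memLp_two_iff_integrable_sq_norm (Lp.aestronglyMeasurable p)).1 (Lp.memLp p)

section Bloch

variable (g : PeriodicMetric n)

lemma IsPeriodicPotential.memLp_cell {q : Space n → ℂ} (hq : IsPeriodicPotential q) :
    MemLp q ((n : ENNReal) / 2) (cellMeasure n) := by
  refine (hq.memLp_loc _ (isCompact_closedBall (0 : Space n) (cellRadius n))).mono_measure ?_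
  refine Measure.restrict_mono ?_ le_rfl
  intro x hx
  simpa using norm_le_of_mem_cell hx

lemma memLp_mul_density {q : Space n → ℂ} (hq : IsPeriodicPotential q) :
    MemLp (fun x => q x * g.weight x) ((n : ENNReal) / 2) (cellMeasure n) := by
  have h1 := hq.memLp_cell
  obtain ⟨C, -, hC⟩ := continuous_bounded_cell g.continuous_weight
  refine h1.of_le_mul (c := C) (h1.1.mul g.continuous_weight.aestronglyMeasurable) ?_
  filter_upwards [ae_mem_cell] with x hx
  rw [norm_mul, mul_comm]
  exact mul_le_mul_of_nonneg_right (hC x hx) (norm_nonneg _)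

/-- The operator `∂ₖ + iθₖ` from `H¹(𝕋ⁿ)` to `L²(𝕋ⁿ)`. -/
def shiftedGr (θ : Fin n → ℂ) (k : Fin n) : TorusH1 n →L[ℂ] CellL2 n :=
  gr k + (Complex.I * θ k) • fn

/-- The adjoint of `∂ⱼ + iθⱼ` for real `θⱼ`, continued holomorphically to complex `θⱼ`. -/
def shiftedGrAdj (θ : Fin n → ℂ) (j : Fin n) : CellL2 n →L[ℂ] TorusH1 n :=
  (gr j).adjoint - (Complex.I * θ j) • (fn (n := n)).adjoint

variable (hn : 3 ≤ n) {q : Space n → ℂ} (hq : IsPeriodicPotential q) (z : ℂ)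

/-- The operator on `H¹(𝕋ⁿ)` of the form `h(θ) - z`, a polynomial in `θ`. -/
def blochOp (θ : Fin n → ℂ) : TorusH1 n →L[ℂ] TorusH1 n :=
  (∑ j, ∑ k, (shiftedGrAdj θ j).comp
    ((mulOp _ (memLp_top_cell (g.continuous_coeff j k))).comp (shiftedGr θ k))) +
  potentialOp hn (memLp_mul_density g hq) -
  z • (fn (n := n)).adjoint.comp ((mulOp _ (memLp_top_cell g.continuous_weight)).comp fn)

lemma inner_blochOp (θ : Fin n → ℂ) (u v : TorusH1 n) :
    inner ℂ v (blochOp g hn hq z θ u) =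
      (∑ j, ∑ k,
        ((∫ x, g.coeff j k x * gr k u x * conj (gr j v x) ∂(cellMeasure n)) +
        Complex.I * θ k * (∫ x, g.coeff j k x * fn u x * conj (gr j v x) ∂(cellMeasure n)) -
        Complex.I * θ j * (∫ x, g.coeff j k x * gr k u x * conj (fn v x) ∂(cellMeasure n)) +
        θ k * θ j * (∫ x, g.coeff j k x * fn u x * conj (fn v x) ∂(cellMeasure n)))) +
      (∫ x, q x * g.weight x * fn u x * conj (fn v x) ∂(cellMeasure n)) -
      z * ∫ x, g.weight x * fn u x * conj (fn v x) ∂(cellMeasure n) := by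
  rw [blochOp, _root_.sub_apply, _root_.add_apply, inner_sub_right, inner_add_right,
    inner_potentialOp, _root_.smul_apply, inner_smul_right, ContinuousLinearMap.comp_apply,
    ContinuousLinearMap.adjoint_inner_right, ContinuousLinearMap.comp_apply, inner_mulOp]
  congr 2
  rw [_root_.sum_apply, inner_sum]
  refine Finset.sum_congr rfl fun j _ => ?_
  rw [_root_.sum_apply, inner_sum]
  refine Finset.sum_congr rfl fun k _ => ?_
  rw [ContinuousLinearMap.comp_apply, ContinuousLinearMap.comp_apply, shiftedGrAdj, shiftedGr,
    _root_.sub_apply, inner_sub_right, _root_.smul_apply, inner_smul_right,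
    ContinuousLinearMap.adjoint_inner_right, ContinuousLinearMap.adjoint_inner_right,
    _root_.add_apply, _root_.smul_apply, map_add, map_smul, inner_add_right, inner_add_right,
    inner_smul_right, inner_smul_right]
  simp only [inner_mulOp]
  linear_combination (-θ k * θ j *
    (∫ x, g.coeff j k x * fn u x * conj (fn v x) ∂(cellMeasure n))) * Complex.I_sq

lemma differentiable_affine {E : Type*} [NormedAddCommGroup E] [NormedSpace ℂ E] {f : ℂ → ℂ}
    (hf : Differentiable ℂ f) (a b : E) :
    Differentiable ℂ (fun t => a + (Complex.I * f t) • b) ∧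
      Differentiable ℂ fun t => a - (Complex.I * f t) • b :=
  ⟨((hf.const_mul _).smul_const b).const_add a, ((hf.const_mul _).smul_const b).const_sub a⟩

lemma differentiable_blochOp_update (θ : Fin n → ℂ) (i : Fin n) :
    Differentiable ℂ fun t : ℂ => blochOp g hn hq z (Function.update θ i t) := by
  have hθ : ∀ k, Differentiable ℂ fun t : ℂ => Function.update θ i t k := fun k => by
    by_cases h : k = i
    · subst h; simp only [Function.update_self]; exact differentiable_id
    · simp only [Function.update_of_ne h]; exact differentiable_const _
  unfold blochOp
  refine Differentiable.sub_const (Differentiable.add_const _ ?_) _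
  refine Differentiable.fun_sum fun j _ => Differentiable.fun_sum fun k _ => ?_
  refine Differentiable.clm_comp ?_ (Differentiable.clm_comp (differentiable_const _) ?_)
  · exact (differentiable_affine (hθ j) (gr j).adjoint (fn (n := n)).adjoint).2
  · exact (differentiable_affine (hθ k) (gr k) fn).1

lemma continuous_blochOp : Continuous (blochOp g hn hq z) := by
  unfold blochOp
  refine Continuous.sub (Continuous.add ?_ continuous_const) continuous_const
  refine continuous_finsetSum _ fun j _ => continuous_finsetSum _ fun k _ => ?_
  refine Continuous.clm_comp ?_ (Continuous.clm_comp continuous_const ?_)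
  · unfold shiftedGrAdj; fun_prop
  · unfold shiftedGr; fun_prop

end Bloch

/-! ### Gårding's inequality and generic invertibility -/

/-- The principal part of the form is coercive on gradients. -/
lemma integral_coeff_ellipticity (g : PeriodicMetric n) {c : ℝ}
    (hc : ∀ x ∈ cell n, ∀ y : Space n,
      c * ‖y‖ ^ 2 ≤ ∑ j, ∑ k, g.inv x j k * g.density x * (y k * y j)) (u : TorusH1 n) :
    c * ∑ i, ‖gr i u‖ ^ 2 ≤ (∑ j, ∑ k,
      ∫ x, g.coeff j k x * gr k u x * conj (gr j u x) ∂(cellMeasure n)).re := by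
  have hint : ∀ j k, Integrable (fun x => g.coeff j k x * gr k u x * conj (gr j u x))
      (cellMeasure n) := fun j k =>
    integrable_mul_mul_conj (memLp_top_cell (g.continuous_coeff j k)) _ _
  have h1 : (∑ j, ∑ k, ∫ x, g.coeff j k x * gr k u x * conj (gr j u x) ∂(cellMeasure n)) =
      ∫ x, ∑ j, ∑ k, g.coeff j k x * gr k u x * conj (gr j u x) ∂(cellMeasure n) := by
    rw [integral_finsetSum _ fun j _ => integrable_finsetSum _ fun k _ => hint j k]
    exact Finset.sum_congr rfl fun j _ => (integral_finsetSum _ fun k _ => hint j k).symm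
  have hint2 : Integrable (fun x => ∑ j, ∑ k, g.coeff j k x * gr k u x * conj (gr j u x))
      (cellMeasure n) :=
    integrable_finsetSum _ fun j _ => integrable_finsetSum _ fun k _ => hint j k
  have h2 : c * ∑ i, ‖gr i u‖ ^ 2 = ∫ x, c * ∑ i, ‖gr i u x‖ ^ 2 ∂(cellMeasure n) := by
    rw [integral_const_mul, integral_finsetSum _ fun i _ => integrable_norm_sq _]
    simp only [norm_sq_eq_integral]
  rw [h1, h2]
  have h3 : (∫ x, ∑ j, ∑ k, g.coeff j k x * gr k u x * conj (gr j u x) ∂(cellMeasure n)).re =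
      ∫ x, (∑ j, ∑ k, g.coeff j k x * gr k u x * conj (gr j u x)).re ∂(cellMeasure n) :=
    (integral_re hint2).symm
  rw [h3]
  refine integral_mono_ae ((integrable_finsetSum _ fun i _ => integrable_norm_sq _).const_mul c)
    hint2.re ?_
  filter_upwards [ae_mem_cell] with x hx
  -- the real and the imaginary part of the gradient contribute separately
  have ha := hc x hx (WithLp.toLp 2 fun i => (gr i u x).re)
  have hb := hc x hx (WithLp.toLp 2 fun i => (gr i u x).im)
  rw [EuclideanSpace.norm_sq_eq] at ha hb
  have h4 : (∑ j, ∑ k, g.coeff j k x * gr k u x * conj (gr j u x)).re =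
      (∑ j, ∑ k, g.inv x j k * g.density x * ((gr k u x).re * (gr j u x).re)) +
      ∑ j, ∑ k, g.inv x j k * g.density x * ((gr k u x).im * (gr j u x).im) := by
    rw [Complex.re_sum, ← Finset.sum_add_distrib]
    refine Finset.sum_congr rfl fun j _ => ?_
    rw [Complex.re_sum, ← Finset.sum_add_distrib]
    refine Finset.sum_congr rfl fun k _ => ?_
    rw [PeriodicMetric.coeff, ← Complex.ofReal_mul, mul_assoc, Complex.re_ofReal_mul]
    simp only [Complex.mul_re, Complex.conj_re, Complex.conj_im]
    ring
  show c * ∑ i, ‖gr i u x‖ ^ 2 ≤ (∑ j, ∑ k, g.coeff j k x * gr k u x * conj (gr j u x)).re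
  rw [h4]
  refine le_trans (le_of_eq ?_) (add_le_add ha hb)
  rw [← mul_add, ← Finset.sum_add_distrib]
  congr 1
  refine Finset.sum_congr rfl fun i _ => ?_
  rw [← Complex.normSq_eq_norm_sq, Complex.normSq_apply]
  simp only [Real.norm_eq_abs, sq_abs]
  ring

/-- **Gårding's inequality**, uniformly for bounded complex quasimomenta. -/
lemma garding (g : PeriodicMetric n) (hn : 3 ≤ n) {q : Space n → ℂ} (hq : IsPeriodicPotential q)
    (z : ℂ) (r : ℝ) (hr : 0 ≤ r) : ∃ c C : ℝ, 0 < c ∧ 0 ≤ C ∧ ∀ θ : Fin n → ℂ, (∀ k, ‖θ k‖ ≤ r) →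
      ∀ u : TorusH1 n,
        c * ‖u‖ ^ 2 - C * ‖fn u‖ ^ 2 ≤ (inner ℂ u (blochOp g hn hq z θ u) : ℂ).re := by
  obtain ⟨c, hc0, hc⟩ := g.exists_ellipticity
  have hK' : ∀ j k, ∃ K : ℝ, 0 ≤ K ∧ ∀ x ∈ cell n, ‖g.coeff j k x‖ ≤ K := fun j k =>
    continuous_bounded_cell (g.continuous_coeff j k)
  choose K hK0 hK using hK'
  obtain ⟨W, hW0, hW⟩ := continuous_bounded_cell g.continuous_weight
  obtain ⟨P, hP0, hP⟩ := potential_infinitesimal hn (memLp_mul_density g hq)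
    (by positivity : (0 : ℝ) < c / 4)
  set A : ℝ := ∑ j, ∑ k, (2 * r + r ^ 2) * K j k with hA
  have hA0 : 0 ≤ A := Finset.sum_nonneg fun j _ => Finset.sum_nonneg fun k _ =>
    mul_nonneg (by positivity) (hK0 j k)
  -- `A` bounds the terms with a factor `θ`, `P` the potential and `W` the density
  refine ⟨c / 2, c + A ^ 2 / c + P + ‖z‖ * W, by positivity, by positivity, fun θ hθ u => ?_⟩
  have hbil : ∀ j k (p s : CellL2 n),
      ‖∫ x, g.coeff j k x * p x * conj (s x) ∂(cellMeasure n)‖ ≤ K j k * (‖p‖ * ‖s‖) := by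
    intro j k p s
    rw [← inner_mulOp _ (memLp_top_cell (g.continuous_coeff j k))]
    calc _ ≤ ‖s‖ * ‖mulOp _ (memLp_top_cell (g.continuous_coeff j k)) p‖ := norm_inner_le_norm _ _
      _ ≤ ‖s‖ * (K j k * ‖p‖) := mul_le_mul_of_nonneg_left
          (norm_mulOp_le _ (hK j k) p) (norm_nonneg _)
      _ = _ := by ring
  set main := ∑ j, ∑ k, ∫ x, g.coeff j k x * gr k u x * conj (gr j u x) ∂(cellMeasure n) with hmain
  set rem := ∑ j, ∑ k,
    (Complex.I * θ k * (∫ x, g.coeff j k x * fn u x * conj (gr j u x) ∂(cellMeasure n)) -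
        Complex.I * θ j * (∫ x, g.coeff j k x * gr k u x * conj (fn u x) ∂(cellMeasure n)) +
        θ k * θ j * (∫ x, g.coeff j k x * fn u x * conj (fn u x) ∂(cellMeasure n))) with hrem
  set pot := ∫ x, q x * g.weight x * fn u x * conj (fn u x) ∂(cellMeasure n) with hpot
  set wt := ∫ x, g.weight x * fn u x * conj (fn u x) ∂(cellMeasure n) with hwt
  have hin : inner ℂ u (blochOp g hn hq z θ u) = main + rem + pot - z * wt := by
    rw [inner_blochOp, hmain, hrem, ← Finset.sum_add_distrib]
    congr 2
    refine Finset.sum_congr rfl fun j _ => ?_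
    rw [← Finset.sum_add_distrib]
    exact Finset.sum_congr rfl fun k _ => by ring
  have hrem_le : ‖rem‖ ≤ A * (‖u‖ * ‖fn u‖) := by
    rw [hA, Finset.sum_mul]
    refine (norm_sum_le _ _).trans (Finset.sum_le_sum fun j _ => ?_)
    rw [Finset.sum_mul]
    refine (norm_sum_le _ _).trans (Finset.sum_le_sum fun k _ => ?_)
    have b1 : ‖Complex.I * θ k * (∫ x, g.coeff j k x * fn u x * conj (gr j u x) ∂(cellMeasure n))‖ ≤
        r * (K j k * (‖u‖ * ‖fn u‖)) := by
      rw [norm_mul, norm_mul, Complex.norm_I, one_mul]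
      refine mul_le_mul (hθ k) ((hbil j k _ _).trans ?_) (norm_nonneg _) hr
      rw [mul_comm ‖u‖]
      have := norm_gr_le j u
      have := hK0 j k
      gcongr
    have b2 : ‖Complex.I * θ j * (∫ x, g.coeff j k x * gr k u x * conj (fn u x) ∂(cellMeasure n))‖ ≤
        r * (K j k * (‖u‖ * ‖fn u‖)) := by
      rw [norm_mul, norm_mul, Complex.norm_I, one_mul]
      refine mul_le_mul (hθ j) ((hbil j k _ _).trans ?_) (norm_nonneg _) hr
      have := norm_gr_le k u
      have := hK0 j k
      gcongr
    have b3 : ‖θ k * θ j * (∫ x, g.coeff j k x * fn u x * conj (fn u x) ∂(cellMeasure n))‖ ≤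
        r ^ 2 * (K j k * (‖u‖ * ‖fn u‖)) := by
      rw [norm_mul, norm_mul, sq]
      refine mul_le_mul (mul_le_mul (hθ k) (hθ j) (norm_nonneg _) hr)
        ((hbil j k _ _).trans ?_) (norm_nonneg _) (by positivity)
      have := norm_fn_le u
      have := hK0 j k
      gcongr
    refine (norm_add_le _ _).trans ?_
    refine (add_le_add ((norm_sub_le _ _).trans (add_le_add b1 b2)) b3).trans (le_of_eq ?_)
    ring
  have hpot_le : ‖pot‖ ≤ c / 4 * ‖u‖ ^ 2 + P * ‖fn u‖ ^ 2 := by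
    have := hP u
    rwa [inner_potentialOp] at this
  have hwt_le : ‖z * wt‖ ≤ ‖z‖ * W * ‖fn u‖ ^ 2 := by
    rw [norm_mul, mul_assoc]
    refine mul_le_mul_of_nonneg_left ?_ (norm_nonneg _)
    rw [hwt, ← inner_mulOp _ (memLp_top_cell g.continuous_weight)]
    refine (norm_inner_le_norm _ _).trans ?_
    calc _ ≤ ‖fn u‖ * (W * ‖fn u‖) := mul_le_mul_of_nonneg_left
          (norm_mulOp_le _ hW _) (norm_nonneg _)
      _ = _ := by ring
  have hmain_ge := integral_coeff_ellipticity g hc u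
  rw [← hmain] at hmain_ge
  have hn2 := norm_sq_torusH1 u
  have hsum : ∑ i, ‖gr i u‖ ^ 2 = ‖u‖ ^ 2 - ‖fn u‖ ^ 2 := by linarith
  rw [hsum] at hmain_ge
  have r1 := (abs_le.1 ((Complex.abs_re_le_norm rem).trans hrem_le)).1
  have r2 := (abs_le.1 ((Complex.abs_re_le_norm pot).trans hpot_le)).1
  have r3 := (abs_le.1 ((Complex.abs_re_le_norm (z * wt)).trans hwt_le)).2
  rw [hin, Complex.sub_re, Complex.add_re, Complex.add_re]
  -- the terms with a factor `θ` cost a quarter of the principal part, like the potential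
  have key : A * (‖u‖ * ‖fn u‖) ≤ c / 4 * ‖u‖ ^ 2 + A ^ 2 / c * ‖fn u‖ ^ 2 := by
    have h0 : 0 ≤ (c / 2 * ‖u‖ - A * ‖fn u‖) ^ 2 / c := by positivity
    have h1 : (c / 2 * ‖u‖ - A * ‖fn u‖) ^ 2 / c =
        c / 4 * ‖u‖ ^ 2 + A ^ 2 / c * ‖fn u‖ ^ 2 - A * (‖u‖ * ‖fn u‖) := by
      field_simp; ring
    linarith
  nlinarith

/-- The low Fourier modes of a function control its `L²` norm up to a small multiple of its `H¹`
norm. -/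
lemma low_modes {δ : ℝ} (hδ : 0 < δ) : ∃ F : Finset (Fin n → ℤ), ∀ u : TorusH1 n,
    ‖fn u‖ ^ 2 ≤ ∑ k ∈ F, ‖(inner ℂ (expL2 k) (fn u) : ℂ)‖ ^ 2 + δ * ‖u‖ ^ 2 := by
  have hfin : {k : Fin n → ℤ | ‖latticeVec k‖ ≤ 2 * Real.pi * Real.sqrt δ⁻¹}.Finite :=
    finite_latticeVec_norm_le _
  refine ⟨hfin.toFinset, fun u => ?_⟩
  have parseval : ∀ p : CellL2 n,
      HasSum (fun k => ‖(inner ℂ (expL2 k) p : ℂ)‖ ^ 2) (‖p‖ ^ 2) := fun p => by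
    have h := (fourierL2 (n := n)).hasSum_inner_mul_inner p p
    simp only [coe_fourierL2] at h
    rw [inner_self_eq_norm_sq_to_K] at h
    have h1 : ∀ k : Fin n → ℤ, (inner ℂ p (expL2 k) : ℂ) * inner ℂ (expL2 k) p =
        ((‖(inner ℂ (expL2 k) p : ℂ)‖ ^ 2 : ℝ) : ℂ) := fun k => by
      rw [← inner_conj_symm, mul_comm, Complex.mul_conj, Complex.normSq_eq_norm_sq]
    simp only [h1] at h
    rw [← Complex.hasSum_ofReal]
    rw [Complex.ofReal_pow]
    exact h
  have h1 := parseval (fn u)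
  have h2 : HasSum (fun k : Fin n → ℤ => ∑ i, ‖(inner ℂ (expL2 k) (gr i u) : ℂ)‖ ^ 2)
      (∑ i, ‖gr i u‖ ^ 2) := hasSum_sum fun i _ => parseval (gr i u)
  have h3 : HasSum (fun k => if k ∈ hfin.toFinset then ‖(inner ℂ (expL2 k) (fn u) : ℂ)‖ ^ 2 else 0)
      (∑ k ∈ hfin.toFinset, ‖(inner ℂ (expL2 k) (fn u) : ℂ)‖ ^ 2) := by
    have he : ∑ k ∈ hfin.toFinset, ‖(inner ℂ (expL2 k) (fn u) : ℂ)‖ ^ 2 =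
        ∑ k ∈ hfin.toFinset, if k ∈ hfin.toFinset then
          ‖(inner ℂ (expL2 k) (fn u) : ℂ)‖ ^ 2 else 0 :=
      Finset.sum_congr rfl fun k hk => (if_pos hk).symm
    rw [he]
    exact hasSum_sum_of_ne_finset_zero fun k hk => if_neg hk
  -- outside the finite set, `δ |k|²` is at least one
  have h4 := hasSum_le (fun k => ?_) h1 (h3.add (h2.mul_left δ))
  · refine h4.trans (add_le_add le_rfl (mul_le_mul_of_nonneg_left ?_ hδ.le))
    have := norm_sq_torusH1 u
    have := sq_nonneg ‖fn u‖
    linarith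
  · have hnn : 0 ≤ δ * ∑ i, ‖(inner ℂ (expL2 k) (gr i u) : ℂ)‖ ^ 2 := by positivity
    by_cases hk : k ∈ hfin.toFinset
    · rw [if_pos hk]; linarith
    · rw [if_neg hk, zero_add]
      have hk' : Real.sqrt δ⁻¹ < ‖intVec k‖ := by
        have h5 : ¬ ‖latticeVec k‖ ≤ 2 * Real.pi * Real.sqrt δ⁻¹ := fun h => hk (by simpa using h)
        have h6 : latticeVec k = (2 * Real.pi) • intVec k := by ext i; simp
        rw [h6, norm_smul, Real.norm_of_nonneg Real.two_pi_pos.le, not_le] at h5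
        exact lt_of_mul_lt_mul_left h5 Real.two_pi_pos.le
      have hsq : δ⁻¹ ≤ ∑ i, (k i : ℝ) ^ 2 := by
        have h5 := pow_le_pow_left₀ (Real.sqrt_nonneg _) hk'.le 2
        rw [Real.sq_sqrt (by positivity), EuclideanSpace.norm_sq_eq] at h5
        simpa using h5
      have h7 : ∑ i, ‖(inner ℂ (expL2 k) (gr i u) : ℂ)‖ ^ 2 =
          (∑ i, (k i : ℝ) ^ 2) * ‖(inner ℂ (expL2 k) (fn u) : ℂ)‖ ^ 2 := by
        rw [Finset.sum_mul]
        refine Finset.sum_congr rfl fun i _ => ?_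
        rw [inner_expL2_gr, norm_mul, norm_mul, Complex.norm_I, one_mul, mul_pow,
          Complex.norm_intCast, sq_abs]
      rw [h7, ← mul_assoc]
      refine le_mul_of_one_le_left (by positivity) ?_
      calc (1 : ℝ) = δ * δ⁻¹ := by field_simp
        _ ≤ _ := mul_le_mul_of_nonneg_left hsq hδ.le

/-- Adding a multiple of the projection on finitely many Fourier modes makes the operators of all
bounded quasimomenta invertible. -/
lemma exists_finrank_isUnit (g : PeriodicMetric n) (hn : 3 ≤ n) {q : Space n → ℂ}
    (hq : IsPeriodicPotential q) (z : ℂ) (r : ℝ) (hr : 0 ≤ r) :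
    ∃ (F : Finset (Fin n → ℤ)) (J : TorusH1 n →L[ℂ] (F → ℂ)) (J' : (F → ℂ) →L[ℂ] TorusH1 n),
      ∀ θ : Fin n → ℂ, (∀ k, ‖θ k‖ ≤ r) → IsUnit (blochOp g hn hq z θ + J'.comp J) := by
  obtain ⟨c, C, hc, hC, hG⟩ := garding g hn hq z r hr
  obtain ⟨F, hF⟩ := low_modes (n := n) (δ := c / (2 * (C + 1))) (by positivity)
  let J : TorusH1 n →L[ℂ] (F → ℂ) :=
    ContinuousLinearMap.pi fun k => (innerSL ℂ (expL2 (k : Fin n → ℤ))).comp fn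
  let J' : (F → ℂ) →L[ℂ] TorusH1 n :=
    ∑ k : F, ((C : ℂ) • ContinuousLinearMap.proj k : (F → ℂ) →L[ℂ] ℂ).smulRight
      ((fn (n := n)).adjoint (expL2 (k : Fin n → ℤ)))
  refine ⟨F, J, J', fun θ hθ => ?_⟩
  have hJ : ∀ u, (inner ℂ u (J' (J u)) : ℂ) =
      ((C * ∑ k ∈ F, ‖(inner ℂ (expL2 k) (fn u) : ℂ)‖ ^ 2 : ℝ) : ℂ) := fun u => by
    have h1 : J' (J u) = ∑ k : F, ((C : ℂ) * inner ℂ (expL2 (k : Fin n → ℤ)) (fn u)) •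
        ((fn (n := n)).adjoint (expL2 (k : Fin n → ℤ))) := by
      simp only [J', _root_.sum_apply]
      rfl
    rw [h1, inner_sum]
    push_cast
    rw [Finset.mul_sum, ← Finset.sum_coe_sort F]
    refine Finset.sum_congr rfl fun k _ => ?_
    rw [inner_smul_right, ContinuousLinearMap.adjoint_inner_right, mul_assoc,
      ← inner_conj_symm (fn u), Complex.mul_conj, Complex.normSq_eq_norm_sq]
    push_cast
    rfl
  refine ContinuousLinearMap.isUnit_of_forall_le_norm_inner_map _ (c := ⟨c / 2, by positivity⟩)
    (by exact_mod_cast half_pos hc) fun u => ?_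
  have h1 := hG θ hθ u
  have h2 := hF u
  have h3 : ‖(inner ℂ ((blochOp g hn hq z θ + J'.comp J) u) u : ℂ)‖ =
      ‖(inner ℂ u ((blochOp g hn hq z θ + J'.comp J) u) : ℂ)‖ := norm_inner_symm _ _
  rw [h3]
  refine le_trans ?_ (Complex.re_le_norm _)
  rw [_root_.add_apply, inner_add_right, Complex.add_re, ContinuousLinearMap.comp_apply, hJ,
    Complex.ofReal_re]
  have h4 : C * ‖fn u‖ ^ 2 ≤ C * (∑ k ∈ F, ‖(inner ℂ (expL2 k) (fn u) : ℂ)‖ ^ 2 +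
      c / (2 * (C + 1)) * ‖u‖ ^ 2) := mul_le_mul_of_nonneg_left h2 hC
  have h5 : C * (c / (2 * (C + 1))) ≤ c / 2 := by
    rw [← mul_div_assoc, div_le_div_iff₀ (by positivity) (by norm_num)]
    nlinarith
  have h6 : C * (c / (2 * (C + 1))) * ‖u‖ ^ 2 ≤ c / 2 * ‖u‖ ^ 2 :=
    mul_le_mul_of_nonneg_right h5 (by positivity)
  show ‖u‖ ^ 2 * (c / 2) ≤ _
  nlinarith

/-- If the operator of one complex quasimomentum is injective, then the operators of almost all
real quasimomenta are invertible. -/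
lemma ae_isUnit_blochOp (g : PeriodicMetric n) (hn : 3 ≤ n) {q : Space n → ℂ}
    (hq : IsPeriodicPotential q) (z : ℂ) (θ₀ : Fin n → ℂ)
    (hinj : Function.Injective (blochOp g hn hq z θ₀)) :
    ∀ᵐ x : Fin n → ℝ, IsUnit (blochOp g hn hq z fun i => (x i : ℂ)) := by
  classical
  set G : Set (Fin n → ℂ) := {θ | IsUnit (blochOp g hn hq z θ)} with hG
  -- invertibility fails only countably often on a coordinate line with a point of injectivity;
  -- the line is exhausted by discs, as the finite rank perturbation depends on a bound for `θ`
  have hline : ∀ θ : Fin n → ℂ, Function.Injective (blochOp g hn hq z θ) → ∀ j,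
      {t : ℂ | Function.update θ j t ∉ G}.Countable := by
    intro θ hθ j
    have hsub : {t : ℂ | Function.update θ j t ∉ G} ⊆
        ⋃ N : ℕ, {t ∈ Metric.ball (0 : ℂ) (‖θ j‖ + 1 + N) | Function.update θ j t ∉ G} := by
      intro t ht
      obtain ⟨N, hN⟩ := exists_nat_ge ‖t‖
      rw [Set.mem_iUnion]
      refine ⟨N, ?_, ht⟩
      rw [mem_ball_zero_iff]
      linarith [norm_nonneg (θ j)]
    refine Set.Countable.mono hsub (Set.countable_iUnion fun N => ?_)
    set ρ : ℝ := ‖θ j‖ + 1 + N with hρ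
    have hρ0 : 0 ≤ ρ := by positivity
    obtain ⟨F, J, J', hF⟩ := exists_finrank_isUnit g hn hq z (ρ + ∑ k, ‖θ k‖)
      (add_nonneg hρ0 (Finset.sum_nonneg fun k _ => norm_nonneg _))
    refine countable_not_isUnit (fun t => blochOp g hn hq z (Function.update θ j t))
      (differentiable_blochOp_update g hn hq z θ j) J J' ρ (fun t ht => hF _ fun k => ?_) (θ j)
      ?_ ?_
    · rw [mem_ball_zero_iff] at ht
      have hk := Finset.single_le_sum (f := fun k => ‖θ k‖) (fun k _ => norm_nonneg _)
        (Finset.mem_univ k)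
      by_cases h : k = j
      · subst h
        rw [Function.update_self]
        have : 0 ≤ ∑ k, ‖θ k‖ := Finset.sum_nonneg fun k _ => norm_nonneg _
        linarith
      · rw [Function.update_of_ne h]
        exact hk.trans (by linarith)
    · rw [mem_ball_zero_iff]
      have : (0 : ℝ) ≤ N := Nat.cast_nonneg N
      linarith
    · rwa [Function.update_eq_self]
  refine ae_real_of_countable_on_lines n G ?_ ?_ ?_
  · exact Units.isOpen.preimage (continuous_blochOp g hn hq z)
  · intro θ hθ j
    exact hline θ (ContinuousLinearMap.isUnit_iff_bijective.1 hθ).1 j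
  · -- a good point on the first coordinate line through `θ₀`
    have hc := hline θ₀ hinj ⟨0, by omega⟩
    have hne : ({t : ℂ | Function.update θ₀ ⟨0, by omega⟩ t ∉ G}ᶜ).Nonempty := by
      by_contra hcon
      rw [Set.not_nonempty_iff_eq_empty, Set.compl_empty_iff] at hcon
      rw [hcon] at hc
      exact not_countable_complex hc
    obtain ⟨t, ht⟩ := hne
    exact ⟨_, not_not.1 ht⟩

lemma conj_I_inv_mul (w : ℂ) : conj (Complex.I⁻¹ * w) = Complex.I * conj w := by
  simp

lemma I_inv_eq : (Complex.I⁻¹ : ℂ) = -Complex.I := Complex.inv_I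

/-- The operator `blochOp` is the operator of the form `h(θ) - z` on `H¹(𝕋ⁿ)`. -/
lemma inner_blochOp_toH1 (g : PeriodicMetric n) (hn : 3 ≤ n) {q : Space n → ℂ}
    (hq : IsPeriodicPotential q) (z : ℂ) (θ : Fin n → ℂ) (u v : TorusSobolevSpace n) :
    inner ℂ v.toH1 (blochOp g hn hq z θ u.toH1) = torusForm g q θ u v -
      ∫ x, z * u.toFun x * conj (v.toFun x) * (g.density x : ℂ) ∂(cellMeasure n) := by
  set a := u.toH1 with ha
  set b := v.toH1 with hb
  have hae : ∀ᵐ x ∂(cellMeasure n), fn a x = u.toFun x ∧ fn b x = v.toFun x ∧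
      (∀ k, gr k a x = u.grad k x) ∧ ∀ k, gr k b x = v.grad k x := by
    have h1 : fn a =ᵐ[cellMeasure n] u.toFun := coeFn_fn_mkH1 _ _ _ _ _
    have h2 : fn b =ᵐ[cellMeasure n] v.toFun := coeFn_fn_mkH1 _ _ _ _ _
    have h3 : ∀ᵐ x ∂(cellMeasure n), ∀ k, gr k a x = u.grad k x :=
      ae_all_iff.2 fun k => coeFn_gr_mkH1 _ _ _ _ _ k
    have h4 : ∀ᵐ x ∂(cellMeasure n), ∀ k, gr k b x = v.grad k x :=
      ae_all_iff.2 fun k => coeFn_gr_mkH1 _ _ _ _ _ k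
    filter_upwards [h1, h2, h3, h4] with x e1 e2 e3 e4
    exact ⟨e1, e2, e3, e4⟩
  have hint : ∀ j k (p s : CellL2 n), Integrable (fun x => g.coeff j k x * p x * conj (s x))
      (cellMeasure n) := fun j k p s =>
    integrable_mul_mul_conj (memLp_top_cell (g.continuous_coeff j k)) p s
  have hmain : (∫ x, (∑ j, ∑ k, (g.inv x j k : ℂ) * (u.D k x * conj (v.D j x))) * (g.density x : ℂ)
      ∂(cellMeasure n)) =
      ∑ j, ∑ k, ∫ x, g.coeff j k x * gr k a x * conj (gr j b x) ∂(cellMeasure n) := by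
    have h1 : ∀ᵐ x ∂(cellMeasure n),
        (∑ j, ∑ k, (g.inv x j k : ℂ) * (u.D k x * conj (v.D j x))) * (g.density x : ℂ) =
        ∑ j, ∑ k, g.coeff j k x * gr k a x * conj (gr j b x) := by
      filter_upwards [hae] with x ⟨_, _, e3, e4⟩
      rw [Finset.sum_mul]
      refine Finset.sum_congr rfl fun j _ => ?_
      rw [Finset.sum_mul]
      refine Finset.sum_congr rfl fun k _ => ?_
      rw [e3, e4, TorusSobolevSpace.D, TorusSobolevSpace.D, conj_I_inv_mul,
        PeriodicMetric.coeff, I_inv_eq]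
      linear_combination (-(g.inv x j k : ℂ) * g.density x * u.grad k x * conj (v.grad j x)) *
        Complex.I_sq
    rw [integral_congr_ae h1,
      integral_finsetSum _ fun j _ => integrable_finsetSum _ fun k _ => hint j k _ _]
    exact Finset.sum_congr rfl fun j _ => integral_finsetSum _ fun k _ => hint j k _ _
  have hlow : (∫ x, (∑ j, ∑ k, (g.inv x j k : ℂ) *
      (θ k * u.toFun x * conj (v.D j x) + u.D k x * θ j * conj (v.toFun x)
        + θ k * θ j * u.toFun x * conj (v.toFun x))) * (g.density x : ℂ) ∂(cellMeasure n)) =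
      ∑ j, ∑ k,
        (Complex.I * θ k * (∫ x, g.coeff j k x * fn a x * conj (gr j b x) ∂(cellMeasure n)) -
        Complex.I * θ j * (∫ x, g.coeff j k x * gr k a x * conj (fn b x) ∂(cellMeasure n)) +
        θ k * θ j * (∫ x, g.coeff j k x * fn a x * conj (fn b x) ∂(cellMeasure n))) := by
    have hint2 : ∀ j k, Integrable (fun x =>
        Complex.I * θ k * (g.coeff j k x * fn a x * conj (gr j b x)) -
        Complex.I * θ j * (g.coeff j k x * gr k a x * conj (fn b x)) +
        θ k * θ j * (g.coeff j k x * fn a x * conj (fn b x))) (cellMeasure n) := fun j k =>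
      (((hint j k _ _).const_mul _).sub ((hint j k _ _).const_mul _)).add
        ((hint j k _ _).const_mul _)
    have h1 : ∀ᵐ x ∂(cellMeasure n),
        (∑ j, ∑ k, (g.inv x j k : ℂ) *
      (θ k * u.toFun x * conj (v.D j x) + u.D k x * θ j * conj (v.toFun x)
        + θ k * θ j * u.toFun x * conj (v.toFun x))) * (g.density x : ℂ) =
        ∑ j, ∑ k, (Complex.I * θ k * (g.coeff j k x * fn a x * conj (gr j b x)) -
        Complex.I * θ j * (g.coeff j k x * gr k a x * conj (fn b x)) +
        θ k * θ j * (g.coeff j k x * fn a x * conj (fn b x))) := by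
      filter_upwards [hae] with x ⟨e1, e2, e3, e4⟩
      rw [Finset.sum_mul]
      refine Finset.sum_congr rfl fun j _ => ?_
      rw [Finset.sum_mul]
      refine Finset.sum_congr rfl fun k _ => ?_
      rw [e1, e2, e3, e4, TorusSobolevSpace.D, TorusSobolevSpace.D, conj_I_inv_mul,
        PeriodicMetric.coeff, I_inv_eq]
      ring
    rw [integral_congr_ae h1,
      integral_finsetSum _ fun j _ => integrable_finsetSum _ fun k _ => hint2 j k]
    refine Finset.sum_congr rfl fun j _ => ?_
    rw [integral_finsetSum _ fun k _ => hint2 j k]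
    refine Finset.sum_congr rfl fun k _ => ?_
    have e1 : Integrable (fun x => Complex.I * θ k * (g.coeff j k x * fn a x * conj (gr j b x)) -
        Complex.I * θ j * (g.coeff j k x * gr k a x * conj (fn b x))) (cellMeasure n) :=
      ((hint j k _ _).const_mul _).sub ((hint j k _ _).const_mul _)
    rw [integral_add e1 ((hint j k _ _).const_mul _),
      integral_sub ((hint j k _ _).const_mul _) ((hint j k _ _).const_mul _)]
    simp only [integral_const_mul]
  have hpot : (∫ x, q x * u.toFun x * conj (v.toFun x) * (g.density x : ℂ) ∂(cellMeasure n)) =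
      ∫ x, q x * g.weight x * fn a x * conj (fn b x) ∂(cellMeasure n) := by
    refine integral_congr_ae ?_
    filter_upwards [hae] with x ⟨e1, e2, _, _⟩
    rw [e1, e2, PeriodicMetric.weight]; ring
  have hz : (∫ x, z * u.toFun x * conj (v.toFun x) * (g.density x : ℂ) ∂(cellMeasure n)) =
      z * ∫ x, g.weight x * fn a x * conj (fn b x) ∂(cellMeasure n) := by
    rw [← integral_const_mul]
    refine integral_congr_ae ?_
    filter_upwards [hae] with x ⟨e1, e2, _, _⟩
    rw [e1, e2, PeriodicMetric.weight]; ring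
  rw [torusForm, torusFormLower, hmain, hlow, hpot, hz, inner_blochOp, ← add_assoc,
    ← Finset.sum_add_distrib]
  congr 2
  refine Finset.sum_congr rfl fun j _ => ?_
  rw [← Finset.sum_add_distrib]
  exact Finset.sum_congr rfl fun k _ => by ring

lemma toH1_toSobolev (p : TorusH1 n) : (toSobolev p).toH1 = p := by
  have h1 : fn (toSobolev p).toH1 = fn p := by
    refine Lp.ext ?_
    exact (coeFn_fn_mkH1 _ _ _ _ _).trans (periodicExtension_ae _)
  have h2 : ∀ i, gr i (toSobolev p).toH1 = gr i p := fun i => by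
    refine Lp.ext ?_
    exact (coeFn_gr_mkH1 _ _ _ _ _ i).trans (periodicExtension_ae _)
  refine sub_eq_zero.1 (norm_eq_zero.1 (pow_eq_zero_iff two_ne_zero |>.1 ?_))
  rw [norm_sq_torusH1]
  simp [map_sub, h1, h2]

/-- An element of `H¹(𝕋ⁿ)` is determined by its values: the Fourier coefficients of its weak
gradient are determined by those of the function. -/
lemma eq_zero_of_fn_eq_zero {p : TorusH1 n} (h : fn p = 0) : p = 0 := by
  have h2 : ∀ i, gr i p = 0 := fun i => by
    have h3 : fourierL2.repr (gr i p) = 0 := by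
      ext k
      rw [HilbertBasis.repr_apply_apply, coe_fourierL2, inner_expL2_gr, h]
      simp
    simpa using h3
  refine norm_eq_zero.1 (pow_eq_zero_iff two_ne_zero |>.1 ?_)
  rw [norm_sq_torusH1]
  simp [h, h2]

/-- A kernel element of `blochOp` extends periodically to a kernel element of `H(θ) - z`. -/
lemma injective_blochOp (g : PeriodicMetric n) (hn : 3 ≤ n) {q : Space n → ℂ}
    (hq : IsPeriodicPotential q) (z : ℂ) (θ : Fin n → ℂ) (hker : TorusKernelTrivial g q θ z) :
    Function.Injective (blochOp g hn hq z θ) := by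
  rw [injective_iff_map_eq_zero]
  intro p hp
  have h := hker (toSobolev p) ⟨⟨fun k x => by
      show z * (toSobolev p).toFun _ = _
      rw [(toSobolev p).memL2.periodic k x], (toSobolev p).memL2.memLp.const_mul z⟩, fun v => by
    have h1 := inner_blochOp_toH1 g hn hq z θ (toSobolev p) v
    rw [toH1_toSobolev, hp, inner_zero_right] at h1
    exact (sub_eq_zero.1 h1.symm)⟩
  refine eq_zero_of_fn_eq_zero ?_
  rw [Lp.eq_zero_iff_ae_eq_zero]
  exact (periodicExtension_ae (fn p)).symm.trans h

/-! ### Periodization of compactly supported functions -/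

/-- The sum of all lattice translates of a function. It is used for functions that vanish outside
some ball, so that the sum is finite at every point. -/
def periodization (F : Space n → ℂ) (x : Space n) : ℂ := ∑' m : Fin n → ℤ, F (x + latticeVec m)

lemma periodization_eq_sum {F : Space n → ℂ} {r : ℝ} (hF : ∀ x, r < ‖x‖ → F x = 0) {x : Space n}
    (hx : x ∈ cell n) : periodization F x = ∑ m ∈ ballCells n r, F (x + latticeVec m) :=
  tsum_eq_sum fun _ hm => hF _ (not_le.1 fun h => hm (mem_ballCells hx h))

lemma memLp_periodization {F : Space n → ℂ} {r : ℝ} (hF : ∀ x, r < ‖x‖ → F x = 0) {p : ENNReal}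
    (h : MemLp F p volume) : MemLp (periodization F) p (cellMeasure n) := by
  have h1 : MemLp (fun x => ∑ m ∈ ballCells n r, F (x + latticeVec m)) p (cellMeasure n) :=
    memLp_finsetSum _ fun _ _ => memLp_cell_translate h _
  refine (memLp_congr_ae ?_).2 h1
  filter_upwards [ae_mem_cell] with x hx
  exact periodization_eq_sum hF hx

/-- Unfolding: pairing a periodization with a periodic function on the cell is the same as pairing
the original function with it on the whole space. -/
lemma integral_mul_periodization {b F : Space n → ℂ} {r : ℝ} (hF : ∀ x, r < ‖x‖ → F x = 0)
    (hb : ∀ k : Fin n → ℤ, (fun x => b (x + latticeVec k)) =ᵐ[volume] b)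
    (hint : Integrable fun x => b x * F x) :
    ∫ x, b x * periodization F x ∂(cellMeasure n) = ∫ x, b x * F x := by
  have h1 : ∀ m, (fun x => b (x + latticeVec m) * F (x + latticeVec m)) =ᵐ[cellMeasure n]
      fun x => b x * F (x + latticeVec m) := fun m => by
    filter_upwards [ae_restrict_of_ae (hb m)] with x hx
    rw [hx]
  have h2 : ∀ m, Integrable (fun x => b x * F (x + latticeVec m)) (cellMeasure n) := fun m =>
    ((hint.comp_add_right (latticeVec m)).restrict (s := cell n)).congr (h1 m)
  have h3 := (hasSum_integral_cell hint).tsum_eq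
  rw [tsum_eq_sum (s := ballCells n r)] at h3
  · rw [← h3]
    have h4 : ∀ᵐ x ∂(cellMeasure n), b x * periodization F x =
        ∑ m ∈ ballCells n r, b x * F (x + latticeVec m) := by
      filter_upwards [ae_mem_cell] with x hx
      rw [periodization_eq_sum hF hx, Finset.mul_sum]
    rw [integral_congr_ae h4, integral_finsetSum _ fun m _ => h2 m]
    exact Finset.sum_congr rfl fun m _ => (integral_congr_ae (h1 m)).symm
  · intro m hm
    refine integral_eq_zero_of_ae ?_
    filter_upwards [ae_mem_cell] with x hx
    rw [hF _ (not_le.1 fun h => hm (mem_ballCells hx h)), mul_zero]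
    rfl

lemma integrable_cell_of_continuous {f : Space n → ℂ} (hf : Continuous f) :
    Integrable f (cellMeasure n) :=
  memLp_one_iff_integrable.1 (memLp_cell_of_continuous hf 1)

lemma inner_torusH1 (p r : TorusH1 n) :
    inner ℂ p r = inner ℂ (fn p) (fn r) + ∑ i, inner ℂ (gr i p) (gr i r) := by
  have h : inner ℂ p r = inner ℂ ((torusH1 n).subtypeL p) ((torusH1 n).subtypeL r) := rfl
  rw [h, PiLp.inner_apply, Fintype.sum_option]
  rfl

lemma IsPeriodic.ae_eq {b : Space n → ℂ} (hb : IsPeriodic b) (k : Fin n → ℤ) :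
    (fun x => b (x + latticeVec k)) =ᵐ[volume] b :=
  Filter.Eventually.of_forall fun x => hb k x

lemma partialDeriv_mul {f h : Space n → ℂ} (hf : ContDiff ℝ ∞ f) (hh : ContDiff ℝ ∞ h) (i : Fin n)
    (x : Space n) : partialDeriv i (fun y => f y * h y) x =
      f x * partialDeriv i h x + partialDeriv i f x * h x := by
  have h1 := ((hf.differentiable (by simp) x).hasFDerivAt.mul
    (hh.differentiable (by simp) x).hasFDerivAt).fderiv
  rw [partialDeriv, show (fun y => f y * h y) = f * h from rfl, h1]
  simp [partialDeriv, mul_comm]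

lemma partialDeriv_eq_zero {c : Space n → ℂ} {r : ℝ} (hs : ∀ x, r < ‖x‖ → c x = 0) (i : Fin n)
    (x : Space n) (hx : r < ‖x‖) : partialDeriv i c x = 0 := by
  have h : c =ᶠ[nhds x] fun _ => 0 := by
    filter_upwards [(isOpen_lt continuous_const continuous_norm).mem_nhds hx] with y hy
    exact hs y hy
  rw [partialDeriv, h.fderiv_eq]
  simp

lemma hasCompactSupport_of_norm {c : Space n → ℂ} {r : ℝ} (hs : ∀ x, r < ‖x‖ → c x = 0) :
    HasCompactSupport c :=
  HasCompactSupport.intro (isCompact_closedBall 0 r) fun x hx => hs x (by simpa using hx)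

lemma integrable_mul_of_norm {f c : Space n → ℂ} {r : ℝ} (hf : LocallyIntegrable f volume)
    (hc : Continuous c) (hs : ∀ x, r < ‖x‖ → c x = 0) : Integrable fun x => c x * f x :=
  hf.integrable_smul_left_of_hasCompactSupport hc (hasCompactSupport_of_norm hs)

lemma memLp_two_mul_of_norm {f c : Space n → ℂ} {r : ℝ} (hf : MemLp f 2 volume)
    (hc : Continuous c) (hs : ∀ x, r < ‖x‖ → c x = 0) : MemLp (fun x => c x * f x) 2 volume := by
  obtain ⟨C, hC⟩ := (hasCompactSupport_of_norm hs).exists_bound_of_continuous hc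
  refine hf.of_le_mul (c := C) (hc.aestronglyMeasurable.mul hf.1)
    (Filter.Eventually.of_forall fun x => ?_)
  rw [norm_mul]
  exact mul_le_mul_of_nonneg_right (hC x) (norm_nonneg _)

section

variable (u : SobolevSpace n) {c : Space n → ℂ} {r : ℝ} (hc : ContDiff ℝ ∞ c)
  (hs : ∀ x, r < ‖x‖ → c x = 0)

lemma SobolevSpace.locallyIntegrable : LocallyIntegrable u.toFun volume :=
  u.memLp.locallyIntegrable (by norm_num)

lemma SobolevSpace.locallyIntegrable_grad (i : Fin n) : LocallyIntegrable (u.grad i) volume :=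
  (u.memLp_grad i).locallyIntegrable (by norm_num)

/-- The derivative of the product of a Sobolev function and a smooth function. -/
def SobolevSpace.mulGrad (c : Space n → ℂ) (i : Fin n) (x : Space n) : ℂ :=
  c x * u.grad i x + partialDeriv i c x * u.toFun x

include hs in
lemma SobolevSpace.mulGrad_eq_zero (i : Fin n) (x : Space n) (hx : r < ‖x‖) :
    u.mulGrad c i x = 0 := by
  rw [SobolevSpace.mulGrad, hs x hx, partialDeriv_eq_zero hs i x hx]; simp

include hc hs in
lemma SobolevSpace.memLp_mulGrad (i : Fin n) : MemLp (u.mulGrad c i) 2 volume :=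
  (memLp_two_mul_of_norm (u.memLp_grad i) hc.continuous hs).add
    (memLp_two_mul_of_norm u.memLp (continuous_partialDeriv hc i) (partialDeriv_eq_zero hs i))

/-- The periodization of the product of a function in `H¹(ℝⁿ)` and a compactly supported smooth
function, an element of `H¹(𝕋ⁿ)`. -/
def periodizationH1 : TorusH1 n :=
  mkH1 (periodization fun x => c x * u.toFun x) (fun i => periodization (u.mulGrad c i))
    (memLp_periodization (r := r) (fun x hx => by rw [hs x hx, zero_mul])
      (memLp_two_mul_of_norm u.memLp hc.continuous hs))
    (fun i => memLp_periodization (u.mulGrad_eq_zero hs i) (u.memLp_mulGrad hc hs i))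
    (fun i φ hφ hper => by
      have hd := isPeriodic_partialDeriv hper i
      have hcφ : ∀ x, r < ‖x‖ → c x * φ x = 0 := fun x hx => by rw [hs x hx, zero_mul]
      have i1 : Integrable fun x => (c x * partialDeriv i φ x) * u.toFun x :=
        integrable_mul_of_norm u.locallyIntegrable
          (hc.continuous.mul (continuous_partialDeriv hφ i)) (r := r)
          fun x hx => by rw [hs x hx, zero_mul]
      have i2 : Integrable fun x => (partialDeriv i c x * φ x) * u.toFun x :=
        integrable_mul_of_norm u.locallyIntegrable
          ((continuous_partialDeriv hc i).mul hφ.continuous) (r := r)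
          fun x hx => by rw [partialDeriv_eq_zero hs i x hx, zero_mul]
      have i3 : Integrable fun x => (c x * φ x) * u.grad i x :=
        integrable_mul_of_norm (u.locallyIntegrable_grad i)
          (hc.continuous.mul hφ.continuous) hcφ
      have e1 := integral_mul_periodization (b := partialDeriv i φ)
        (F := fun x => c x * u.toFun x) (r := r) (fun x hx => by rw [hs x hx, zero_mul]) hd.ae_eq
        (i1.congr (Filter.Eventually.of_forall fun x => by ring))
      have e2 := integral_mul_periodization (b := φ) (F := u.mulGrad c i)
        (u.mulGrad_eq_zero hs i) hper.ae_eq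
        ((i3.add i2).congr (Filter.Eventually.of_forall fun x => by
          simp only [Pi.add_apply, SobolevSpace.mulGrad]; ring))
      have hw := u.weak i (fun x => c x * φ x) (hc.mul hφ) (hasCompactSupport_of_norm hcφ)
      simp only [partialDeriv_mul hc hφ] at hw
      have e3 : ∫ x, u.toFun x * (c x * partialDeriv i φ x + partialDeriv i c x * φ x) =
          (∫ x, (c x * partialDeriv i φ x) * u.toFun x) +
            ∫ x, (partialDeriv i c x * φ x) * u.toFun x := by
        rw [← integral_add i1 i2]
        exact integral_congr_ae (Filter.Eventually.of_forall fun x => by ring)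
      have e4 : ∫ x, φ x * u.mulGrad c i x = (∫ x, (c x * φ x) * u.grad i x) +
            ∫ x, (partialDeriv i c x * φ x) * u.toFun x := by
        rw [← integral_add i3 i2]
        exact integral_congr_ae (Filter.Eventually.of_forall fun x => by
          simp only [SobolevSpace.mulGrad]; ring)
      simp only [mul_comm (periodization _ _)]
      rw [e1, e2, e4]
      rw [e3] at hw
      have e5 : ∫ x, partialDeriv i φ x * (c x * u.toFun x) =
          ∫ x, (c x * partialDeriv i φ x) * u.toFun x :=
        integral_congr_ae (Filter.Eventually.of_forall fun x => by ring)
      have e6 : ∫ x, u.grad i x * (c x * φ x) = ∫ x, (c x * φ x) * u.grad i x :=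
        integral_congr_ae (Filter.Eventually.of_forall fun x => by ring)
      rw [e5]
      rw [e6] at hw
      linear_combination hw)

lemma coeFn_fn_periodizationH1 : fn (periodizationH1 u hc hs) =ᵐ[cellMeasure n]
    periodization fun x => c x * u.toFun x := coeFn_fn_mkH1 _ _ _ _ _

lemma coeFn_gr_periodizationH1 (i : Fin n) : gr i (periodizationH1 u hc hs) =ᵐ[cellMeasure n]
    periodization (u.mulGrad c i) := coeFn_gr_mkH1 _ _ _ _ _ i

end

/-- The integral of a derivative over the torus vanishes: in the divergence theorem on the cell,
opposite faces cancel. -/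
lemma integral_cell_partialDeriv {ψ : Space n → ℂ} (hψ : ContDiff ℝ ∞ ψ) (hper : IsPeriodic ψ)
    (i : Fin n) : ∫ x, partialDeriv i ψ x ∂(cellMeasure n) = 0 := by
  cases n with
  | zero => exact i.elim0
  | succ d =>
    set L : (Fin (d + 1) → ℝ) ≃L[ℝ] Space (d + 1) :=
      (PiLp.continuousLinearEquiv 2 ℝ (fun _ : Fin (d + 1) => ℝ)).symm with hL
    set f : Fin (d + 1) → (Fin (d + 1) → ℝ) → ℂ := fun j y => if j = i then ψ (L y) else 0 with hf
    set f' : Fin (d + 1) → (Fin (d + 1) → ℝ) → (Fin (d + 1) → ℝ) →L[ℝ] ℂ := fun j y =>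
      if j = i then (fderiv ℝ ψ (L y)).comp (L : (Fin (d + 1) → ℝ) →L[ℝ] Space (d + 1)) else 0
      with hf'
    have hsum : ∀ y, ∑ j, f' j y (Pi.single j 1) = partialDeriv i ψ (L y) := fun y => by
      rw [Finset.sum_eq_single i (fun j _ hj => by simp [hf', hj]) (by simp)]
      simp only [hf', if_true, partialDeriv]
      rfl
    have hcont : Continuous fun y => partialDeriv i ψ (L y) :=
      (continuous_partialDeriv hψ i).comp L.continuous
    have h := integral_divergence_of_hasFDerivAt_off_countable' (fun _ => 0)
      (fun _ => 2 * Real.pi) (fun _ => Real.two_pi_pos.le) f f' ∅ Set.countable_empty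
      (fun j => by
        by_cases hj : j = i
        · simp only [hf, hj, if_true]
          exact (hψ.continuous.comp L.continuous).continuousOn
        · simp only [hf, hj, if_false]; exact continuousOn_const)
      (fun x _ j => by
        by_cases hj : j = i
        · simp only [hf, hf', hj, if_true]
          exact (hψ.differentiable (by simp) (L x)).hasFDerivAt.comp x L.hasFDerivAt
        · simp only [hf, hf', hj, if_false]; exact hasFDerivAt_const _ _)
      (by
        simp only [hsum]
        exact hcont.continuousOn.integrableOn_compact isCompact_Icc)
    simp only [hsum] at h
    have hface : ∀ (y : Fin d → ℝ), f i (i.insertNth (2 * Real.pi) y) = f i (i.insertNth 0 y) :=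
      fun y => by
        simp only [hf, if_true]
        rw [← hper (Pi.single i 1) (L (i.insertNth 0 y))]
        congr 1
        ext j
        rw [PiLp.add_apply, latticeVec_apply]
        show (i.insertNth (2 * Real.pi) y : Fin (d + 1) → ℝ) j =
          (i.insertNth 0 y : Fin (d + 1) → ℝ) j + _
        refine i.succAboveCases ?_ (fun l => ?_) j
        · simp
        · simp
    rw [Finset.sum_eq_single i (fun j _ hj => by simp [hf, hj]) (by simp)] at h
    simp only [hface, sub_self] at h
    rw [volume_pi, ← setIntegral_congr_set Measure.univ_pi_Ioo_ae_eq_Icc, ← volume_pi] at h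
    rw [← h, cellMeasure]
    have hmp := EuclideanSpace.volume_preserving_symm_measurableEquiv_toLp (Fin (d + 1))
    rw [← hmp.setIntegral_preimage_emb (MeasurableEquiv.measurableEmbedding _)]
    have hcell : cell (d + 1) = (MeasurableEquiv.toLp 2 (Fin (d + 1) → ℝ)).symm ⁻¹'
        Set.univ.pi fun _ => Set.Ioo 0 (2 * Real.pi) := by
      ext x; simp [cell]
    rw [hcell]
    rfl

/-- The plane wave with integer wave vector as an element of `H¹(𝕋ⁿ)`. -/
def waveH1 (m : Fin n → ℤ) : TorusH1 n :=
  mkH1 (planeWave (intVec m)) (fun i x => Complex.I * m i * planeWave (intVec m) x)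
    (memLp_cell_of_continuous (continuous_planeWave _) 2)
    (fun i => memLp_cell_of_continuous (continuous_const.mul (continuous_planeWave _)) 2)
    fun i φ hφ hper => by
      have h := integral_cell_partialDeriv ((contDiff_planeWave (intVec m)).mul hφ)
        (fun k x => by simp only [isPeriodic_planeWave m k x, hper k x]) i
      simp only [partialDeriv_mul (contDiff_planeWave (intVec m)) hφ, partialDeriv_planeWave,
        intVec_apply, Complex.ofReal_intCast] at h
      have i1 : Integrable (fun x => planeWave (intVec m) x * partialDeriv i φ x)
          (cellMeasure n) := integrable_cell_of_continuous
        ((continuous_planeWave _).mul (continuous_partialDeriv hφ i))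
      have i2 : Integrable (fun x => Complex.I * m i * planeWave (intVec m) x * φ x)
          (cellMeasure n) := integrable_cell_of_continuous
        ((continuous_const.mul (continuous_planeWave _)).mul hφ.continuous)
      rw [integral_add i1 i2] at h
      exact eq_neg_of_add_eq_zero_left h

lemma coeFn_fn_waveH1 (m : Fin n → ℤ) :
    fn (waveH1 m) =ᵐ[cellMeasure n] planeWave (intVec m) := coeFn_fn_mkH1 _ _ _ _ _

lemma coeFn_gr_waveH1 (m : Fin n → ℤ) (i : Fin n) : gr i (waveH1 m) =ᵐ[cellMeasure n]
    fun x => Complex.I * m i * planeWave (intVec m) x := coeFn_gr_mkH1 _ _ _ _ _ i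

lemma gr_waveH1 (m : Fin n → ℤ) (i : Fin n) :
    gr i (waveH1 m) = (Complex.I * m i : ℂ) • fn (waveH1 m) :=
  Lp.ext <| by
    filter_upwards [coeFn_fn_waveH1 m, coeFn_gr_waveH1 m i, Lp.coeFn_smul (Complex.I * m i : ℂ)
      (fn (waveH1 m))] with x h1 h2 h3
    rw [h3, h2, Pi.smul_apply, h1, smul_eq_mul]

/-- An element of the Sobolev space of the torus that is orthogonal to all plane waves vanishes,
since its inner product with a plane wave is a nonzero multiple of a Fourier coefficient. -/
lemma eq_zero_of_inner_waveH1 {y : TorusH1 n} (h : ∀ m, inner ℂ (waveH1 m) y = 0) : y = 0 := by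
  refine eq_zero_of_fn_eq_zero ?_
  have hc : (cellNorm n : ℂ) ≠ 0 := by exact_mod_cast cellNorm_pos.ne'
  have hfn : ∀ m, (cellNorm n : ℂ) • fn (waveH1 m) = expL2 m := fun m => Lp.ext <| by
    filter_upwards [coeFn_fn_waveH1 m, coeFn_expL2 m, Lp.coeFn_smul (cellNorm n : ℂ)
      (fn (waveH1 m))] with x h1 h2 h3
    rw [h3, h2, Pi.smul_apply, h1, smul_eq_mul]
  have h3 : fourierL2.repr (fn y) = 0 := by
    ext m
    rw [HilbertBasis.repr_apply_apply, coe_fourierL2]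
    have h4 : inner ℂ ((cellNorm n : ℂ) • waveH1 m) y =
        (1 + ∑ i, (m i : ℂ) ^ 2) * inner ℂ (expL2 m) (fn y) := by
      rw [inner_torusH1]
      simp only [map_smul, gr_waveH1, smul_comm (cellNorm n : ℂ), hfn, inner_smul_left,
        inner_expL2_gr]
      rw [add_mul, one_mul, Finset.sum_mul]
      congr 1
      refine Finset.sum_congr rfl fun i _ => ?_
      simp
      linear_combination (-(m i : ℂ) ^ 2 * inner ℂ (expL2 m) (fn y)) * Complex.I_sq
    rw [inner_smul_left, h, mul_zero] at h4
    refine (mul_eq_zero.1 h4.symm).resolve_left ?_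
    have h5 : (0 : ℝ) < 1 + ∑ i, (m i : ℝ) ^ 2 := by positivity
    have h6 : ((1 + ∑ i, (m i : ℝ) ^ 2 : ℝ) : ℂ) ≠ 0 := by exact_mod_cast h5.ne'
    simpa using h6
  simpa using h3

/-! ### Local integrability of the potential against Sobolev functions -/

lemma IsPeriodicPotential.aestronglyMeasurable {q : Space n → ℂ} (hq : IsPeriodicPotential q) :
    AEStronglyMeasurable q volume := by
  rw [← Measure.restrict_univ (μ := (volume : Measure (Space n))),
    ← Metric.iUnion_closedBall_nat (0 : Space n), aestronglyMeasurable_iUnion_iff]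
  exact fun k => (hq.memLp_loc _ (isCompact_closedBall _ _)).1

lemma two_pi_le_norm_latticeVec {m : Fin n → ℤ} (hm : m ≠ 0) : 2 * Real.pi ≤ ‖latticeVec m‖ := by
  obtain ⟨i, hi⟩ := Function.ne_iff.1 hm
  have h1 := PiLp.norm_apply_le (latticeVec m) i
  refine le_trans ?_ h1
  rw [latticeVec_apply, norm_mul, Real.norm_eq_abs, abs_of_pos Real.two_pi_pos]
  have h2 : (1 : ℝ) ≤ ‖(m i : ℝ)‖ := by
    rw [Real.norm_eq_abs]
    exact_mod_cast Int.one_le_abs hi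
  nlinarith [Real.two_pi_pos]

/-- If a function is supported in a ball of diameter less than `2π`, its lattice translates have
disjoint supports. -/
lemma norm_le_norm_periodization {F : Space n → ℂ} {a : Space n} (hF : ∀ x, F x ≠ 0 → dist x a < 2)
    (x : Space n) (m : Fin n → ℤ) : ‖F (x + latticeVec m)‖ ≤ ‖periodization F x‖ := by
  by_cases h : F (x + latticeVec m) = 0
  · simp [h]
  · rw [periodization, tsum_eq_single m]
    intro k hk
    by_contra hne
    have h1 := hF _ h
    have h2 := hF _ hne
    -- two translates in the support would be at distance at least `2π > 4`
    have h3 := two_pi_le_norm_latticeVec (sub_ne_zero.2 hk)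
    have h4 : ‖latticeVec (k - m)‖ = dist (x + latticeVec k) (x + latticeVec m) := by
      rw [dist_add_left, dist_eq_norm, sub_eq_add_neg, latticeVec_add, latticeVec_neg,
        sub_eq_add_neg]
    have h5 := dist_triangle_right (x + latticeVec k) (x + latticeVec m) a
    linarith [Real.pi_gt_three]

/-- The product of the potential and a function in `H¹(ℝⁿ)` is locally integrable: the function is
cut off to a small ball and periodized, which reduces the claim to the torus. -/
lemma IsPeriodicPotential.locallyIntegrable_mul (hn : 3 ≤ n) {q : Space n → ℂ}
    (hq : IsPeriodicPotential q) (u : SobolevSpace n) :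
    LocallyIntegrable (fun x => q x * u.toFun x) volume := by
  intro a
  set κ : ContDiffBump a := ⟨1, 2, one_pos, one_lt_two⟩ with hκ
  set c : Space n → ℂ := fun x => (κ x : ℂ) with hc_def
  have hc : ContDiff ℝ ∞ c := Complex.ofRealCLM.contDiff.comp κ.contDiff
  have hball : ∀ x, c x ≠ 0 → dist x a < 2 := fun x hx => by
    have h1 : x ∈ Function.support κ := fun h => hx (by simp [hc_def, h])
    rw [κ.support_eq] at h1
    exact h1
  have hs : ∀ x, ‖a‖ + 2 < ‖x‖ → c x = 0 := fun x hx => by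
    by_contra h
    have h1 := hball x h
    have h2 := norm_le_norm_add_norm_sub' x a
    rw [dist_eq_norm] at h1
    linarith
  set F : Space n → ℂ := fun x => c x * u.toFun x with hF
  have hsF : ∀ x, ‖a‖ + 2 < ‖x‖ → F x = 0 := fun x hx => by rw [hF]; simp [hs x hx]
  have hFball : ∀ x, F x ≠ 0 → dist x a < 2 := fun x hx => hball x fun h => hx (by simp [hF, h])
  have hcell : Integrable (fun x => q x * periodization F x) (cellMeasure n) := by
    refine (integrable_potential hn hq.memLp_cell (periodizationH1 u hc hs) (waveH1 0)).congr ?_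
    filter_upwards [coeFn_fn_periodizationH1 u hc hs, coeFn_fn_waveH1 (n := n) 0] with x h1 h2
    rw [h1, h2]
    simp [planeWave, hF]
  have hint : Integrable fun x => q x * F x := by
    refine ⟨hq.aestronglyMeasurable.mul (hc.continuous.aestronglyMeasurable.mul u.memLp.1), ?_⟩
    rw [hasFiniteIntegral_iff_enorm, lintegral_eq_tsum_cell,
      tsum_eq_sum (s := ballCells n (‖a‖ + 2))]
    · refine ENNReal.sum_lt_top.2 fun m _ => lt_of_le_of_lt ?_
        (hasFiniteIntegral_iff_enorm.1 hcell.2)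
      refine lintegral_mono_ae ?_
      filter_upwards [ae_restrict_of_ae (hq.periodic m)] with x hx
      simp only [enorm_mul (q _), hx]
      exact mul_le_mul' le_rfl (enorm_le_iff_norm_le.2 (norm_le_norm_periodization hFball x m))
    · intro m hm
      rw [lintegral_eq_zero_iff' ?_]
      · filter_upwards [ae_mem_cell] with x hx
        rw [hsF _ (not_le.1 fun h => hm (mem_ballCells hx h))]
        simp
      · exact (((hq.aestronglyMeasurable.mul
          (hc.continuous.aestronglyMeasurable.mul u.memLp.1)).comp_measurePreserving
          (measurePreserving_add_right volume (latticeVec m))).restrict).enorm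
  refine ⟨Metric.ball a 1, Metric.ball_mem_nhds a one_pos, ?_⟩
  refine (hint.integrableOn (s := Metric.ball a 1)).congr_fun (fun x hx => ?_) measurableSet_ball
  have : κ x = 1 := κ.one_of_mem_closedBall (Metric.ball_subset_closedBall hx)
  simp [hF, hc_def, this]

/-! ### The Bloch transform of a cut-off eigenfunction -/

/-- The product of a cut-off function and the plane wave `exp(-iθ·x)`. -/
def cut (ζ : Space n → ℝ) (θ x : Space n) : ℂ := (ζ x : ℂ) * planeWave (-θ) x

/-- The product of the `k`-th derivative of a cut-off function and the plane wave `exp(-iθ·x)`. -/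
def dcut (ζ : Space n → ℝ) (k : Fin n) (θ x : Space n) : ℂ :=
  cut (fun y => fderiv ℝ ζ y (EuclideanSpace.single k 1)) θ x

section

variable {ζ : Space n → ℝ} (hζ : ContDiff ℝ ∞ ζ) {r : ℝ} (hs : ∀ x, r < ‖x‖ → ζ x = 0)

lemma continuous_cut {ζ : Space n → ℝ} (hζ : Continuous ζ) (θ : Space n) : Continuous (cut ζ θ) :=
  (Complex.continuous_ofReal.comp hζ).mul (continuous_planeWave _)

include hζ in
lemma contDiff_cut (θ : Space n) : ContDiff ℝ ∞ (cut ζ θ) :=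
  (Complex.ofRealCLM.contDiff.comp hζ).mul (contDiff_planeWave _)

include hζ in
lemma continuous_dcut (k : Fin n) (θ : Space n) : Continuous (dcut ζ k θ) :=
  continuous_cut ((hζ.continuous_fderiv (by simp)).clm_apply continuous_const) θ

include hs in
lemma cut_eq_zero (θ x : Space n) (hx : r < ‖x‖) : cut ζ θ x = 0 := by
  rw [cut, hs x hx]; simp

include hs in
lemma fderiv_eq_zero_of_norm (x : Space n) (hx : r < ‖x‖) : fderiv ℝ ζ x = 0 := by
  have h : ζ =ᶠ[nhds x] fun _ => 0 := by
    filter_upwards [(isOpen_lt continuous_const continuous_norm).mem_nhds hx] with y hy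
    exact hs y hy
  rw [h.fderiv_eq]
  simp

include hs in
lemma dcut_eq_zero (k : Fin n) (θ x : Space n) (hx : r < ‖x‖) : dcut ζ k θ x = 0 := by
  rw [dcut, cut, fderiv_eq_zero_of_norm hs x hx]; simp

include hζ in
lemma partialDeriv_cut (k : Fin n) (θ x : Space n) :
    partialDeriv k (cut ζ θ) x = dcut ζ k θ x - Complex.I * θ k * cut ζ θ x := by
  have h1 : partialDeriv k (fun y => (ζ y : ℂ)) x =
      ((fderiv ℝ ζ x (EuclideanSpace.single k 1) : ℝ) : ℂ) := by
    have h := Complex.ofRealCLM.hasFDerivAt.comp x (hζ.differentiable (by simp) x).hasFDerivAt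
    have h2 : HasFDerivAt (fun y => (ζ y : ℂ)) (Complex.ofRealCLM.comp (fderiv ℝ ζ x)) x := h
    rw [partialDeriv, h2.fderiv]
    rfl
  have h2 := partialDeriv_mul (f := fun y => (ζ y : ℂ)) (h := planeWave (-θ))
    (Complex.ofRealCLM.contDiff.comp hζ) (contDiff_planeWave _) k x
  rw [show cut ζ θ = fun y => (ζ y : ℂ) * planeWave (-θ) y from rfl, h2, h1, partialDeriv_planeWave,
    dcut, cut]
  simp
  ring

lemma conj_cut_neg (ζ : Space n → ℝ) (η x : Space n) : conj (cut ζ (-η) x) = cut ζ η x := by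
  rw [cut, cut, map_mul, ← planeWave_neg, Complex.conj_ofReal, neg_neg]

lemma cut_add (ζ : Space n → ℝ) (θ η x : Space n) :
    cut ζ (θ + η) x = conj (planeWave η x) * cut ζ θ x := by
  rw [cut, cut, neg_add, planeWave_add_left, planeWave_neg η]
  ring

/-- A compactly supported smooth function as an element of `H¹(ℝⁿ)`. -/
def smoothSobolev {c : Space n → ℂ} (hc : ContDiff ℝ ∞ c) (hs : ∀ x, r < ‖x‖ → c x = 0) :
    SobolevSpace n where
  toFun := c
  grad i := partialDeriv i c
  memLp := hc.continuous.memLp_of_hasCompactSupport (hasCompactSupport_of_norm hs)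
  memLp_grad i := (continuous_partialDeriv hc i).memLp_of_hasCompactSupport
    (hasCompactSupport_of_norm (partialDeriv_eq_zero hs i))
  weak i φ hφ hφs := by
    have h1 : ∀ {f h : Space n → ℂ}, Continuous f → Continuous h → (∀ x, r < ‖x‖ → f x = 0) →
        Integrable fun x => f x * h x := fun {f h} hf hh hfs =>
      (hf.mul hh).integrable_of_hasCompactSupport
        (hasCompactSupport_of_norm fun x hx => by
          show f x * h x = 0
          rw [hfs x hx, zero_mul])
    exact integral_mul_fderiv_eq_neg_fderiv_mul_of_integrable
      (h1 (continuous_partialDeriv hc i) hφ.continuous (partialDeriv_eq_zero hs i))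
      (h1 hc.continuous (continuous_partialDeriv hφ i) hs)
      (h1 hc.continuous hφ.continuous hs)
      (fun x _ => hc.differentiable (by simp) x) (fun x _ => hφ.differentiable (by simp) x)

/-- The periodization of `c f`, for `f` in `L²(ℝⁿ)` and `c` continuous and compactly supported, as
an element of `L²(𝕋ⁿ)`. -/
def periodizationL2 {c : Space n → ℂ} (hc : Continuous c) (hs : ∀ x, r < ‖x‖ → c x = 0)
    {f : Space n → ℂ} (hf : MemLp f 2 volume) : CellL2 n :=
  (memLp_periodization (r := r) (F := fun x => c x * f x) (fun x hx => by rw [hs x hx, zero_mul])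
    (memLp_two_mul_of_norm hf hc hs)).toLp

lemma coeFn_periodizationL2 {c : Space n → ℂ} (hc : Continuous c) (hs : ∀ x, r < ‖x‖ → c x = 0)
    {f : Space n → ℂ} (hf : MemLp f 2 volume) : periodizationL2 hc hs hf =ᵐ[cellMeasure n]
      periodization fun x => c x * f x := MemLp.coeFn_toLp _

/-- Fourier coefficients of periodizations unfold to integrals over `ℝⁿ`. -/
lemma inner_wave_mulOp_periodizationL2 {b : Space n → ℂ} (hb : Continuous b) (hper : IsPeriodic b)
    {c : Space n → ℂ} (hc : Continuous c) (hs : ∀ x, r < ‖x‖ → c x = 0)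
    {f : Space n → ℂ} (hf : MemLp f 2 volume) (m : Fin n → ℤ) :
    inner ℂ (fn (waveH1 m)) (mulOp b (memLp_top_cell hb) (periodizationL2 hc hs hf)) =
      ∫ x, b x * conj (planeWave (intVec m) x) * (c x * f x) := by
  have hcw : Continuous fun x => b x * conj (planeWave (intVec m) x) * c x :=
    (hb.mul (Complex.continuous_conj.comp (continuous_planeWave _))).mul hc
  rw [inner_mulOp, ← integral_mul_periodization (r := r) (F := fun x => c x * f x)
    (b := fun x => b x * conj (planeWave (intVec m) x))]
  · refine integral_congr_ae ?_
    filter_upwards [coeFn_periodizationL2 hc hs hf, coeFn_fn_waveH1 m] with x h1 h2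
    rw [h1, h2]; ring
  · exact fun x hx => by rw [hs x hx, zero_mul]
  · have hper' : IsPeriodic fun x => b x * conj (planeWave (intVec m) x) := fun k x => by
      show b _ * conj (planeWave _ _) = _
      rw [hper k x, isPeriodic_planeWave m k x]
    exact hper'.ae_eq
  · refine (integrable_mul_of_norm (r := r) (hf.locallyIntegrable (by norm_num)) hcw
      fun x hx => ?_).congr (Filter.Eventually.of_forall fun x => by ring)
    rw [hs x hx, mul_zero]

lemma inner_wave_shiftedGrAdj (θ : Space n) (m : Fin n → ℤ) (j : Fin n) (p : CellL2 n) :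
    inner ℂ (waveH1 m) (shiftedGrAdj (fun i => (θ i : ℂ)) j p) =
      -(Complex.I * ((θ + intVec m) j : ℝ)) * inner ℂ (fn (waveH1 m)) p := by
  rw [shiftedGrAdj, _root_.sub_apply, inner_sub_right, _root_.smul_apply, inner_smul_right,
    ContinuousLinearMap.adjoint_inner_right, ContinuousLinearMap.adjoint_inner_right, gr_waveH1,
    inner_smul_left]
  simp
  ring

end

section

variable (g : PeriodicMetric n) (hn : 3 ≤ n) {q : Space n → ℂ} (hq : IsPeriodicPotential q) (z : ℂ)
  (u : SobolevSpace n) {ζ : Space n → ℝ} (hζ : ContDiff ℝ ∞ ζ) {r : ℝ}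
  (hs : ∀ x, r < ‖x‖ → ζ x = 0) (θ : Space n)

/-- The periodization of `exp(-iθ·x) ζ u` for a cut-off function `ζ`. -/
def blochTransform : TorusH1 n := periodizationH1 u (contDiff_cut hζ θ) (cut_eq_zero hs θ)

/-- The element of `H¹(𝕋ⁿ)` that represents the commutator of the operator and the cut-off
function `ζ`, applied to `u` and periodized. It contains derivatives of `ζ` only. -/
def commutator : TorusH1 n :=
  ∑ j, ∑ k, (shiftedGrAdj (fun i => (θ i : ℂ)) j (mulOp _ (memLp_top_cell (g.continuous_coeff j k))
      (periodizationL2 (continuous_dcut hζ k θ) (dcut_eq_zero hs k θ) u.memLp)) -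
    (fn (n := n)).adjoint (mulOp _ (memLp_top_cell (g.continuous_coeff j k))
      (periodizationL2 (continuous_dcut hζ j θ) (dcut_eq_zero hs j θ) (u.memLp_grad k))))

lemma fn_blochTransform : fn (blochTransform u hζ hs θ) =
    periodizationL2 (contDiff_cut hζ θ).continuous (cut_eq_zero hs θ) u.memLp := rfl

/-- The gradient shifted by `iθ` commutes with the Bloch transform, up to a derivative of the
cut-off function. -/
lemma shiftedGr_blochTransform (k : Fin n) :
    shiftedGr (fun i => (θ i : ℂ)) k (blochTransform u hζ hs θ) =
      periodizationL2 (contDiff_cut hζ θ).continuous (cut_eq_zero hs θ) (u.memLp_grad k) +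
      periodizationL2 (continuous_dcut hζ k θ) (dcut_eq_zero hs k θ) u.memLp := by
  rw [shiftedGr, _root_.add_apply, _root_.smul_apply]
  refine Lp.ext ?_
  filter_upwards [Lp.coeFn_add (gr k (blochTransform u hζ hs θ))
      ((Complex.I * (θ k : ℂ)) • fn (blochTransform u hζ hs θ)),
    Lp.coeFn_smul (Complex.I * (θ k : ℂ)) (fn (blochTransform u hζ hs θ)),
    coeFn_fn_periodizationH1 u (contDiff_cut hζ θ) (cut_eq_zero hs θ),
    coeFn_gr_periodizationH1 u (contDiff_cut hζ θ) (cut_eq_zero hs θ) k,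
    coeFn_periodizationL2 (contDiff_cut hζ θ).continuous (cut_eq_zero hs θ) (u.memLp_grad k),
    coeFn_periodizationL2 (continuous_dcut hζ k θ) (dcut_eq_zero hs k θ) u.memLp,
    Lp.coeFn_add
      (periodizationL2 (contDiff_cut hζ θ).continuous (cut_eq_zero hs θ) (u.memLp_grad k))
      (periodizationL2 (continuous_dcut hζ k θ) (dcut_eq_zero hs k θ) u.memLp),
    ae_mem_cell] with x h1 h2 h3 h4 h5 h6 h7 hx
  rw [h1, h7, Pi.add_apply, Pi.add_apply, h2, Pi.smul_apply, h5, h6]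
  rw [show fn (blochTransform u hζ hs θ) = fn (periodizationH1 u (contDiff_cut hζ θ)
    (cut_eq_zero hs θ)) from rfl, h3, show gr k (blochTransform u hζ hs θ) = gr k (periodizationH1 u
    (contDiff_cut hζ θ) (cut_eq_zero hs θ)) from rfl, h4, smul_eq_mul]
  rw [periodization_eq_sum (u.mulGrad_eq_zero (cut_eq_zero hs θ) k) hx,
    periodization_eq_sum (r := r) (fun y hy => by rw [cut_eq_zero hs θ y hy, zero_mul]) hx,
    periodization_eq_sum (r := r) (fun y hy => by rw [cut_eq_zero hs θ y hy, zero_mul]) hx,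
    periodization_eq_sum (r := r) (fun y hy => by rw [dcut_eq_zero hs k θ y hy, zero_mul]) hx,
    Finset.mul_sum, ← Finset.sum_add_distrib, ← Finset.sum_add_distrib]
  refine Finset.sum_congr rfl fun m _ => ?_
  rw [SobolevSpace.mulGrad, partialDeriv_cut hζ]
  ring

/-- The form on `H¹(ℝⁿ)`, tested against a plane wave times a cut-off function, in terms of
periodizations. -/
lemma form_cut (hn : 3 ≤ n) (hq : IsPeriodicPotential q) (m : Fin n → ℤ) :
    form g q u (smoothSobolev (contDiff_cut hζ (-(θ + intVec m)))
      (cut_eq_zero hs (-(θ + intVec m)))) =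
    (∑ j, ∑ k,
      (inner ℂ (waveH1 m) (shiftedGrAdj (fun i => (θ i : ℂ)) j
        (mulOp _ (memLp_top_cell (g.continuous_coeff j k))
        (periodizationL2 (contDiff_cut hζ θ).continuous (cut_eq_zero hs θ) (u.memLp_grad k)))) +
      inner ℂ (waveH1 m) ((fn (n := n)).adjoint (mulOp _ (memLp_top_cell (g.continuous_coeff j k))
      (periodizationL2 (continuous_dcut hζ j θ) (dcut_eq_zero hs j θ) (u.memLp_grad k)))))) +
    inner ℂ (waveH1 m) (potentialOp hn (memLp_mul_density g hq) (blochTransform u hζ hs θ)) := by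
  set η := θ + intVec m with hη
  have i1 : ∀ j k (c : Space n → ℂ), Continuous c → (∀ x, r < ‖x‖ → c x = 0) →
      Integrable fun x => g.coeff j k x * conj (planeWave (intVec m) x) * (c x * u.grad k x) :=
    fun j k c hc hcs =>
      (integrable_mul_of_norm (r := r) (u.locallyIntegrable_grad k)
        (c := fun x => g.coeff j k x * conj (planeWave (intVec m) x) * c x)
        (((g.continuous_coeff j k).mul (Complex.continuous_conj.comp (continuous_planeWave _))).mul
          hc) fun x hx => by rw [hcs x hx, mul_zero]).congr
        (Filter.Eventually.of_forall fun x => by ring)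
  rw [form]
  congr 1
  · have h1 : ∀ x, (∑ j, ∑ k, (g.inv x j k : ℂ) * (u.D k x *
        conj ((smoothSobolev (contDiff_cut hζ (-η)) (cut_eq_zero hs (-η))).D j x))) *
          (g.density x : ℂ) = ∑ j, ∑ k,
        (-(Complex.I * (η j : ℝ)) *
          (g.coeff j k x * conj (planeWave (intVec m) x) * (cut ζ θ x * u.grad k x)) +
          g.coeff j k x * conj (planeWave (intVec m) x) * (dcut ζ j θ x * u.grad k x)) :=
      fun x => by
      rw [Finset.sum_mul]
      refine Finset.sum_congr rfl fun j _ => ?_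
      rw [Finset.sum_mul]
      refine Finset.sum_congr rfl fun k _ => ?_
      have e1 : conj (partialDeriv j (cut ζ (-η)) x) = conj (planeWave (intVec m) x) *
          (dcut ζ j θ x - Complex.I * (η j : ℝ) * cut ζ θ x) := by
        rw [partialDeriv_cut hζ, map_sub, map_mul, map_mul, conj_cut_neg, dcut, conj_cut_neg, hη,
          cut_add, cut_add, dcut]
        simp
        ring
      rw [SobolevSpace.D, SobolevSpace.D, conj_I_inv_mul, I_inv_eq, PeriodicMetric.coeff]
      show _ * (-Complex.I * _ * (Complex.I * conj (partialDeriv j (cut ζ (-η)) x))) * _ = _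
      rw [e1]
      linear_combination (-(g.inv x j k : ℂ) * g.density x * u.grad k x *
        (conj (planeWave (intVec m) x) *
          (dcut ζ j θ x - Complex.I * (η j : ℝ) * cut ζ θ x))) * Complex.I_sq
    have i2 := fun j k => i1 j k _ (contDiff_cut hζ θ).continuous (cut_eq_zero hs θ)
    have i3 := fun j k => i1 j k _ (continuous_dcut hζ j θ) (dcut_eq_zero hs j θ)
    have i4 : ∀ j k, Integrable fun x => -(Complex.I * (η j : ℝ)) *
          (g.coeff j k x * conj (planeWave (intVec m) x) * (cut ζ θ x * u.grad k x)) +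
          g.coeff j k x * conj (planeWave (intVec m) x) * (dcut ζ j θ x * u.grad k x) :=
      fun j k => ((i2 j k).const_mul _).add (i3 j k)
    rw [integral_congr_ae (Filter.Eventually.of_forall h1),
      integral_finsetSum _ fun j _ => integrable_finsetSum _ fun k _ => i4 j k]
    refine Finset.sum_congr rfl fun j _ => ?_
    rw [integral_finsetSum _ fun k _ => i4 j k]
    refine Finset.sum_congr rfl fun k _ => ?_
    rw [integral_add ((i2 j k).const_mul _) (i3 j k), integral_const_mul, inner_wave_shiftedGrAdj,
      ContinuousLinearMap.adjoint_inner_right,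
      inner_wave_mulOp_periodizationL2 (g.continuous_coeff j k) (g.isPeriodic_coeff j k),
      inner_wave_mulOp_periodizationL2 (g.continuous_coeff j k) (g.isPeriodic_coeff j k)]
  · have h2 : inner ℂ (waveH1 m) (potentialOp hn (memLp_mul_density g hq)
        (blochTransform u hζ hs θ)) =
        ∫ x, (q x * g.weight x * conj (planeWave (intVec m) x)) * (cut ζ θ x * u.toFun x) := by
      rw [inner_potentialOp, ← integral_mul_periodization (r := r)
        (F := fun x => cut ζ θ x * u.toFun x)
        (b := fun x => q x * g.weight x * conj (planeWave (intVec m) x))]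
      · refine integral_congr_ae ?_
        filter_upwards [coeFn_fn_periodizationH1 u (contDiff_cut hζ θ) (cut_eq_zero hs θ),
          coeFn_fn_waveH1 m] with x h1 h2
        rw [show fn (blochTransform u hζ hs θ) = fn (periodizationH1 u (contDiff_cut hζ θ)
          (cut_eq_zero hs θ)) from rfl, h1, h2]
        ring
      · exact fun x hx => by rw [cut_eq_zero hs θ x hx, zero_mul]
      · intro k
        filter_upwards [hq.periodic k] with x hx
        rw [hx, g.isPeriodic_weight k x, isPeriodic_planeWave m k x]
      · refine (integrable_mul_of_norm (r := r) (hq.locallyIntegrable_mul hn u)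
          (c := fun x => g.weight x * conj (planeWave (intVec m) x) * cut ζ θ x)
          ((g.continuous_weight.mul (Complex.continuous_conj.comp (continuous_planeWave _))).mul
          (contDiff_cut hζ θ).continuous) fun x hx => by
            rw [cut_eq_zero hs θ x hx, mul_zero]).congr
          (Filter.Eventually.of_forall fun x => by ring)
    rw [h2]
    refine integral_congr_ae (Filter.Eventually.of_forall fun x => ?_)
    show q x * u.toFun x * conj (cut ζ (-η) x) * (g.density x : ℂ) = _
    rw [conj_cut_neg, hη, cut_add, show (g.density x : ℂ) = g.weight x from rfl]
    ring

/-- The Bloch operator maps the transform of a cut-off solution to a commutator. -/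
lemma blochOp_blochTransform (hu : ∀ v : SobolevSpace n, form g q u v =
      ∫ x, z * u.toFun x * conj (v.toFun x) * (g.density x : ℂ)) :
    blochOp g hn hq z (fun i => (θ i : ℂ)) (blochTransform u hζ hs θ) =
      commutator g u hζ hs θ := by
  rw [← sub_eq_zero]
  refine eq_zero_of_inner_waveH1 fun m => ?_
  -- the cut-off plane wave is the test function: pairing with `waveH1 m` unfolds to `ℝⁿ`
  have h := hu (smoothSobolev (contDiff_cut hζ (-(θ + intVec m)))
      (cut_eq_zero hs (-(θ + intVec m))))
  rw [form_cut g u hζ hs θ hn hq m] at h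
  have hz : ∫ x, z * u.toFun x * conj ((smoothSobolev (contDiff_cut hζ (-(θ + intVec m)))
      (cut_eq_zero hs (-(θ + intVec m)))).toFun x) * (g.density x : ℂ) =
      z * inner ℂ (fn (waveH1 m)) (mulOp _ (memLp_top_cell g.continuous_weight)
        (fn (blochTransform u hζ hs θ))) := by
    rw [fn_blochTransform, inner_wave_mulOp_periodizationL2 g.continuous_weight g.isPeriodic_weight,
      ← integral_const_mul]
    refine integral_congr_ae (Filter.Eventually.of_forall fun x => ?_)
    show z * u.toFun x * conj (cut ζ (-(θ + intVec m)) x) * (g.density x : ℂ) = _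
    rw [conj_cut_neg, cut_add, show (g.density x : ℂ) = g.weight x from rfl]
    ring
  rw [hz] at h
  rw [inner_sub_right, blochOp, _root_.sub_apply, _root_.add_apply, inner_sub_right,
    inner_add_right, _root_.smul_apply, inner_smul_right, ContinuousLinearMap.comp_apply,
    ContinuousLinearMap.adjoint_inner_right, ContinuousLinearMap.comp_apply]
  have e1 : inner ℂ (waveH1 m) ((∑ j, ∑ k, (shiftedGrAdj (fun i => (θ i : ℂ)) j).comp
      ((mulOp _ (memLp_top_cell (g.continuous_coeff j k))).comp
        (shiftedGr (fun i => (θ i : ℂ)) k))) (blochTransform u hζ hs θ)) -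
      inner ℂ (waveH1 m) (commutator g u hζ hs θ) = ∑ j, ∑ k,
      (inner ℂ (waveH1 m) (shiftedGrAdj (fun i => (θ i : ℂ)) j
        (mulOp _ (memLp_top_cell (g.continuous_coeff j k))
        (periodizationL2 (contDiff_cut hζ θ).continuous (cut_eq_zero hs θ) (u.memLp_grad k)))) +
      inner ℂ (waveH1 m) ((fn (n := n)).adjoint (mulOp _ (memLp_top_cell (g.continuous_coeff j k))
      (periodizationL2 (continuous_dcut hζ j θ) (dcut_eq_zero hs j θ) (u.memLp_grad k))))) := by
    rw [commutator, ← inner_sub_right, _root_.sum_apply, ← Finset.sum_sub_distrib, inner_sum]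
    refine Finset.sum_congr rfl fun j _ => ?_
    rw [_root_.sum_apply, ← Finset.sum_sub_distrib, inner_sum]
    refine Finset.sum_congr rfl fun k _ => ?_
    rw [ContinuousLinearMap.comp_apply, ContinuousLinearMap.comp_apply, shiftedGr_blochTransform,
      map_add, map_add, ← inner_add_right]
    congr 1
    abel
  linear_combination e1 + h

end

/-! ### Plancherel's theorem for the Bloch transform -/

/-- The quasimomentum in `(0,1)ⁿ` that corresponds to a point of the cell. -/
def quasimomentum (t : Space n) : Space n := (2 * Real.pi)⁻¹ • t

/-- The square of the `L²(𝕋ⁿ)` norm of the periodization of `exp(-iθ·x) F`, as a function of the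
quasimomentum. -/
def transformSq (F : Space n → ℂ) (t : Space n) : ENNReal :=
  ∫⁻ x, ‖periodization (fun y => planeWave (-quasimomentum t) y * F y) x‖ₑ ^ 2 ∂(cellMeasure n)

/-- The reciprocal of the volume of the cell. -/
def cellConst (n : ℕ) : ENNReal := ‖(cellNorm n : ℂ)‖ₑ ^ 2

lemma planeWave_neg_quasimomentum (t : Space n) (m : Fin n → ℤ) :
    planeWave (-quasimomentum t) (latticeVec m) = planeWave (intVec (-m)) t := by
  rw [planeWave, planeWave]
  congr 3
  refine Finset.sum_congr rfl fun i _ => ?_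
  have := Real.pi_ne_zero
  simp [quasimomentum]
  field_simp

/-- Parseval's identity for trigonometric polynomials. -/
lemma lintegral_sum_planeWave (S : Finset (Fin n → ℤ)) (a : (Fin n → ℤ) → ℂ) :
    cellConst n * ∫⁻ t, ‖∑ m ∈ S, planeWave (intVec (-m)) t * a m‖ₑ ^ 2 ∂(cellMeasure n) =
      ∑ m ∈ S, ‖a m‖ₑ ^ 2 := by
  have hon : Orthonormal ℂ fun m : Fin n → ℤ => expL2 (-m) :=
    orthonormal_expL2.comp _ neg_injective
  set p : CellL2 n := ∑ m ∈ S, a m • expL2 (-m) with hp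
  have h1 : p =ᵐ[cellMeasure n] fun t =>
      (cellNorm n : ℂ) * ∑ m ∈ S, planeWave (intVec (-m)) t * a m := by
    have h : ∀ m ∈ S, (a m • expL2 (-m) : CellL2 n) =ᵐ[cellMeasure n]
        fun x => a m * ((cellNorm n : ℂ) * planeWave (intVec (-m)) x) := fun m _ => by
      filter_upwards [Lp.coeFn_smul (a m) (expL2 (-m)), coeFn_expL2 (-m)] with x h1 h2
      rw [h1, Pi.smul_apply, h2, smul_eq_mul]
    refine (Lp.coeFn_finsetSum S _).trans ?_
    filter_upwards [(Filter.eventually_all_finset S).2 h] with x hx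
    rw [Finset.sum_apply, Finset.mul_sum]
    refine (Finset.sum_congr rfl hx).trans (Finset.sum_congr rfl fun m _ => ?_)
    ring
  have h2 : ‖p‖ ^ 2 = ∑ m ∈ S, ‖a m‖ ^ 2 := by
    have h := hon.inner_sum a a S
    rw [← hp, inner_self_eq_norm_sq_to_K] at h
    apply Complex.ofReal_injective
    rw [Complex.ofReal_pow]
    refine h.trans ?_
    rw [Complex.ofReal_sum]
    refine Finset.sum_congr rfl fun m _ => ?_
    rw [mul_comm, Complex.mul_conj, Complex.normSq_eq_norm_sq]
  have h3 : ‖p‖ₑ ^ 2 = ∑ m ∈ S, ‖a m‖ₑ ^ 2 := by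
    simp only [← ofReal_norm, ← ENNReal.ofReal_pow (norm_nonneg _)]
    rw [h2, ENNReal.ofReal_sum_of_nonneg fun _ _ => by positivity]
  rw [← h3, enorm_sq_eq_lintegral, cellConst, ← lintegral_const_mul' _ _ (by simp)]
  refine lintegral_congr_ae ?_
  filter_upwards [h1] with t ht
  rw [ht, enorm_mul, mul_pow]

section

variable {F : Space n → ℂ} {r : ℝ} (hF : ∀ x, r < ‖x‖ → F x = 0)
  (hm : AEStronglyMeasurable F volume)

include hF in
lemma periodization_planeWave_mul (t : Space n) {x : Space n} (hx : x ∈ cell n) :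
    periodization (fun y => planeWave (-quasimomentum t) y * F y) x =
      planeWave (-quasimomentum t) x *
        ∑ m ∈ ballCells n r, planeWave (intVec (-m)) t * F (x + latticeVec m) := by
  rw [periodization_eq_sum (r := r) (fun y hy => by rw [hF y hy, mul_zero]) hx, Finset.mul_sum]
  refine Finset.sum_congr rfl fun m _ => ?_
  rw [planeWave_add_right, planeWave_neg_quasimomentum, mul_assoc]

include hF in
lemma transformSq_eq (t : Space n) : transformSq F t =
    ∫⁻ x, ‖∑ m ∈ ballCells n r, planeWave (intVec (-m)) t * F (x + latticeVec m)‖ₑ ^ 2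
      ∂(cellMeasure n) := by
  refine lintegral_congr_ae ?_
  filter_upwards [ae_mem_cell] with x hx
  rw [periodization_planeWave_mul hF t hx, enorm_mul]
  have : ‖planeWave (-quasimomentum t) x‖ₑ = 1 := by
    rw [← ofReal_norm, norm_planeWave]; simp
  rw [this, one_mul]

include hm in
lemma aestronglyMeasurable_translate (m : Fin n → ℤ) :
    AEStronglyMeasurable (fun x => F (x + latticeVec m)) (cellMeasure n) :=
  (hm.comp_measurePreserving (measurePreserving_add_right volume (latticeVec m))).restrict

include hm in
lemma aemeasurable_transformSq_integrand (S : Finset (Fin n → ℤ)) :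
    AEMeasurable (fun p : Space n × Space n =>
      ‖∑ m ∈ S, planeWave (intVec (-m)) p.1 * F (p.2 + latticeVec m)‖ₑ ^ 2)
      ((cellMeasure n).prod (cellMeasure n)) := by
  refine AEMeasurable.pow_const (AEStronglyMeasurable.enorm ?_) 2
  refine Finset.aestronglyMeasurable_fun_sum _ fun m _ => ?_
  exact ((continuous_planeWave _).comp continuous_fst).aestronglyMeasurable.mul
    (aestronglyMeasurable_translate hm m).comp_snd

include hF hm in
/-- Plancherel's theorem: for a fixed point `x` of the cell, the values of `F` at the translates of
`x` are the Fourier coefficients, with respect to the quasimomentum, of the Bloch transform. -/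
lemma lintegral_transformSq :
    cellConst n * ∫⁻ t, transformSq F t ∂(cellMeasure n) = ∫⁻ x, ‖F x‖ₑ ^ 2 := by
  simp only [transformSq_eq hF]
  rw [lintegral_lintegral_swap (aemeasurable_transformSq_integrand hm _),
    ← lintegral_const_mul' _ _ (by simp [cellConst])]
  simp only [lintegral_sum_planeWave]
  rw [lintegral_finsetSum' _ fun m _ => ((aestronglyMeasurable_translate hm m).enorm.pow_const 2),
    lintegral_eq_tsum_cell, tsum_eq_sum]
  intro m hm'
  rw [lintegral_eq_zero_iff' ((aestronglyMeasurable_translate hm m).enorm.pow_const 2)]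
  filter_upwards [ae_mem_cell] with x hx
  rw [hF _ (not_le.1 fun h => hm' (mem_ballCells hx h))]
  simp

include hF hm in
lemma aemeasurable_transformSq : AEMeasurable (transformSq F) (cellMeasure n) := by
  simp only [funext (transformSq_eq hF)]
  exact (aemeasurable_transformSq_integrand hm _).lintegral_prod_right'

end

lemma enorm_add_sq_le (a b : ℂ) : ‖a + b‖ₑ ^ 2 ≤ 2 * ‖a‖ₑ ^ 2 + 2 * ‖b‖ₑ ^ 2 := by
  have h : ‖a + b‖ ^ 2 ≤ 2 * ‖a‖ ^ 2 + 2 * ‖b‖ ^ 2 := by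
    nlinarith [norm_add_le a b, norm_nonneg (a + b), norm_nonneg a, norm_nonneg b,
      sq_nonneg (‖a‖ - ‖b‖)]
  have h2 := ENNReal.ofReal_le_ofReal h
  rw [ENNReal.ofReal_add (by positivity) (by positivity), ENNReal.ofReal_mul (by norm_num),
    ENNReal.ofReal_mul (by norm_num)] at h2
  simpa [ENNReal.ofReal_pow, ofReal_norm] using h2

lemma transformSq_add_le {F G : Space n → ℂ} {r : ℝ} (hF : ∀ x, r < ‖x‖ → F x = 0)
    (hG : ∀ x, r < ‖x‖ → G x = 0) (hm : AEStronglyMeasurable F volume) (t : Space n) :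
    transformSq (fun x => F x + G x) t ≤ 2 * transformSq F t + 2 * transformSq G t := by
  rw [transformSq_eq (r := r) (fun x hx => by rw [hF x hx, hG x hx, add_zero]), transformSq_eq hF,
    transformSq_eq hG, ← lintegral_const_mul' _ _ (by simp), ← lintegral_const_mul' _ _ (by simp),
    ← lintegral_add_left']
  · refine lintegral_mono fun x => ?_
    simp only [mul_add, Finset.sum_add_distrib]
    exact enorm_add_sq_le _ _
  · refine AEMeasurable.const_mul (AEMeasurable.pow_const (AEStronglyMeasurable.enorm ?_) 2) _
    exact Finset.aestronglyMeasurable_fun_sum _ fun m _ =>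
      (aestronglyMeasurable_translate hm m).const_mul _

/-- The transform of `ζ f` for a cut-off function `ζ`. -/
lemma enorm_sq_periodizationL2 {ζ : Space n → ℝ} (t : Space n) {r : ℝ}
    (hc : Continuous (cut ζ (quasimomentum t))) (hs : ∀ x, r < ‖x‖ → cut ζ (quasimomentum t) x = 0)
    {f : Space n → ℂ} (hf : MemLp f 2 volume) :
    ‖periodizationL2 hc hs hf‖ₑ ^ 2 = transformSq (fun x => (ζ x : ℂ) * f x) t := by
  rw [enorm_sq_eq_lintegral]
  refine lintegral_congr_ae ?_
  filter_upwards [coeFn_periodizationL2 hc hs hf] with x hx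
  have : (fun y => cut ζ (quasimomentum t) y * f y) =
      fun y => planeWave (-quasimomentum t) y * ((ζ y : ℂ) * f y) := by
    funext y; rw [cut]; ring
  rw [hx, this]

/-! ### Absence of square integrable solutions -/

/-- The commutator is controlled by the periodizations of the terms with derivatives of the cut-off
function, uniformly in the quasimomentum. -/
lemma exists_commutator_bound (g : PeriodicMetric n) (u : SobolevSpace n) :
    ∃ C : ENNReal, C ≠ ⊤ ∧ ∀ (ζ : Space n → ℝ) (hζ : ContDiff ℝ ∞ ζ) (r : ℝ)
      (hs : ∀ x, r < ‖x‖ → ζ x = 0) (t : Space n), t ∈ cell n →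
      ‖commutator g u hζ hs (quasimomentum t)‖ₑ ^ 2 ≤ C * ∑ j, ∑ k,
        (transformSq (fun x => (fderiv ℝ ζ x (EuclideanSpace.single k 1) : ℂ) * u.toFun x) t +
        transformSq (fun x => (fderiv ℝ ζ x (EuclideanSpace.single j 1) : ℂ) * u.grad k x) t) := by
  set A : ℝ := ∑ j, ∑ k, ‖mulOp _ (memLp_top_cell (g.continuous_coeff j k))‖ with hA
  have hA0 : 0 ≤ A := Finset.sum_nonneg fun _ _ => Finset.sum_nonneg fun _ _ => norm_nonneg _
  have hM : ∀ j k p, ‖mulOp _ (memLp_top_cell (g.continuous_coeff j k)) p‖ ≤ A * ‖p‖ :=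
    fun j k p => (ContinuousLinearMap.le_opNorm _ p).trans <| mul_le_mul_of_nonneg_right
      ((Finset.single_le_sum (f := fun k => ‖mulOp _ (memLp_top_cell (g.continuous_coeff j k))‖)
        (fun _ _ => norm_nonneg _) (Finset.mem_univ k)).trans
      (Finset.single_le_sum
        (f := fun j => ∑ k, ‖mulOp _ (memLp_top_cell (g.continuous_coeff j k))‖)
        (fun _ _ => Finset.sum_nonneg fun _ _ => norm_nonneg _) (Finset.mem_univ j)))
      (norm_nonneg _)
  refine ⟨ENNReal.ofReal (8 * A ^ 2 * n ^ 2), ENNReal.ofReal_ne_top, fun ζ hζ r hs t ht => ?_⟩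
  set θ := quasimomentum t with hθ
  set P : Fin n → CellL2 n := fun k =>
    periodizationL2 (continuous_dcut hζ k θ) (dcut_eq_zero hs k θ) u.memLp with hP
  set R : Fin n → Fin n → CellL2 n := fun j k =>
    periodizationL2 (continuous_dcut hζ j θ) (dcut_eq_zero hs j θ) (u.memLp_grad k) with hR
  have hfn : ∀ p : CellL2 n, ‖(fn (n := n)).adjoint p‖ ≤ ‖p‖ := fun p => by
    refine (ContinuousLinearMap.le_opNorm _ p).trans ?_
    rw [LinearIsometryEquiv.norm_map]
    exact mul_le_of_le_one_left (norm_nonneg _)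
      (ContinuousLinearMap.opNorm_le_bound _ zero_le_one fun y => by
        rw [one_mul]; exact norm_fn_le y)
  have hgr : ∀ j (p : CellL2 n), ‖(gr j).adjoint p‖ ≤ ‖p‖ := fun j p => by
    refine (ContinuousLinearMap.le_opNorm _ p).trans ?_
    rw [LinearIsometryEquiv.norm_map]
    exact mul_le_of_le_one_left (norm_nonneg _)
      (ContinuousLinearMap.opNorm_le_bound _ zero_le_one fun y => by
        rw [one_mul]; exact norm_gr_le j y)
  have hθ1 : ∀ j, |θ j| ≤ 1 := fun j => by
    have h0 := ht j
    rw [hθ, quasimomentum, PiLp.smul_apply, smul_eq_mul, abs_of_pos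
      (mul_pos (by positivity) h0.1), inv_mul_le_iff₀ Real.two_pi_pos]
    linarith [h0.2]
  have hadj : ∀ j (p : CellL2 n), ‖shiftedGrAdj (fun i => (θ i : ℂ)) j p‖ ≤ 2 * ‖p‖ := fun j p => by
    rw [shiftedGrAdj, _root_.sub_apply, _root_.smul_apply]
    refine (norm_sub_le _ _).trans ?_
    rw [norm_smul]
    have h1 : ‖Complex.I * (θ j : ℂ)‖ ≤ 1 := by
      rw [norm_mul, Complex.norm_I, one_mul, Complex.norm_real]
      exact hθ1 j
    have h2 := mul_le_mul h1 (hfn p) (norm_nonneg _) zero_le_one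
    linarith [hgr j p]
  have hc : ‖commutator g u hζ hs θ‖ ≤ ∑ j, ∑ k, 2 * A * (‖P k‖ + ‖R j k‖) := by
    refine (norm_sum_le _ _).trans (Finset.sum_le_sum fun j _ => ?_)
    refine (norm_sum_le _ _).trans (Finset.sum_le_sum fun k _ => ?_)
    refine (norm_sub_le _ _).trans ?_
    have h1 := (hadj j _).trans (mul_le_mul_of_nonneg_left (hM j k (P k)) zero_le_two)
    have h2 := (hfn _).trans (hM j k (R j k))
    have h3 := mul_nonneg hA0 (norm_nonneg (R j k))
    linarith
  have hc2 : ‖commutator g u hζ hs θ‖ ^ 2 ≤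
      8 * A ^ 2 * n ^ 2 * ∑ j, ∑ k, (‖P k‖ ^ 2 + ‖R j k‖ ^ 2) := by
    calc _ ≤ (∑ j, ∑ k, 2 * A * (‖P k‖ + ‖R j k‖)) ^ 2 := pow_le_pow_left₀ (norm_nonneg _) hc 2
      _ ≤ (n : ℝ) * ∑ j, (∑ k, 2 * A * (‖P k‖ + ‖R j k‖)) ^ 2 := by
        simpa using sq_sum_le_card_mul_sum_sq (s := Finset.univ)
          (f := fun j => ∑ k, 2 * A * (‖P k‖ + ‖R j k‖))
      _ ≤ (n : ℝ) * ∑ j, ((n : ℝ) * ∑ k, (2 * A * (‖P k‖ + ‖R j k‖)) ^ 2) := by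
        gcongr with j _
        simpa using sq_sum_le_card_mul_sum_sq (s := Finset.univ)
          (f := fun k => 2 * A * (‖P k‖ + ‖R j k‖))
      _ ≤ (n : ℝ) * ∑ j, ((n : ℝ) * ∑ k, 8 * A ^ 2 * (‖P k‖ ^ 2 + ‖R j k‖ ^ 2)) := by
        gcongr with j _ k _
        nlinarith [mul_nonneg (sq_nonneg A) (sq_nonneg (‖P k‖ - ‖R j k‖))]
      _ = _ := by
        simp only [← Finset.mul_sum]
        ring
  have h := ENNReal.ofReal_le_ofReal hc2
  rw [ENNReal.ofReal_mul (by positivity), ENNReal.ofReal_pow (norm_nonneg _), ofReal_norm,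
    ENNReal.ofReal_sum_of_nonneg fun j _ => by positivity] at h
  refine h.trans (le_of_eq ?_)
  congr 1
  refine Finset.sum_congr rfl fun j _ => ?_
  rw [ENNReal.ofReal_sum_of_nonneg fun k _ => by positivity]
  refine Finset.sum_congr rfl fun k _ => ?_
  rw [ENNReal.ofReal_add (by positivity) (by positivity), ENNReal.ofReal_pow (norm_nonneg _),
    ENNReal.ofReal_pow (norm_nonneg _), ofReal_norm, ofReal_norm]
  congr 1
  · exact enorm_sq_periodizationL2 (ζ := fun y => fderiv ℝ ζ y (EuclideanSpace.single k 1)) t _ _ _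
  · exact enorm_sq_periodizationL2 (ζ := fun y => fderiv ℝ ζ y (EuclideanSpace.single j 1)) t _ _ _

/-- The quasimomenta for which the Bloch operator is bounded below by `1/N`. -/
def coerciveSet (g : PeriodicMetric n) (hn : 3 ≤ n) {q : Space n → ℂ}
    (hq : IsPeriodicPotential q) (z : ℂ) (N : ℕ) : Set (Space n) :=
  {t | ∀ p, ‖p‖ ≤ N * ‖blochOp g hn hq z (fun i => (quasimomentum t i : ℂ)) p‖}

section

variable (g : PeriodicMetric n) (hn : 3 ≤ n) {q : Space n → ℂ} (hq : IsPeriodicPotential q) (z : ℂ)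

lemma isClosed_coerciveSet (N : ℕ) : IsClosed (coerciveSet g hn hq z N) := by
  simp only [coerciveSet, Set.ofPred_forall]
  refine isClosed_iInter fun p => isClosed_le continuous_const (continuous_const.mul ?_)
  refine Continuous.norm (Continuous.clm_apply ((continuous_blochOp g hn hq z).comp ?_)
    continuous_const)
  unfold quasimomentum
  fun_prop

lemma monotone_coerciveSet : Monotone (coerciveSet g hn hq z) := fun N M hNM t ht p =>
  (ht p).trans (mul_le_mul_of_nonneg_right (by exact_mod_cast hNM) (norm_nonneg _))

/-- Almost every quasimomentum has an invertible Bloch operator, which is bounded below by the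
reciprocal of the norm of its inverse. -/
lemma ae_mem_coerciveSet {θ₀ : Fin n → ℂ}
    (hinj : Function.Injective (blochOp g hn hq z θ₀)) :
    ∀ᵐ t ∂(cellMeasure n), t ∈ ⋃ N, coerciveSet g hn hq z N := by
  have h1 := ae_isUnit_blochOp g hn hq z θ₀ hinj
  have hmp := EuclideanSpace.volume_preserving_symm_measurableEquiv_toLp (Fin n)
  have h2 : ∀ᵐ t : Space n, IsUnit (blochOp g hn hq z fun i => (t i : ℂ)) :=
    hmp.quasiMeasurePreserving.ae h1
  have hscale := (⟨by fun_prop, Measure.map_addHaar_smul (μ := (volume : Measure (Space n)))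
    (show (2 * Real.pi)⁻¹ ≠ 0 by positivity)⟩ :
      MeasurePreserving (fun x : Space n => (2 * Real.pi)⁻¹ • x) volume _)
  have h3 : ∀ᵐ t : Space n, IsUnit (blochOp g hn hq z fun i => (quasimomentum t i : ℂ)) :=
    hscale.quasiMeasurePreserving.ae (Measure.ae_smul_measure h2 _)
  filter_upwards [ae_restrict_of_ae h3] with t ht
  obtain ⟨B, hB⟩ := ht
  obtain ⟨N, hN⟩ := exists_nat_ge ‖(↑B⁻¹ : TorusH1 n →L[ℂ] TorusH1 n)‖
  refine Set.mem_iUnion.2 ⟨N, fun p => ?_⟩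
  rw [← hB]
  have h4 : (↑B⁻¹ : TorusH1 n →L[ℂ] TorusH1 n) ((B : TorusH1 n →L[ℂ] TorusH1 n) p) = p := by
    rw [← mul_apply_eq_comp, Units.inv_mul]; rfl
  calc ‖p‖ = ‖(↑B⁻¹ : TorusH1 n →L[ℂ] TorusH1 n) ((B : TorusH1 n →L[ℂ] TorusH1 n) p)‖ := by rw [h4]
    _ ≤ ‖(↑B⁻¹ : TorusH1 n →L[ℂ] TorusH1 n)‖ * ‖(B : TorusH1 n →L[ℂ] TorusH1 n) p‖ :=
      ContinuousLinearMap.le_opNorm _ _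
    _ ≤ _ := mul_le_mul_of_nonneg_right hN (norm_nonneg _)

/-- On the set where the Bloch operator is bounded below, the transform of a cut-off solution is
controlled by the derivatives of the cut-off function. -/
lemma exists_lintegral_coerciveSet_le (u : SobolevSpace n) (hu : ∀ v : SobolevSpace n,
    form g q u v = ∫ x, z * u.toFun x * conj (v.toFun x) * (g.density x : ℂ)) (N : ℕ) :
    ∃ C : ENNReal, C ≠ ⊤ ∧ ∀ (ζ : Space n → ℝ), ContDiff ℝ ∞ ζ → ∀ (r : ℝ),
      (∀ x, r < ‖x‖ → ζ x = 0) → ∀ M : ℝ≥0, (∀ x k,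
        ‖fderiv ℝ ζ x (EuclideanSpace.single k 1)‖ ≤ M) →
      cellConst n * ∫⁻ t in coerciveSet g hn hq z N, transformSq (fun x => (ζ x : ℂ) * u.toFun x) t
        ∂(cellMeasure n) ≤ C * (M : ENNReal) ^ 2 := by
  obtain ⟨C, hC, hbound⟩ := exists_commutator_bound g u
  set D : ENNReal := ∑ _j : Fin n, ∑ k, ((∫⁻ x, ‖u.toFun x‖ₑ ^ 2) + ∫⁻ x, ‖u.grad k x‖ₑ ^ 2) with hD
  have hfin : ∀ {f : Space n → ℂ}, MemLp f 2 volume → ∫⁻ x, ‖f x‖ₑ ^ 2 ≠ ⊤ := fun {f} hf => by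
    rw [← eLpNorm_two_sq]; exact ENNReal.pow_ne_top hf.2.ne
  have hDt : D ≠ ⊤ := by
    refine ENNReal.sum_ne_top.2 fun j _ => ENNReal.sum_ne_top.2 fun k _ => ?_
    exact ENNReal.add_ne_top.2 ⟨hfin u.memLp, hfin (u.memLp_grad k)⟩
  refine ⟨(N : ENNReal) ^ 2 * C * D, ?_, fun ζ hζ r hs M hM => ?_⟩
  · exact ENNReal.mul_ne_top (ENNReal.mul_ne_top (by simp) hC) hDt
  set E : Fin n → (Space n → ℂ) → Space n → ℂ := fun k f x =>
    (fderiv ℝ ζ x (EuclideanSpace.single k 1) : ℂ) * f x with hE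
  have hEs : ∀ k f x, r < ‖x‖ → E k f x = 0 := fun k f x hx => by
    simp [hE, fderiv_eq_zero_of_norm hs x hx]
  have hEm : ∀ k {f}, MemLp f 2 volume → AEStronglyMeasurable (E k f) volume := fun k {f} hf =>
    (Complex.continuous_ofReal.comp ((hζ.continuous_fderiv (by simp)).clm_apply
      continuous_const)).aestronglyMeasurable.mul hf.1
  have hEle : ∀ k {f}, MemLp f 2 volume →
      cellConst n * ∫⁻ t, transformSq (E k f) t ∂(cellMeasure n) ≤
        (M : ENNReal) ^ 2 * ∫⁻ x, ‖f x‖ₑ ^ 2 := fun k {f} hf => by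
    rw [lintegral_transformSq (hEs k f) (hEm k hf), ← lintegral_const_mul' _ _ (by simp)]
    refine lintegral_mono fun x => ?_
    rw [hE, ← mul_pow]
    simp only [enorm_mul]
    refine pow_le_pow_left₀ zero_le (mul_le_mul' ?_ le_rfl) 2
    rw [← enorm_norm, Complex.norm_real, enorm_norm]
    have := hM x k
    rw [← ofReal_norm]
    exact ENNReal.ofReal_le_of_le_toReal (by simpa using this)
  have hpt : ∀ t ∈ cell n, t ∈ coerciveSet g hn hq z N →
      transformSq (fun x => (ζ x : ℂ) * u.toFun x) t ≤ (N : ENNReal) ^ 2 * C *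
        ∑ j, ∑ k, (transformSq (E k u.toFun) t + transformSq (E j (u.grad k)) t) := by
    intro t ht htN
    have h1 := htN (blochTransform u hζ hs (quasimomentum t))
    rw [blochOp_blochTransform g hn hq z u hζ hs _ hu] at h1
    have h2 : ‖fn (blochTransform u hζ hs (quasimomentum t))‖ₑ ≤
        N * ‖commutator g u hζ hs (quasimomentum t)‖ₑ := by
      have h3 := ENNReal.ofReal_le_ofReal ((norm_fn_le _).trans h1)
      rw [ENNReal.ofReal_mul (by positivity)] at h3
      simpa using h3
    rw [← enorm_sq_periodizationL2 t (contDiff_cut hζ _).continuous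
      (cut_eq_zero hs _) u.memLp, ← fn_blochTransform u hζ hs]
    calc _ ≤ (N * ‖commutator g u hζ hs (quasimomentum t)‖ₑ) ^ 2 := pow_le_pow_left₀ zero_le h2 2
      _ = (N : ENNReal) ^ 2 * ‖commutator g u hζ hs (quasimomentum t)‖ₑ ^ 2 := mul_pow _ _ _
      _ ≤ _ := by rw [mul_assoc]; exact mul_le_mul' le_rfl (hbound ζ hζ r hs t ht)
  have hmeas : ∀ k {f}, MemLp f 2 volume → AEMeasurable (transformSq (E k f)) (cellMeasure n) :=
    fun k {f} hf => aemeasurable_transformSq (hEs k f) (hEm k hf)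
  have hsum : ∫⁻ t, ∑ j, ∑ k, (transformSq (E k u.toFun) t + transformSq (E j (u.grad k)) t)
      ∂(cellMeasure n) = ∑ j, ∑ k, ((∫⁻ t, transformSq (E k u.toFun) t ∂(cellMeasure n)) +
        ∫⁻ t, transformSq (E j (u.grad k)) t ∂(cellMeasure n)) := by
    have hadd : ∀ j k, AEMeasurable (fun t => transformSq (E k u.toFun) t +
        transformSq (E j (u.grad k)) t) (cellMeasure n) := fun j k =>
      (hmeas k u.memLp).add (hmeas j (u.memLp_grad k))
    rw [lintegral_finsetSum' _ fun j _ => Finset.aemeasurable_fun_sum _ fun k _ => hadd j k]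
    refine Finset.sum_congr rfl fun j _ => ?_
    rw [lintegral_finsetSum' _ fun k _ => hadd j k]
    exact Finset.sum_congr rfl fun k _ => lintegral_add_left' (hmeas k u.memLp) _
  have hset : ∫⁻ t in coerciveSet g hn hq z N, transformSq (fun x => (ζ x : ℂ) * u.toFun x) t
        ∂(cellMeasure n) ≤ (N : ENNReal) ^ 2 * C * ∫⁻ t, ∑ j, ∑ k,
          (transformSq (E k u.toFun) t + transformSq (E j (u.grad k)) t) ∂(cellMeasure n) := by
    rw [← lintegral_const_mul' _ _ (ENNReal.mul_ne_top (by simp) hC)]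
    refine (lintegral_mono_ae ?_).trans (setLIntegral_le_lintegral (coerciveSet g hn hq z N) _)
    filter_upwards [ae_restrict_of_ae ae_mem_cell,
      ae_restrict_mem (isClosed_coerciveSet g hn hq z N).measurableSet] with t h1 h2
    exact hpt t h1 h2
  calc _ ≤ cellConst n * ((N : ENNReal) ^ 2 * C * ∫⁻ t, ∑ j, ∑ k,
          (transformSq (E k u.toFun) t + transformSq (E j (u.grad k)) t) ∂(cellMeasure n)) :=
        mul_le_mul' le_rfl hset
    _ = (N : ENNReal) ^ 2 * C * ∑ j, ∑ k,
          (cellConst n * (∫⁻ t, transformSq (E k u.toFun) t ∂(cellMeasure n)) +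
        cellConst n * ∫⁻ t, transformSq (E j (u.grad k)) t ∂(cellMeasure n)) := by
      rw [hsum]
      simp only [← mul_add, ← Finset.mul_sum]
      ring
    _ ≤ (N : ENNReal) ^ 2 * C * ∑ _j : Fin n, ∑ k, ((M : ENNReal) ^ 2 * (∫⁻ x, ‖u.toFun x‖ₑ ^ 2) +
        (M : ENNReal) ^ 2 * ∫⁻ x, ‖u.grad k x‖ₑ ^ 2) := by
      exact mul_le_mul' le_rfl (Finset.sum_le_sum fun j _ => Finset.sum_le_sum fun k _ =>
        add_le_add (hEle k u.memLp) (hEle j (u.memLp_grad k)))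
    _ = _ := by
      simp only [← mul_add, ← Finset.mul_sum, hD]
      ring

end

/-- Smooth cut-off functions on balls of radius `k + 1` whose derivatives are of order
`1 / (k + 1)`. -/
lemma exists_cutoff (n : ℕ) : ∃ (ζ : ℕ → Space n → ℝ) (M : ℝ≥0), ∀ k, ContDiff ℝ ∞ (ζ k) ∧
    (∀ x, ‖x‖ ≤ k + 1 → ζ k x = 1) ∧ (∀ x, 2 * (k + 1 : ℝ) < ‖x‖ → ζ k x = 0) ∧
    (∀ x, ζ k x ∈ Set.Icc (0 : ℝ) 1) ∧
    ∀ x i, ‖fderiv ℝ (ζ k) x (EuclideanSpace.single i 1)‖ ≤ (M / (k + 1) : ℝ≥0) := by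
  set b : ContDiffBump (0 : Space n) := ⟨1, 2, one_pos, one_lt_two⟩ with hb
  have hbs : ContDiff ℝ ∞ b := b.contDiff
  obtain ⟨M, hM⟩ := (b.hasCompactSupport.fderiv (𝕜 := ℝ)).exists_bound_of_continuous
    (hbs.continuous_fderiv (by simp))
  have hM0 : 0 ≤ M := (norm_nonneg _).trans (hM 0)
  have hnorm : ∀ (k : ℕ) (x : Space n), ‖((k : ℝ) + 1)⁻¹ • x‖ = ‖x‖ / (k + 1) := fun k x => by
    rw [norm_smul, Real.norm_eq_abs, abs_of_pos (by positivity), inv_mul_eq_div]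
  refine ⟨fun k x => b (((k : ℝ) + 1)⁻¹ • x), ⟨M, hM0⟩, fun k =>
    ⟨?_, fun x hx => ?_, fun x hx => ?_, fun x => ⟨b.nonneg, b.le_one⟩, fun x i => ?_⟩⟩
  · exact hbs.comp (contDiff_const_smul _)
  · refine b.one_of_mem_closedBall ?_
    rw [mem_closedBall_zero_iff, hnorm, div_le_one (by positivity)]
    exact hx
  · refine b.zero_of_le_dist ?_
    rw [dist_zero_right, hnorm]
    exact (le_div_iff₀ (by positivity)).2 hx.le
  · have h1 : HasFDerivAt (fun x => b (((k : ℝ) + 1)⁻¹ • x))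
        ((fderiv ℝ b (((k : ℝ) + 1)⁻¹ • x)).comp
          (((k : ℝ) + 1)⁻¹ • ContinuousLinearMap.id ℝ (Space n)))
        x := (hbs.differentiable (by simp) _).hasFDerivAt.comp x
          ((hasFDerivAt_id x).const_smul (((k : ℝ) + 1)⁻¹))
    rw [h1.fderiv, ContinuousLinearMap.comp_apply, _root_.smul_apply, map_smul, norm_smul,
      Real.norm_eq_abs, abs_of_pos (by positivity), inv_mul_eq_div]
    have h2 := ContinuousLinearMap.le_opNorm (fderiv ℝ b (((k : ℝ) + 1)⁻¹ • x))
      (EuclideanSpace.single i (1 : ℝ))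
    have h3 := hM (((k : ℝ) + 1)⁻¹ • x)
    rw [show ‖EuclideanSpace.single i (1 : ℝ)‖ = 1 by simp, mul_one] at h2
    push_cast
    exact div_le_div_of_nonneg_right (h2.trans h3) (by positivity)

/-- If the Bloch operator is injective for one complex quasimomentum, then the eigenvalue equation
has no nonzero solution in `H¹(ℝⁿ)`. -/
lemma ae_eq_zero_of_injective (g : PeriodicMetric n) (hn : 3 ≤ n) {q : Space n → ℂ}
    (hq : IsPeriodicPotential q) (z : ℂ) {θ₀ : Fin n → ℂ}
    (hinj : Function.Injective (blochOp g hn hq z θ₀)) (u : SobolevSpace n)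
    (hu : ∀ v : SobolevSpace n,
      form g q u v = ∫ x, z * u.toFun x * conj (v.toFun x) * (g.density x : ℂ)) :
    u.toFun =ᵐ[volume] 0 := by
  obtain ⟨ζ, M, hζ⟩ := exists_cutoff n
  set J := coerciveSet g hn hq z with hJ
  set tail : ℕ → ENNReal := fun k =>
    ∫⁻ x in (Metric.closedBall (0 : Space n) (k + 1))ᶜ, ‖u.toFun x‖ₑ ^ 2 with htail
  have hUt : ∫⁻ x, ‖u.toFun x‖ₑ ^ 2 ≠ ⊤ := by
    rw [← eLpNorm_two_sq]; exact ENNReal.pow_ne_top u.memLp.2.ne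
  have hm : ∀ f : Space n → ℝ, Continuous f →
      AEStronglyMeasurable (fun x => (f x : ℂ) * u.toFun x) volume := fun f hf =>
    (Complex.continuous_ofReal.comp hf).aestronglyMeasurable.mul u.memLp.1
  -- the difference of two cut-off functions is supported away from the smaller ball
  have hdiff : ∀ {S k : ℕ}, S ≤ k →
      ∫⁻ x, ‖((ζ S x - ζ k x : ℝ) : ℂ) * u.toFun x‖ₑ ^ 2 ≤ tail S := fun {S k} hSk => by
    simp only [htail]
    rw [← lintegral_indicator Metric.isClosed_closedBall.measurableSet.compl]
    refine lintegral_mono fun x => ?_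
    by_cases hx : ‖x‖ ≤ S + 1
    · have hx' : ‖x‖ ≤ k + 1 := hx.trans (by gcongr)
      rw [(hζ S).2.1 x hx, (hζ k).2.1 x hx']
      simp
    · rw [Set.indicator_of_mem (by simpa using hx), enorm_mul]
      refine pow_le_pow_left₀ zero_le (mul_le_of_le_one_left zero_le ?_) 2
      rw [← ofReal_norm, Complex.norm_real, ENNReal.ofReal_le_one, Real.norm_eq_abs, abs_le]
      have h1 := (hζ S).2.2.2.1 x
      have h2 := (hζ k).2.2.2.1 x
      exact ⟨by linarith [h1.1, h2.2], by linarith [h1.2, h2.1]⟩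
  -- for `k ≥ S`, write `ζ S` as `ζ k` plus the difference: on `J N`, the first term contributes
  -- `O(1/k²)` for fixed `N`, and the second at most the tail
  have hstep : ∀ N S : ℕ, cellConst n * ∫⁻ t in J N,
      transformSq (fun x => (ζ S x : ℂ) * u.toFun x) t ∂(cellMeasure n) ≤ 2 * tail S :=
    fun N S => by
    obtain ⟨C, hC, hbound⟩ := exists_lintegral_coerciveSet_le g hn hq z u hu N
    have hk : ∀ k ≥ S, cellConst n * ∫⁻ t in J N,
        transformSq (fun x => (ζ S x : ℂ) * u.toFun x) t ∂(cellMeasure n) ≤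
        2 * (C * ((M / (k + 1) : ℝ≥0) : ENNReal) ^ 2) + 2 * tail S := fun k hSk => by
      obtain ⟨hk1, -, hk3, -, hk5⟩ := hζ k
      have hS : ∀ x, 2 * (k + 1 : ℝ) < ‖x‖ → ζ S x = 0 := fun x hx =>
        (hζ S).2.2.1 x (lt_of_le_of_lt (by gcongr) hx)
      have e1 : ∀ t, transformSq (fun x => (ζ S x : ℂ) * u.toFun x) t ≤
          2 * transformSq (fun x => (ζ k x : ℂ) * u.toFun x) t +
          2 * transformSq (fun x => ((ζ S x - ζ k x : ℝ) : ℂ) * u.toFun x) t := fun t => by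
        have h := transformSq_add_le (r := 2 * (k + 1 : ℝ))
          (F := fun x => (ζ k x : ℂ) * u.toFun x)
          (G := fun x => ((ζ S x - ζ k x : ℝ) : ℂ) * u.toFun x)
          (fun x hx => by simp [hk3 x hx]) (fun x hx => by simp [hk3 x hx, hS x hx])
          (hm _ hk1.continuous) t
        refine le_trans (le_of_eq ?_) h
        congr 1
        funext x
        push_cast
        ring
      have e2 := aemeasurable_transformSq (r := 2 * (k + 1 : ℝ))
          (F := fun x => (ζ k x : ℂ) * u.toFun x) (fun x hx => by simp [hk3 x hx])
          (hm _ hk1.continuous)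
      have e3 := lintegral_transformSq (r := 2 * (k + 1 : ℝ))
          (F := fun x => ((ζ S x - ζ k x : ℝ) : ℂ) * u.toFun x)
          (fun x hx => by simp [hk3 x hx, hS x hx])
          (hm _ ((hζ S).1.continuous.sub hk1.continuous))
      calc _ ≤ cellConst n * ∫⁻ t in J N, (2 * transformSq (fun x => (ζ k x : ℂ) * u.toFun x) t +
          2 * transformSq (fun x => ((ζ S x - ζ k x : ℝ) : ℂ) * u.toFun x) t) ∂(cellMeasure n) :=
            mul_le_mul' le_rfl (lintegral_mono e1)
        _ = 2 * (cellConst n * ∫⁻ t in J N, transformSq (fun x => (ζ k x : ℂ) * u.toFun x) t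
              ∂(cellMeasure n)) +
            2 * (cellConst n * ∫⁻ t in J N,
              transformSq (fun x => ((ζ S x - ζ k x : ℝ) : ℂ) * u.toFun x) t ∂(cellMeasure n)) := by
          rw [lintegral_add_left' (e2.restrict.const_mul 2), lintegral_const_mul' _ _ (by simp),
            lintegral_const_mul' _ _ (by simp)]
          ring
        _ ≤ _ := by
          refine add_le_add (mul_le_mul' le_rfl (hbound (ζ k) hk1 _ hk3 _ hk5))
            (mul_le_mul' le_rfl ?_)
          exact (mul_le_mul' le_rfl (setLIntegral_le_lintegral _ _)).trans
            (e3.le.trans (hdiff hSk))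
    have hlim0 : Filter.Tendsto (fun k : ℕ => ((M / (k + 1) : ℝ≥0) : ENNReal)) Filter.atTop
        (nhds 0) := by
      rw [← ENNReal.coe_zero, ENNReal.tendsto_coe, ← NNReal.tendsto_coe]
      have h := (tendsto_one_div_add_atTop_nhds_zero_nat (𝕜 := ℝ)).const_mul (M : ℝ)
      rw [mul_zero] at h
      refine h.congr fun k => ?_
      push_cast
      ring
    have hlim : Filter.Tendsto (fun k : ℕ => 2 * (C * ((M / (k + 1) : ℝ≥0) : ENNReal) ^ 2) +
        2 * tail S) Filter.atTop (nhds (2 * (C * 0 ^ 2) + 2 * tail S)) := by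
      refine Filter.Tendsto.add ?_ tendsto_const_nhds
      refine ENNReal.Tendsto.const_mul (ENNReal.Tendsto.const_mul ?_ (Or.inr hC)) (Or.inr (by simp))
      exact ((ENNReal.continuous_pow 2).tendsto 0).comp hlim0
    have h := ge_of_tendsto hlim (Filter.eventually_atTop.2 ⟨S, hk⟩)
    simpa using h
  -- the coercive sets exhaust almost all quasimomenta, so Plancherel's theorem applies
  have hbig : ∀ S : ℕ, ∫⁻ x, ‖(ζ S x : ℂ) * u.toFun x‖ₑ ^ 2 ≤ 2 * tail S := fun S => by
    rw [← lintegral_transformSq (r := 2 * (S + 1 : ℝ)) (fun x hx => by simp [(hζ S).2.2.1 x hx])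
      (hm _ (hζ S).1.continuous)]
    have h1 : (cellMeasure n).restrict (⋃ N, J N) = cellMeasure n :=
      Measure.restrict_eq_self_of_ae_mem (ae_mem_coerciveSet g hn hq z hinj)
    rw [← h1, setLIntegral_iUnion_of_directed _ (monotone_coerciveSet g hn hq z).directed_le,
      ENNReal.mul_iSup]
    exact iSup_le fun N => hstep N S
  have hU : ∀ S : ℕ, ∫⁻ x, ‖u.toFun x‖ₑ ^ 2 ≤ 3 * tail S := fun S => by
    rw [← lintegral_add_compl _ (Metric.isClosed_closedBall (x := (0 : Space n))
      (ε := (S + 1 : ℝ))).measurableSet]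
    have h1 : ∫⁻ x in Metric.closedBall (0 : Space n) (S + 1), ‖u.toFun x‖ₑ ^ 2 ≤ 2 * tail S := by
      refine le_trans ?_ (hbig S)
      rw [← lintegral_indicator Metric.isClosed_closedBall.measurableSet]
      refine lintegral_mono fun x => ?_
      by_cases hx : x ∈ Metric.closedBall (0 : Space n) (S + 1)
      · rw [Set.indicator_of_mem hx, (hζ S).2.1 x (by simpa using hx)]
        simp
      · rw [Set.indicator_of_notMem hx]
        exact zero_le
    calc _ ≤ 2 * tail S + tail S := add_le_add h1 le_rfl
      _ = _ := by ring
  have htail0 : Filter.Tendsto tail Filter.atTop (nhds 0) := by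
    have h := tendsto_lintegral_of_dominated_convergence' (μ := (volume : Measure (Space n)))
      (F := fun (k : ℕ) => (Metric.closedBall (0 : Space n) (k + 1))ᶜ.indicator
        fun x => ‖u.toFun x‖ₑ ^ 2) (f := fun _ => 0) (fun x => ‖u.toFun x‖ₑ ^ 2)
      (fun k => (u.memLp.1.enorm.pow_const 2).indicator
        Metric.isClosed_closedBall.measurableSet.compl)
      (fun k => Filter.Eventually.of_forall fun x =>
        Set.indicator_le_self _ (fun x => ‖u.toFun x‖ₑ ^ 2) x) hUt
      (Filter.Eventually.of_forall fun x => by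
        obtain ⟨k₀, hk₀⟩ := exists_nat_ge ‖x‖
        refine tendsto_const_nhds.congr' ?_
        filter_upwards [Filter.eventually_ge_atTop k₀] with k hk
        rw [Set.indicator_of_notMem]
        have : (k₀ : ℝ) ≤ k := by exact_mod_cast hk
        simp only [Set.mem_compl_iff, mem_closedBall_zero_iff, not_not]
        linarith)
    simp only [lintegral_zero] at h
    refine h.congr fun k => ?_
    simp only [htail]
    rw [lintegral_indicator Metric.isClosed_closedBall.measurableSet.compl]
  have hzero : ∫⁻ x, ‖u.toFun x‖ₑ ^ 2 = 0 := by
    have h := ENNReal.Tendsto.const_mul (a := 3) htail0 (Or.inr (by simp))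
    rw [mul_zero] at h
    exact le_antisymm (ge_of_tendsto' h hU) zero_le
  rw [lintegral_eq_zero_iff' (u.memLp.1.enorm.pow_const 2)] at hzero
  filter_upwards [hzero] with x hx
  simpa using hx

end PeriodicSchrodinger

end

theorem propositionA1 {n : ℕ} (hn : 3 ≤ n) (g : PeriodicSchrodinger.PeriodicMetric n)
    (q : PeriodicSchrodinger.Space n → ℂ) (hq : PeriodicSchrodinger.IsPeriodicPotential q)
    (z : ℂ)
    (hker : ∃ θ : Fin n → ℂ, PeriodicSchrodinger.TorusKernelTrivial g q θ z) :
    ¬ PeriodicSchrodinger.IsEigenvalue g q z := by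
  obtain ⟨θ, hθ⟩ := hker
  rintro ⟨u, ⟨-, hu⟩, hne⟩
  exact hne (PeriodicSchrodinger.ae_eq_zero_of_injective g hn hq z
    (PeriodicSchrodinger.injective_blochOp g hn hq z θ hθ) u hu)
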